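/- Let $n\ge 1$ be an integer and let $\lambda$ be a nonzero real number. Consider the class $\mathscr P_\lambda$ of the nonlinear Schrödinger equations $$i\psi_t+\psi_{aa}+\delta\rho^\lambda\psi+V(t,x)\psi=0,\qquad \rho:=|\psi|\neq 0,$$ for a complex-valued unknown function $\psi$ of the real variables $t$ and $x=(x_1,\dots,x_n)$. The arbitrary elements of the class are the nonzero complex constant $\delta$ and the smooth complex-valued potential $V(t,x)$. Indices $a,b$ run from $1$ to $n$, summation over repeated indices is assumed, subscripts of functions denote derivatives and $^*$ denotes complex conjugation. All transformations are local: they are considered on nonempty open sets of points $(t,x,\psi)$ with $\psi\ne0$ whose set of values of $t$ is an interval and whose slices $t=\mathrm{const}$ are connected, and potentials are defined over the corresponding sets of points $(t,x)$. A point transformation is a smooth map with nowhere vanishing Jacobian; it maps one equation to another if its second prolongation maps the manifold defined by the first equation in the second-order jet space to the one defined by the second. An admissible transformation of $\mathscr P_\lambda$ is a triple consisting of two tuples $\theta=(\delta,V)$, $\tilde\theta=(\tilde\delta,\tilde V)$ of arbitrary elements of the class and a point transformation $\varphi$ in the space with the coordinates $(t,x,\psi,\psi^*)$ that maps the equation with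 $\theta$ to the equation with $\tilde\theta$. The equivalence group $G^\sim_{\mathscr P_\lambda}$ consists of the point transformations $\Phi$ in the space with the coordinates $(t,x,\psi,\psi^*,\delta,\delta^*,V,V^*)$, defined for all $\delta\neq0$ and all $V$, that are projectable to the space with the coordinates $(t,x,\psi,\psi^*)$ and map every equation of the class to an equation of the class: for every $\theta$ of the class there is $\tilde\theta=\Phi\theta$ of the class such that $\Phi$ maps the graph of $\theta$ to that of $\tilde\theta$ and the projection of $\Phi$ maps the equation with $\theta$ to the equation with $\tilde\theta$. The class is called normalized if for each of its admissible transformations $(\theta,\varphi,\tilde\theta)$ there is $\Phi\in G^\sim_{\mathscr P_\lambda}$ such that $\tilde\theta=\Phi\theta$ and $\varphi$ is the projection of $\Phi$. Then the class $\mathscr P_\lambda$ is normalized. Its equivalence group $G^\sim_{\mathscr P_\lambda}$ consists exactly of the transformations of the form $$\tilde t=T,\qquad \tilde x_a=|T_t|^{1/2}O^{ab}x_b+\mathcal X^a,$$ $$\tilde\psi=\exp\left(\frac i8\frac{T_{tt}}{|T_t|}x_ax_a+\frac i2\frac{\varepsilon'\mathcal X^b_t}{|T_t|^{1/2}}O^{ba}x_a+i\Sigma+Z\right)\hat\psi,$$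 $$\tilde\delta=\frac{\hat\delta}{\mu^\lambda},\qquad \tilde V=\frac{\hat V}{|T_t|}+\frac{2T_{ttt}T_t-3T_{tt}^2}{16\varepsilon'T_t^3}x_ax_a+\frac{\varepsilon'}2\left(\frac{\mathcal X^b_t}{T_t}\right)_{\!t}\frac{O^{ba}x_a}{|T_t|^{1/2}}+\frac{\Sigma_t}{T_t}-\frac{\mathcal X^a_t\mathcal X^a_t}{4T_t^2}+i\lambda'\frac{T_{tt}}{T_t^2},$$ the components for $\psi^*,\delta^*,V^*$ being the complex conjugates of those for $\psi,\delta,V$. Here $\lambda':=1/\lambda-n/4$; $T$, $\mathcal X^a$ and $\Sigma$ are arbitrary smooth real-valued functions of $t$ with $T_t\ne0$; $\varepsilon':=\operatorname{sgn}T_t$; $O=(O^{ab})$ is an arbitrary constant orthogonal $n\times n$ matrix; $\mu$ is an arbitrary positive real constant; $Z$ is the real-valued function of $t$ with $e^Z=\mu|T_t|^{-1/\lambda}$; and $\hat\beta=\beta$ if $T_t>0$, $\hat\beta=\beta^*$ if $T_t<0$. -/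

import Mathlib

open scoped ContDiff

noncomputable section

namespace PowerNLS

/-- The space of the independent variables `(t, x)`, where `x = (x₁, …, xₙ)`. -/
abbrev Base (n : ℕ) : Type := ℝ × EuclideanSpace ℝ (Fin n)

/-- The space with the coordinates `(t, x, ψ, ψ*)`. The coordinate `ψ*` is the complex conjugate
of `ψ`, so that a point is a triple `((t, x), ψ)` and the space is a real vector space of
dimension `1 + n + 2`; its maps are differentiated over `ℝ`. -/
abbrev Var (n : ℕ) : Type := Base n × ℂ

/-- The space with the coordinates `(t, x, ψ, ψ*, δ, δ*, V, V*)`, a point being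
`(((t, x), ψ), δ, V)`. -/
abbrev ExtVar (n : ℕ) : Type := Var n × ℂ × ℂ

/-- The values of `t` on a set of points `((t, x), ψ)`. -/
def timesOf {n : ℕ} (U : Set (Var n)) : Set ℝ := (fun p : Var n => p.1.1) '' U

/-- The values of `(t, x)` on a set of points `((t, x), ψ)`. -/
def baseOf {n : ℕ} (U : Set (Var n)) : Set (Base n) := Prod.fst '' U

/-- The domains on which (local) point transformations are considered: nonempty open sets of
points `((t, x), ψ)` with `ψ ≠ 0` (where the power `|ψ| ^ lam` is smooth) that lie over an interval
of values of `t` and have connected slices `t = const`. Every point with `ψ ≠ 0` has arbitrarily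
small neighbourhoods of this kind, for instance products of an interval and two balls. -/
structure IsVarDomain {n : ℕ} (U : Set (Var n)) : Prop where
  isOpen : IsOpen U
  nonempty : U.Nonempty
  ne_zero : ∀ p ∈ U, p.2 ≠ 0
  times_connected : IsPreconnected (timesOf U)
  slice_connected : ∀ t : ℝ,
    IsPreconnected {q : EuclideanSpace ℝ (Fin n) × ℂ | ((t, q.1), q.2) ∈ U}

/-- A value of the tuple of arbitrary elements: a constant `δ` and a potential `V(t, x)`. -/
structure ArbElem (n : ℕ) where
  δ : ℂ
  V : Base n → ℂ

/-- `θ = (δ, V)` is a value of the arbitrary elements of the class over the set `Ω` of points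
`(t, x)`: the constant `δ` is nonzero and `V` is smooth on `Ω`. -/
def InClass {n : ℕ} (Ω : Set (Base n)) (θ : ArbElem n) : Prop :=
  θ.δ ≠ 0 ∧ ContDiffOn ℝ ∞ θ.V Ω

/-- The function `u` satisfies the equation `i ψ_t + ψ_{aa} + δ |ψ|^lam ψ + V(t, x) ψ = 0`
at the point `p = (t, x)`. -/
def SatisfiesAt {n : ℕ} (lam : ℝ) (θ : ArbElem n) (u : Base n → ℂ) (p : Base n) : Prop :=
  Complex.I * deriv (fun s : ℝ => u (s, p.2)) p.1
    + Laplacian.laplacian (fun y : EuclideanSpace ℝ (Fin n) => u (p.1, y)) p.2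
    + θ.δ * ((‖u p‖ ^ lam : ℝ) : ℂ) * u p + θ.V p * u p = 0

/-- A point transformation `(t, x, ψ, ψ*) ↦ (T, X, Ψ, Ψ*)` on `U`: a smooth map of the space of
the variables with nondegenerate Jacobian. -/
def IsPointTransformation {n : ℕ} (U : Set (Var n)) (φ : Var n → Var n) : Prop :=
  ContDiffOn ℝ ∞ φ U ∧ (∀ p ∈ U, Function.Bijective (fderiv ℝ φ p)) ∧ ∀ p ∈ U, (φ p).2 ≠ 0

/-- The point transformation `φ` on `U` maps the equation with the arbitrary elements `θ` to the
equation with the arbitrary elements `θ'`, that is, the second prolongation of `φ` maps the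
manifold that the first equation defines in the jet space to the one that the second defines.
A 2-jet is represented by a function `u` near `p`; its image under the prolongation is represented
by the function `u'` whose graph is, locally, the image of the graph of `u` under `φ`. -/
def MapsEquation {n : ℕ} (lam : ℝ) (U : Set (Var n)) (φ : Var n → Var n)
    (θ θ' : ArbElem n) : Prop :=
  ∀ (p : Base n) (u u' : Base n → ℂ), (p, u p) ∈ U →
    ContDiffAt ℝ 2 u p → ContDiffAt ℝ 2 u' (φ (p, u p)).1 →
    (∀ᶠ q in nhds p, u' (φ (q, u q)).1 = (φ (q, u q)).2) →
    (SatisfiesAt lam θ u p ↔ SatisfiesAt lam θ' u' (φ (p, u p)).1)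

/-- The triple `(θ, φ, θ')` is an admissible transformation of the class, that is, an element of
its equivalence groupoid: both equations belong to the class and `φ` is a point transformation
that maps the first equation to the second one. -/
def IsAdmissible {n : ℕ} (lam : ℝ) (U : Set (Var n)) (θ : ArbElem n) (φ : Var n → Var n)
    (θ' : ArbElem n) : Prop :=
  InClass (baseOf U) θ ∧ InClass (baseOf (φ '' U)) θ' ∧ IsPointTransformation U φ ∧
    MapsEquation lam U φ θ θ'

/-- The part of the extended space over `U`, with all values `δ ≠ 0` and `V` of the arbitrary
elements. -/
def extDomain {n : ℕ} (U : Set (Var n)) : Set (ExtVar n) := {P | P.1 ∈ U ∧ P.2.1 ≠ 0}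

/-- The map `Φ` of the extended space is projectable to the space of the variables over `U`, and
its projection is `φ`. -/
def ProjectsTo {n : ℕ} (U : Set (Var n)) (Φ : ExtVar n → ExtVar n) (φ : Var n → Var n) : Prop :=
  ∀ P ∈ extDomain U, (Φ P).1 = φ P.1

/-- The map `Φ` of the extended space takes the arbitrary elements `θ` to `θ'`: it maps the graph
of `θ` over `U` into the graph of `θ'`. -/
def MapsArbElem {n : ℕ} (U : Set (Var n)) (Φ : ExtVar n → ExtVar n) (θ θ' : ArbElem n) : Prop :=
  ∀ p ∈ U, (Φ (p, θ.δ, θ.V p.1)).2 = (θ'.δ, θ'.V (Φ (p, θ.δ, θ.V p.1)).1.1)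

/-- `Φ` is (over `U`) an element of the equivalence group of the class: a point transformation in
the space with the coordinates `(t, x, ψ, ψ*, δ, δ*, V, V*)` that is projectable to the space with
the coordinates `(t, x, ψ, ψ*)` and that maps every equation of the class to an equation of the
class. -/
def IsEquivTransformation {n : ℕ} (lam : ℝ) (U : Set (Var n)) (Φ : ExtVar n → ExtVar n) : Prop :=
  ContDiffOn ℝ ∞ Φ (extDomain U) ∧
    (∀ P ∈ extDomain U, Function.Bijective (fderiv ℝ Φ P)) ∧
    ∃ φ : Var n → Var n, ProjectsTo U Φ φ ∧
      ∀ θ : ArbElem n, InClass (baseOf U) θ →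
        ∃ θ' : ArbElem n, MapsArbElem U Φ θ θ' ∧ IsAdmissible lam U θ φ θ'

/-- The class is normalized: each of its admissible transformations `(θ, φ, θ')` is induced by an
element `Φ` of its equivalence group, `θ' = Φ θ` and `φ` is the projection of `Φ`. -/
def IsNormalized (n : ℕ) (lam : ℝ) : Prop :=
  ∀ U : Set (Var n), IsVarDomain U → ∀ (θ θ' : ArbElem n) (φ : Var n → Var n),
    IsAdmissible lam U θ φ θ' →
      ∃ Φ : ExtVar n → ExtVar n,
        IsEquivTransformation lam U Φ ∧ ProjectsTo U Φ φ ∧ MapsArbElem U Φ θ θ'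

/-- `hat r β` is `β` if `r > 0` and the complex conjugate of `β` if `r < 0`; it is used with
`r = T_t`. -/
def hat (r : ℝ) (β : ℂ) : ℂ := if 0 < r then β else (starRingEnd ℂ) β

/-- The exponent
`(i/8) (T_tt/|T_t|) x_a x_a + (i/2) (ε' X^b_t/|T_t|^{1/2}) O^{ba} x_a + i Σ + Z`
of the factor that multiplies `hat ψ`. -/
def psiExponent {n : ℕ} (T : ℝ → ℝ) (X : Fin n → ℝ → ℝ) (S Z : ℝ → ℝ)
    (O : Matrix (Fin n) (Fin n) ℝ) (t : ℝ) (x : EuclideanSpace ℝ (Fin n)) : ℂ :=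
  Complex.I *
      ((1 / 8 * (deriv (deriv T) t / |deriv T t|) * ∑ a, x a * x a
        + 1 / 2 * ∑ b, ∑ a,
            Real.sign (deriv T t) * deriv (X b) t / √|deriv T t| * O b a * x a
        + S t : ℝ) : ℂ)
    + (Z t : ℂ)

/-- The real part of the inhomogeneity in the transformation law of the potential:
`(2 T_ttt T_t - 3 T_tt²)/(16 ε' T_t³) x_a x_a + (ε'/2) (X^b_t/T_t)_t O^{ba} x_a/|T_t|^{1/2}
+ Σ_t/T_t - X^a_t X^a_t/(4 T_t²)`. -/
def potentialShift {n : ℕ} (T : ℝ → ℝ) (X : Fin n → ℝ → ℝ) (S : ℝ → ℝ)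
    (O : Matrix (Fin n) (Fin n) ℝ) (t : ℝ) (x : EuclideanSpace ℝ (Fin n)) : ℝ :=
  (2 * deriv (deriv (deriv T)) t * deriv T t - 3 * deriv (deriv T) t ^ 2)
      / (16 * Real.sign (deriv T t) * deriv T t ^ 3) * ∑ a, x a * x a
    + Real.sign (deriv T t) / 2 *
      ∑ b, ∑ a, deriv (fun s => deriv (X b) s / deriv T s) t * (O b a * x a) / √|deriv T t|
    + deriv S t / deriv T t
    - (∑ a, deriv (X a) t * deriv (X a) t) / (4 * deriv T t ^ 2)

/-- `Φ` has, over `U`, the explicit form with some parameters `T`, `X^a`, `Σ` (here `S`), `Z`,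
`O`, `μ`: the functions `T`, `X^a`, `Σ`, `Z` of `t` are smooth and real-valued with `T_t ≠ 0`, the
constant matrix `O` is orthogonal, `μ` is a positive constant and `e^Z = μ |T_t|^{-1/lam}`. -/
def HasEquivForm {n : ℕ} (lam : ℝ) (U : Set (Var n)) (Φ : ExtVar n → ExtVar n) : Prop :=
  ∃ (T : ℝ → ℝ) (X : Fin n → ℝ → ℝ) (S Z : ℝ → ℝ) (O : Matrix (Fin n) (Fin n) ℝ) (μ : ℝ),
    ContDiffOn ℝ ∞ T (timesOf U) ∧ (∀ a, ContDiffOn ℝ ∞ (X a) (timesOf U)) ∧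
    ContDiffOn ℝ ∞ S (timesOf U) ∧ ContDiffOn ℝ ∞ Z (timesOf U) ∧
    (∀ t ∈ timesOf U, deriv T t ≠ 0) ∧
    O ∈ Matrix.orthogonalGroup (Fin n) ℝ ∧ 0 < μ ∧
    (∀ t ∈ timesOf U, Real.exp (Z t) = μ * |deriv T t| ^ (-1 / lam)) ∧
    ∀ (t : ℝ) (x : EuclideanSpace ℝ (Fin n)) (ψ δ V : ℂ),
      (((t, x), ψ), δ, V) ∈ extDomain U →
        (Φ (((t, x), ψ), δ, V)).1.1.1 = T t ∧
        (∀ a, (Φ (((t, x), ψ), δ, V)).1.1.2 a = √|deriv T t| * ∑ b, O a b * x b + X a t) ∧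
        (Φ (((t, x), ψ), δ, V)).1.2
          = Complex.exp (psiExponent T X S Z O t x) * hat (deriv T t) ψ ∧
        (Φ (((t, x), ψ), δ, V)).2.1 = hat (deriv T t) δ / ((μ ^ lam : ℝ) : ℂ) ∧
        (Φ (((t, x), ψ), δ, V)).2.2
          = hat (deriv T t) V / ((|deriv T t| : ℝ) : ℂ) + (potentialShift T X S O t x : ℂ)
            + Complex.I * (((1 / lam - n / 4) * (deriv (deriv T) t / deriv T t ^ 2) : ℝ) : ℂ)

end PowerNLS

end

open scoped ContDiff

noncomputable section

namespace PowerNLS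

open Filter Topology

/-! ### Second-order calculus and the prolongation of graphs -/

section SecondOrder

variable {E F G : Type*} [NormedAddCommGroup E] [NormedSpace ℝ E]
  [NormedAddCommGroup F] [NormedSpace ℝ F] [NormedAddCommGroup G] [NormedSpace ℝ G]

/-! Over a fixed point both equations are affine conditions on the 2-jet of the unknown function. A
point transformation that maps one to the other is determined by varying the source jet within its
equation and demanding that the image jet stay within its own.

First order. A symmetric second derivative with zero spatial trace is invisible to the source
equation, hence to the image equation. This forces the preimages of the spatial basis vectors to
have no `t`-component and to form a conformal frame (`JetCondition.sum_eq_zero`,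
`JetCondition.exists_conformal`). Trading an increment of `ψ_t` against the trace fixes the
conformal factor as `|T_t|` and makes the derivative in `ψ` complex linear or antilinear, according
to the sign of `T_t` (`JetCondition.conformal_factor`, `JetCondition.first_order`). Because the
factor depends on `t` only, the new `x` is affine in `x` for fixed `t`, in low dimensions too
(`sliceStructure_of_mapsEquation`).

Second order. Varying `ψ_x` shows that the new unknown function `Ψ` is affine in `ψ` or `ψ*` and
determines `Ψ_{xψ}` (`second_order`). What remains is an identity in `ψ` between two power
nonlinearities. The operator `∂/∂ψ̄` kills its affine terms, and comparing moduli shows that `Ψ` has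
no `ψ`-free term (`affine_shift_eq_zero`, `fiber_homogeneous`).

Integration. The logarithmic derivative of `Ψ` in `x` is now known. The symmetry of `Ψ_xx` leaves no
room for a time-dependent rotation, so the linear part of the new `x` is `|T_t|^{1/2}` times a
constant orthogonal matrix. The phase is then quadratic in `x`, and the remaining factor depends on
`t` alone (`exists_varForm`).

Law of the arbitrary elements. For a transformation of this form the image equation is a nonzero
multiple of the source equation, conjugated if `T_t < 0`, plus `Ψ` times a defect free of
derivatives of the unknown function (`HasVarForm.image_equation`). Changing `|ψ|` over one point
separates the nonlinear coefficient from the potential. Since `δ` and its image are constants, `e^Z`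
must be a constant times `|T_t|^{-1/λ}`. The resulting law makes sense for all arbitrary elements at
once, which is normalization. Conversely, the equations with constant potentials already determine
every component of an equivalence transformation. -/

theorem differentiableAt_fderiv {f : E → F} {p : E} (hf : ContDiffAt ℝ 2 f p) :
    DifferentiableAt ℝ (fderiv ℝ f) p :=
  (hf.fderiv_right (m := 1) (by norm_num)).differentiableAt (by norm_num)

theorem eventually_differentiableAt {f : E → F} {p : E} (hf : ContDiffAt ℝ 2 f p) :
    ∀ᶠ q in 𝓝 p, DifferentiableAt ℝ f q := by
  filter_upwards [(hf.of_le (by norm_num) : ContDiffAt ℝ 1 f p).eventually (by simp)] with q hq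
  exact hq.differentiableAt (by norm_num)

/-- The chain rule for second derivatives. -/
theorem fderiv_fderiv_comp {g : F → G} {f : E → F} {p : E} (hf : ContDiffAt ℝ 2 f p)
    (hg : ContDiffAt ℝ 2 g (f p)) (v w : E) :
    fderiv ℝ (fderiv ℝ (fun q => g (f q))) p v w
      = fderiv ℝ (fderiv ℝ g) (f p) (fderiv ℝ f p v) (fderiv ℝ f p w)
        + fderiv ℝ g (f p) (fderiv ℝ (fderiv ℝ f) p v w) := by
  have hev : fderiv ℝ (fun q => g (f q)) =ᶠ[𝓝 p]
      fun q => (fderiv ℝ g (f q)).comp (fderiv ℝ f q) := by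
    filter_upwards [eventually_differentiableAt hf,
      hf.continuousAt.eventually (eventually_differentiableAt hg)] with q h1 h2
    exact fderiv_fun_comp q h2 h1
  have hfd : HasFDerivAt f (fderiv ℝ f p) p :=
    (hf.differentiableAt (by norm_num)).hasFDerivAt
  have h1 := (differentiableAt_fderiv hg).hasFDerivAt.comp p hfd
  have h2 := (differentiableAt_fderiv hf).hasFDerivAt
  rw [hev.fderiv_eq]
  have h3 := (h1.clm_comp h2).fderiv
  have h4 : fderiv ℝ (fun q => (fderiv ℝ g (f q)).comp (fderiv ℝ f q)) p = _ := h3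
  rw [h4]
  simp [add_comm]

theorem fderiv_graph {u : E → F} {p : E} (hu : DifferentiableAt ℝ u p) (v : E) :
    fderiv ℝ (fun q => (q, u q)) p v = (v, fderiv ℝ u p v) := by
  have h : HasFDerivAt (fun q => (q, u q)) _ p := (hasFDerivAt_id p).prodMk hu.hasFDerivAt
  rw [h.fderiv]
  rfl

theorem fderiv_fderiv_graph {u : E → F} {p : E} (hu : ContDiffAt ℝ 2 u p) (v w : E) :
    fderiv ℝ (fderiv ℝ (fun q => (q, u q))) p v w = (0, fderiv ℝ (fderiv ℝ u) p v w) := by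
  have hev : fderiv ℝ (fun q => (q, u q)) =ᶠ[𝓝 p]
      fun q => ContinuousLinearMap.inl ℝ E F
        + (ContinuousLinearMap.inr ℝ E F).comp (fderiv ℝ u q) := by
    filter_upwards [eventually_differentiableAt hu] with q h1
    ext1 v
    rw [fderiv_graph h1 v]
    simp
  have h1 : HasFDerivAt (fun q => ContinuousLinearMap.inl ℝ E F
      + (ContinuousLinearMap.inr ℝ E F).comp (fderiv ℝ u q)) _ p :=
    ((hasFDerivAt_const (ContinuousLinearMap.inr ℝ E F) p).clm_comp
      (differentiableAt_fderiv hu).hasFDerivAt).const_add _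
  rw [hev.fderiv_eq, h1.fderiv]
  simp

theorem fderiv_fderiv_clm_comp {f : E → F} {p : E} (hf : ContDiffAt ℝ 2 f p) (l : F →L[ℝ] G)
    (v w : E) :
    fderiv ℝ (fderiv ℝ (fun q => l (f q))) p v w = l (fderiv ℝ (fderiv ℝ f) p v w) := by
  rw [fderiv_fderiv_comp (g := l) hf l.contDiff.contDiffAt]
  have : fderiv ℝ (l : F → G) = fun _ => l := by ext1 x; exact l.fderiv
  rw [this]
  simp

theorem fderiv_clm_comp {f : E → F} {p : E} (hf : DifferentiableAt ℝ f p) (l : F →L[ℝ] G)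
    (v : E) : fderiv ℝ (fun q => l (f q)) p v = l (fderiv ℝ f p v) := by
  have : HasFDerivAt (fun q => l (f q)) _ p := l.hasFDerivAt.comp p hf.hasFDerivAt
  rw [this.fderiv]; rfl

/-- If the image of the graph of `u` under `φ` is locally the graph of `u'`, then the 1-jets
of `u` and `u'` are related by the first prolongation of `φ`. -/
theorem prolong_fst {φ : E × F → E × F} {p : E} {u u' : E → F}
    (hφ : ContDiffAt ℝ 2 φ (p, u p)) (hu : ContDiffAt ℝ 2 u p)
    (hu' : ContDiffAt ℝ 2 u' (φ (p, u p)).1)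
    (hev : ∀ᶠ q in 𝓝 p, u' (φ (q, u q)).1 = (φ (q, u q)).2) (v : E) :
    (fderiv ℝ φ (p, u p) (v, fderiv ℝ u p v)).2
      = fderiv ℝ u' (φ (p, u p)).1 (fderiv ℝ φ (p, u p) (v, fderiv ℝ u p v)).1 := by
  have hud := hu.differentiableAt (by norm_num)
  have hG : DifferentiableAt ℝ (fun q => (q, u q)) p := differentiableAt_id.prodMk hud
  have hφG : DifferentiableAt ℝ (fun q => φ (q, u q)) p :=
    (hφ.differentiableAt (by norm_num)).comp (f := fun q => (q, u q)) p hG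
  have h1 : fderiv ℝ (fun q => φ (q, u q)) p v = fderiv ℝ φ (p, u p) (v, fderiv ℝ u p v) := by
    rw [← fderiv_graph hud, fderiv_fun_comp (f := fun q => (q, u q)) p
      (hφ.differentiableAt (by norm_num)) hG]
    rfl
  have h2 : (fun q => u' (φ (q, u q)).1) =ᶠ[𝓝 p] fun q => (φ (q, u q)).2 := hev
  have h3 := congrArg (fun l : E →L[ℝ] F => l v) h2.fderiv_eq
  have h4 := fderiv_clm_comp hφG (ContinuousLinearMap.snd ℝ E F) v
  have h5 := fderiv_clm_comp hφG (ContinuousLinearMap.fst ℝ E F) v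
  simp only [ContinuousLinearMap.coe_snd', ContinuousLinearMap.coe_fst'] at h4 h5
  rw [← h1, ← h4, ← h5, ← h3, fderiv_fun_comp (f := fun q => (φ (q, u q)).1) p
    (hu'.differentiableAt (by norm_num)) hφG.fst]
  rfl

/-- If the image of the graph of `u` under `φ` is locally the graph of `u'`, then the second
derivatives of `u` and `u'` are related by the second prolongation of `φ`. -/
theorem prolong_snd {φ : E × F → E × F} {p : E} {u u' : E → F}
    (hφ : ContDiffAt ℝ 2 φ (p, u p)) (hu : ContDiffAt ℝ 2 u p)
    (hu' : ContDiffAt ℝ 2 u' (φ (p, u p)).1)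
    (hev : ∀ᶠ q in 𝓝 p, u' (φ (q, u q)).1 = (φ (q, u q)).2) (v w : E) :
    fderiv ℝ (fderiv ℝ u') (φ (p, u p)).1 (fderiv ℝ φ (p, u p) (v, fderiv ℝ u p v)).1
        (fderiv ℝ φ (p, u p) (w, fderiv ℝ u p w)).1
      = (fderiv ℝ (fderiv ℝ φ) (p, u p) (v, fderiv ℝ u p v) (w, fderiv ℝ u p w)
          + fderiv ℝ φ (p, u p) (0, fderiv ℝ (fderiv ℝ u) p v w)).2
        - fderiv ℝ u' (φ (p, u p)).1
          (fderiv ℝ (fderiv ℝ φ) (p, u p) (v, fderiv ℝ u p v) (w, fderiv ℝ u p w)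
          + fderiv ℝ φ (p, u p) (0, fderiv ℝ (fderiv ℝ u) p v w)).1 := by
  have hud := hu.differentiableAt (by norm_num)
  have hG : ContDiffAt ℝ 2 (fun q => (q, u q)) p := contDiffAt_id.prodMk hu
  have hφG : ContDiffAt ℝ 2 (fun q => φ (q, u q)) p :=
    ContDiffAt.comp (f := fun q => (q, u q)) p hφ hG
  have h1 : ∀ v, fderiv ℝ (fun q => φ (q, u q)) p v
      = fderiv ℝ φ (p, u p) (v, fderiv ℝ u p v) := by
    intro v
    rw [← fderiv_graph hud, fderiv_fun_comp (f := fun q => (q, u q)) p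
      (hφ.differentiableAt (by norm_num)) (hG.differentiableAt (by norm_num))]
    rfl
  have h2 : (fun q => u' (φ (q, u q)).1) =ᶠ[𝓝 p] fun q => (φ (q, u q)).2 := hev
  have h3 := congrArg (fun l : E →L[ℝ] E →L[ℝ] F => l v w) h2.fderiv.fderiv_eq
  have h4 := fderiv_fderiv_clm_comp hφG (ContinuousLinearMap.snd ℝ E F) v w
  have h5 := fderiv_fderiv_clm_comp hφG (ContinuousLinearMap.fst ℝ E F) v w
  have h6 := fun v => fderiv_clm_comp (hφG.differentiableAt (by norm_num))
    (ContinuousLinearMap.fst ℝ E F) v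
  simp only [ContinuousLinearMap.coe_snd', ContinuousLinearMap.coe_fst'] at h4 h5 h6
  have h7 := fderiv_fderiv_comp (g := φ) hG hφ v w
  simp only [fderiv_graph hud, fderiv_fderiv_graph hu] at h7
  -- The chain rule on the left yields the second derivative of `u'` plus `fderiv u'` applied to the
  -- second derivative of the base component; the latter becomes the subtracted term.
  have h8 := fderiv_fderiv_comp (f := fun q => (φ (q, u q)).1) hφG.fst hu' v w
  rw [← h7, ← h4, ← h5, ← h1, ← h1, ← h6, ← h6, ← h3]
  rw [h8]
  simp

/-- Every 2-jet whose image under the first prolongation of `φ` is defined is the 2-jet of a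
function the graph of which is mapped by `φ` to the graph of a function. -/
theorem exists_prolongation [CompleteSpace E] {φ : E × F → E × F} {p : E} {ψ : F}
    (hφ : ContDiffAt ℝ 2 φ (p, ψ)) (m : E →L[ℝ] F) (B : E →L[ℝ] E →L[ℝ] F)
    (hB : ∀ v w, B v w = B w v) (e : E ≃L[ℝ] E)
    (he : ∀ v, (fderiv ℝ φ (p, ψ) (v, m v)).1 = e v) :
    ∃ u u' : E → F, u p = ψ ∧ ContDiffAt ℝ 2 u p ∧ ContDiffAt ℝ 2 u' (φ (p, ψ)).1 ∧
      (∀ᶠ q in 𝓝 p, u' (φ (q, u q)).1 = (φ (q, u q)).2) ∧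
      fderiv ℝ u p = m ∧ fderiv ℝ (fderiv ℝ u) p = B := by
  -- The quadratic polynomial with the prescribed 2-jet; symmetry of `B` is what makes `B` its
  -- second derivative.
  set u : E → F := fun q => ψ + m (q - p) + (1 / 2 : ℝ) • B (q - p) (q - p) with hu_def
  have hup : u p = ψ := by simp [hu_def]
  have hud : ∀ q, HasFDerivAt u (m + B (q - p)) q := by
    intro q
    have h0 : HasFDerivAt (fun q : E => q - p) (ContinuousLinearMap.id ℝ E) q :=
      (hasFDerivAt_id q).sub_const p
    have h1 : HasFDerivAt (fun q : E => m (q - p)) (m.comp (ContinuousLinearMap.id ℝ E)) q :=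
      m.hasFDerivAt.comp q h0
    have h2 : HasFDerivAt (fun q : E => B (q - p)) (B.comp (ContinuousLinearMap.id ℝ E)) q :=
      B.hasFDerivAt.comp q h0
    have h3 := (h1.const_add ψ).add ((h2.clm_apply h0).const_smul (1 / 2 : ℝ))
    refine h3.congr_fderiv ?_
    ext1 v
    have h4 := hB v (q - p)
    simp only [ContinuousLinearMap.comp_id, _root_.add_apply,
      _root_.smul_apply, ContinuousLinearMap.flip_apply, h4]
    module
  have hfd : fderiv ℝ u = fun q => m + B (q - p) := funext fun q => (hud q).fderiv
  have hfd2 : fderiv ℝ (fderiv ℝ u) p = B := by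
    rw [hfd]
    have h0 : HasFDerivAt (fun q : E => q - p) (ContinuousLinearMap.id ℝ E) p :=
      (hasFDerivAt_id p).sub_const p
    have h2 : HasFDerivAt (fun q : E => B (q - p)) (B.comp (ContinuousLinearMap.id ℝ E)) p :=
      B.hasFDerivAt.comp p h0
    have h3 : HasFDerivAt (fun q : E => m + B (q - p)) _ p := h2.const_add m
    rw [h3.fderiv]; rfl
  have hfdp : fderiv ℝ u p = m := by rw [hfd]; simp
  have huC : ContDiff ℝ 2 u := by
    have h0 : ContDiff ℝ 2 (fun q : E => q - p) := contDiff_id.sub contDiff_const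
    have h1 : ContDiff ℝ 2 (fun q : E => m (q - p)) := m.contDiff.comp h0
    have h2 : ContDiff ℝ 2 (fun q : E => B (q - p)) := B.contDiff.comp h0
    exact (contDiff_const.add h1).add (contDiff_const.smul (h2.clm_apply h0))
  have hφ' : ContDiffAt ℝ 2 φ (p, u p) := by rwa [hup]
  have hG : ContDiffAt ℝ 2 (fun q => (q, u q)) p := contDiffAt_id.prodMk huC.contDiffAt
  have hφG : ContDiffAt ℝ 2 (fun q => φ (q, u q)) p :=
    ContDiffAt.comp (f := fun q => (q, u q)) p hφ' hG
  have hyd : HasFDerivAt (fun q => (φ (q, u q)).1) (e : E →L[ℝ] E) p := by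
    refine (hφG.fst.differentiableAt (by norm_num)).hasFDerivAt.congr_fderiv ?_
    ext1 v
    have h6 := fderiv_clm_comp (hφG.differentiableAt (by norm_num))
      (ContinuousLinearMap.fst ℝ E F) v
    simp only [ContinuousLinearMap.coe_fst'] at h6
    rw [h6, fderiv_fun_comp (f := fun q => (q, u q)) p
      (hφ'.differentiableAt (by norm_num)) (hG.differentiableAt (by norm_num))]
    simp only [ContinuousLinearMap.coe_comp, Function.comp_apply, ContinuousLinearEquiv.coe_coe]
    rw [fderiv_graph (hud p).differentiableAt, hfdp, hup, he]
  have hyC : ContDiffAt ℝ 2 (fun q => (φ (q, u q)).1) p := hφG.fst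
  -- The base component along the graph of `u` has the invertible derivative `e`, so by the inverse
  -- function theorem the image of the graph is locally a graph over the new base.
  set g := hyC.localInverse hyd (by norm_num) with hg
  have hgC : ContDiffAt ℝ 2 g (φ (p, u p)).1 := hyC.to_localInverse hyd (by norm_num)
  have hgp : g (φ (p, u p)).1 = p := hyC.localInverse_apply_image hyd (by norm_num)
  have hgev : ∀ᶠ q in 𝓝 p, g (φ (q, u q)).1 = q :=
    (hyC.hasStrictFDerivAt' hyd (by norm_num)).eventually_left_inverse
  refine ⟨u, fun r => (φ (g r, u (g r))).2, hup, huC.contDiffAt, ?_, ?_, hfdp, hfd2⟩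
  · rw [← hup]
    refine ContDiffAt.comp (g := fun q => (φ (q, u q)).2) _ ?_ hgC
    rw [hgp]
    exact hφG.snd
  · filter_upwards [hgev] with q hq
    rw [hq]

end SecondOrder

/-! ### The equations as conditions on 2-jets -/

/-- The equation in terms of the Fréchet derivatives of the unknown function. -/
theorem satisfiesAt_iff {n : ℕ} {lam : ℝ} {θ : ArbElem n} {u : Base n → ℂ} {p : Base n}
    (hu : ContDiffAt ℝ 2 u p) (b : OrthonormalBasis (Fin n) ℝ (EuclideanSpace ℝ (Fin n))) :
    SatisfiesAt lam θ u p ↔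
      Complex.I * fderiv ℝ u p (1, 0) + ∑ i, fderiv ℝ (fderiv ℝ u) p (0, b i) (0, b i)
        + (θ.δ * ((‖u p‖ ^ lam : ℝ) : ℂ) * u p + θ.V p * u p) = 0 := by
  have h1 : deriv (fun s : ℝ => u (s, p.2)) p.1 = fderiv ℝ u p (1, 0) := by
    have h0 : HasDerivAt (fun s : ℝ => (s, p.2)) ((1 : ℝ), (0 : EuclideanSpace ℝ (Fin n))) p.1 :=
      (hasDerivAt_id p.1).prodMk (hasDerivAt_const p.1 p.2)
    have h2 : HasFDerivAt u (fderiv ℝ u p) (p.1, p.2) :=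
      (hu.differentiableAt (by norm_num)).hasFDerivAt
    exact (h2.comp_hasDerivAt p.1 h0).deriv
  -- The basis is left free because the image equation is best written in a basis adapted to the
  -- transformation.
  have h2 : Laplacian.laplacian (fun y : EuclideanSpace ℝ (Fin n) => u (p.1, y)) p.2
      = ∑ i, fderiv ℝ (fderiv ℝ u) p (0, b i) (0, b i) := by
    rw [InnerProductSpace.laplacian_eq_iteratedFDeriv_orthonormalBasis _ b]
    refine Finset.sum_congr rfl fun i _ => ?_
    rw [iteratedFDeriv_two_apply]
    have hd : ∀ q : EuclideanSpace ℝ (Fin n), HasFDerivAt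
        (fun y : EuclideanSpace ℝ (Fin n) => (p.1, y))
        (ContinuousLinearMap.inr ℝ ℝ (EuclideanSpace ℝ (Fin n))) q := fun q =>
      (hasFDerivAt_const p.1 q).prodMk (hasFDerivAt_id q)
    have hc : ContDiffAt ℝ 2 (fun y : EuclideanSpace ℝ (Fin n) => (p.1, y)) p.2 :=
      contDiffAt_const.prodMk contDiffAt_id
    have hf : fderiv ℝ (fun y : EuclideanSpace ℝ (Fin n) => (p.1, y))
        = fun _ => ContinuousLinearMap.inr ℝ ℝ (EuclideanSpace ℝ (Fin n)) :=
      funext fun q => (hd q).fderiv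
    rw [fderiv_fderiv_comp hc hu, hf]
    simp
  unfold SatisfiesAt
  rw [h1, h2, ← add_assoc]

variable {n : ℕ}

/-- The space of the variables `x`. -/
abbrev Space (n : ℕ) : Type := EuclideanSpace ℝ (Fin n)

/-- The standard orthonormal basis of the space of the variables `x`. -/
abbrev stdB (n : ℕ) : OrthonormalBasis (Fin n) ℝ (Space n) := EuclideanSpace.basisFun (Fin n) ℝ

/-- The terms `δ |ψ|^lam ψ + V ψ` of the equation. -/
def potTerm (lam : ℝ) (θ : ArbElem n) (P : Var n) : ℂ :=
  θ.δ * ((‖P.2‖ ^ lam : ℝ) : ℂ) * P.2 + θ.V P.1 * P.2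

/-- The linear form that vanishes on the graph of `m`. -/
def graphForm (m : Base n →L[ℝ] ℂ) : Var n →L[ℝ] ℂ :=
  ContinuousLinearMap.snd ℝ (Base n) ℂ - m.comp (ContinuousLinearMap.fst ℝ (Base n) ℂ)

@[simp] theorem graphForm_apply (m : Base n →L[ℝ] ℂ) (w : Var n) :
    graphForm m w = w.2 - m w.1 := rfl

/-- The condition on the first and second derivatives `D`, `Q` of a point transformation at a
point that expresses that its second prolongation maps the solution manifold over this point to
the solution manifold of the image equation; `F` and `F'` are the values of the terms without
derivatives. -/
def JetCondition (D : Var n →L[ℝ] Var n) (Q : Var n →L[ℝ] Var n →L[ℝ] Var n) (F F' : ℂ) : Prop :=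
  ∀ (m m' : Base n →L[ℝ] ℂ) (f : Fin n → Base n) (B : Base n →L[ℝ] Base n →L[ℝ] ℂ),
    (∀ v, (D (v, m v)).2 = m' (D (v, m v)).1) →
    (∀ a, (D (f a, m (f a))).1 = (0, stdB n a)) →
    (∀ v w, B v w = B w v) →
    (Complex.I * m (1, 0) + ∑ a, B (0, stdB n a) (0, stdB n a) + F = 0 ↔
      Complex.I * m' (1, 0)
        + ∑ a, graphForm m' (Q (f a, m (f a)) (f a, m (f a)) + D (0, B (f a) (f a))) + F' = 0)

/-! ### Jets with nondegenerate image -/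

/-- The linear map `v ↦ (D (v, m v)).1`. -/
def baseMap (D : Var n →L[ℝ] Var n) (m : Base n →L[ℝ] ℂ) : Base n →L[ℝ] Base n :=
  (ContinuousLinearMap.fst ℝ (Base n) ℂ).comp (D.comp ((ContinuousLinearMap.id ℝ _).prod m))

@[simp] theorem baseMap_apply (D : Var n →L[ℝ] Var n) (m : Base n →L[ℝ] ℂ) (v : Base n) :
    baseMap D m v = (D (v, m v)).1 := rfl

theorem exists_equiv_of_injective {E : Type*} [NormedAddCommGroup E] [NormedSpace ℝ E]
    [FiniteDimensional ℝ E] (A : E →L[ℝ] E) (hA : Function.Injective A) :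
    ∃ e : E ≃L[ℝ] E, ∀ v, A v = e v :=
  ⟨(LinearEquiv.ofInjectiveEndo A.toLinearMap hA).toContinuousLinearEquiv, fun _ => rfl⟩

/-- The image of a vector of the graph of `m` lies in the graph of `m'`; if its base part vanishes,
it vanishes entirely, and `D` is injective. -/
theorem baseMap_injective {D : Var n →L[ℝ] Var n} (hD : Function.Injective D)
    {m m' : Base n →L[ℝ] ℂ} (h : ∀ v, (D (v, m v)).2 = m' (D (v, m v)).1) :
    Function.Injective (baseMap D m) := by
  refine (injective_iff_map_eq_zero _).2 fun v hv => ?_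
  rw [baseMap_apply] at hv
  have h1 : D (v, m v) = 0 := Prod.ext hv (by rw [h, hv]; simp)
  have h2 := (injective_iff_map_eq_zero _).1 hD _ h1
  exact congrArg Prod.fst h2

theorem two_le_infty : (2 : ℕ∞ω) ≤ ∞ :=
  WithTop.coe_le_coe.2 (le_top : (2 : ℕ∞) ≤ ⊤)

/-- Passage from functions to jets: every 2-jet whose image is again a jet of a function is realised
by an actual pair `u`, `u'`, to which the hypothesis on the equations applies. -/
theorem jetCondition_of_mapsEquation {lam : ℝ} {U : Set (Var n)} {φ : Var n → Var n}
    {θ θ' : ArbElem n} (hU : IsOpen U) (hφ : ContDiffOn ℝ ∞ φ U)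
    (hM : MapsEquation lam U φ θ θ') {P : Var n} (hP : P ∈ U)
    (hD : Function.Injective (fderiv ℝ φ P)) :
    JetCondition (fderiv ℝ φ P) (fderiv ℝ (fderiv ℝ φ) P) (potTerm lam θ P)
      (potTerm lam θ' (φ P)) := by
  intro m m' f B hm hf hB
  obtain ⟨p, ψ⟩ := P
  have hφP : ContDiffAt ℝ 2 φ (p, ψ) :=
    ((hφ _ hP).contDiffAt (hU.mem_nhds hP)).of_le two_le_infty
  obtain ⟨e, he⟩ := exists_equiv_of_injective _ (baseMap_injective hD hm)
  simp only [baseMap_apply] at he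
  obtain ⟨u, u', hup, hu, hu', hev, hum, huB⟩ := exists_prolongation hφP m B hB e he
  have hφ2 : ContDiffAt ℝ 2 φ (p, u p) := by rwa [hup]
  have hu'2 : ContDiffAt ℝ 2 u' (φ (p, u p)).1 := by rwa [hup]
  have h1 := prolong_fst hφ2 hu hu'2 hev
  have h2 := prolong_snd hφ2 hu hu'2 hev
  have hkey := hM p u u' (by rwa [hup]) hu hu'2 hev
  rw [satisfiesAt_iff hu (stdB n), satisfiesAt_iff hu'2 (stdB n)] at hkey
  have hval : u' (φ (p, u p)).1 = (φ (p, u p)).2 := hev.self_of_nhds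
  rw [hval] at hkey
  rw [hum, hup] at h1 h2
  rw [hum, hup, huB] at hkey
  rw [huB] at h2
  -- The two forms agree on the base parts of the transformed graph vectors, and `e` reaches every
  -- base vector.
  have hm' : fderiv ℝ u' (φ (p, ψ)).1 = m' := by
    refine ContinuousLinearMap.ext fun r => ?_
    obtain ⟨v, rfl⟩ := e.surjective r
    rw [← he, ← h1, hm]
  rw [hm'] at hkey h2
  have h3 : ∀ a, fderiv ℝ (fderiv ℝ u') (φ (p, ψ)).1 (0, stdB n a) (0, stdB n a)
      = graphForm m' (fderiv ℝ (fderiv ℝ φ) (p, ψ) (f a, m (f a)) (f a, m (f a))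
          + fderiv ℝ φ (p, ψ) (0, B (f a) (f a))) := by
    intro a
    rw [← hf a, h2, graphForm_apply]
  simp only [h3] at hkey
  exact hkey

/-- Projectability is not known yet, so a jet in general position has to be produced. Let `A₁`, `A₂`
be the base parts of `D` on the base and on the fibre. Surjectivity of `D` makes `A₂` cover the
cokernel of `A₁`, which has the dimension of `ker A₁`. An `m` that carries `ker A₁` isomorphically
onto lifts of the cokernel makes `A₁ + A₂ m` injective. -/
theorem exists_baseMap_injective (D : Var n →L[ℝ] Var n) (hD : Function.Surjective D) :
    ∃ m : Base n →L[ℝ] ℂ, Function.Injective (baseMap D m) := by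
  let A₁ : Base n →ₗ[ℝ] Base n :=
    LinearMap.fst ℝ (Base n) ℂ ∘ₗ D.toLinearMap ∘ₗ LinearMap.inl ℝ (Base n) ℂ
  let A₂ : ℂ →ₗ[ℝ] Base n :=
    LinearMap.fst ℝ (Base n) ℂ ∘ₗ D.toLinearMap ∘ₗ LinearMap.inr ℝ (Base n) ℂ
  have hA : ∀ v z, (D (v, z)).1 = A₁ v + A₂ z := by
    intro v z
    have : ((v, z) : Var n) = (v, 0) + (0, z) := by simp
    rw [this, map_add]; rfl
  let R := LinearMap.range A₁
  have hsurj : Function.Surjective (R.mkQ ∘ₗ A₂) := by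
    intro r
    obtain ⟨w, rfl⟩ := R.mkQ_surjective r
    obtain ⟨⟨v, z⟩, hvz⟩ := hD (w, 0)
    refine ⟨z, ?_⟩
    have h1 : A₁ v + A₂ z = w := by rw [← hA, hvz]
    rw [LinearMap.comp_apply, ← h1, map_add]
    have h2 : R.mkQ (A₁ v) = 0 := by
      rw [Submodule.mkQ_apply, Submodule.Quotient.mk_eq_zero]
      exact LinearMap.mem_range_self A₁ v
    rw [h2, zero_add]
  obtain ⟨s, hs⟩ := LinearMap.exists_rightInverse_of_surjective _ (LinearMap.range_eq_top.2 hsurj)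
  have hdim : Module.finrank ℝ (LinearMap.ker A₁) = Module.finrank ℝ (Base n ⧸ R) := by
    have h1 := LinearMap.finrank_range_add_finrank_ker A₁
    have h2 := Submodule.finrank_quotient_add_finrank R
    have h3 : Module.finrank ℝ R = Module.finrank ℝ (LinearMap.range A₁) := rfl
    omega
  let j := LinearEquiv.ofFinrankEq _ _ hdim
  obtain ⟨pr, hpr⟩ := (LinearMap.ker A₁).subtype.exists_leftInverse_of_injective
    (Submodule.ker_subtype _)
  let m : Base n →ₗ[ℝ] ℂ := s ∘ₗ j.toLinearMap ∘ₗ pr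
  refine ⟨LinearMap.toContinuousLinearMap m, (injective_iff_map_eq_zero _).2 fun v hv => ?_⟩
  have hv' : A₁ v + A₂ (s (j (pr v))) = 0 := by
    rw [baseMap_apply, hA] at hv; exact hv
  -- Modulo the range of `A₁` only the lifted part survives, so `pr v = 0`; then `A₁ v = 0`, and on
  -- the kernel `pr` is the identity.
  have h1 : R.mkQ (A₁ v) = 0 := by
    rw [Submodule.mkQ_apply, Submodule.Quotient.mk_eq_zero]
    exact LinearMap.mem_range_self A₁ v
  have h2 : j (pr v) = 0 := by
    have h3 := congrArg R.mkQ hv'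
    rw [map_add, h1, zero_add, map_zero] at h3
    have h4 := LinearMap.congr_fun hs (j (pr v))
    simp only [LinearMap.comp_apply, LinearMap.id_apply] at h4
    rw [← h4]; exact h3
  have h3 : pr v = 0 := by simpa using h2
  have h4 : A₁ v = 0 := by simpa [h2] using hv'
  have h5 := LinearMap.congr_fun hpr ⟨v, h4⟩
  simp only [LinearMap.comp_apply, LinearMap.id_apply, Submodule.subtype_apply] at h5
  rw [h3] at h5
  exact (congrArg Subtype.val h5).symm

/-- Injectivity is an open condition, so an admissible jet may be perturbed in any direction; linear
information follows by comparing it with its perturbations. -/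
theorem eventually_baseMap_injective {D : Var n →L[ℝ] Var n} {m : Base n →L[ℝ] ℂ}
    (hm : Function.Injective (baseMap D m)) (m₁ : Base n →L[ℝ] ℂ) :
    ∀ᶠ s : ℝ in 𝓝 0, Function.Injective (baseMap D (m + s • m₁)) := by
  have h : Continuous fun s : ℝ => baseMap D (m + s • m₁) := by
    have h1 : (fun s : ℝ => baseMap D (m + s • m₁)) = fun s : ℝ => baseMap D m
        + s • ((ContinuousLinearMap.fst ℝ (Base n) ℂ).comp
          (D.comp ((ContinuousLinearMap.inr ℝ (Base n) ℂ).comp m₁))) := by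
      funext s
      refine ContinuousLinearMap.ext fun v => ?_
      have : ((v, m v + s • m₁ v) : Var n) = (v, m v) + s • (0, m₁ v) := by simp
      change (D (v, m v + s • m₁ v)).1 = (D (v, m v)).1 + s • (D (0, m₁ v)).1
      rw [this, map_add, map_smul]
      rfl
    rw [h1]
    fun_prop
  have h0 : baseMap D (m + (0 : ℝ) • m₁) = baseMap D m :=
    congrArg _ (ContinuousLinearMap.ext fun v => by simp)
  have h2 := h.continuousAt.preimage_mem_nhds (x := (0 : ℝ))
    (ContinuousLinearMap.isOpen_injective.mem_nhds (h0.symm ▸ hm))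
  exact h2

theorem exists_jet_data {D : Var n →L[ℝ] Var n} {m : Base n →L[ℝ] ℂ}
    (hm : Function.Injective (baseMap D m)) :
    ∃ (m' : Base n →L[ℝ] ℂ) (f : Fin n → Base n),
      (∀ v, (D (v, m v)).2 = m' (D (v, m v)).1) ∧
      ∀ a, (D (f a, m (f a))).1 = (0, stdB n a) := by
  obtain ⟨e, he⟩ := exists_equiv_of_injective _ hm
  simp only [baseMap_apply] at he
  refine ⟨((ContinuousLinearMap.snd ℝ (Base n) ℂ).comp (D.comp
    ((ContinuousLinearMap.id ℝ _).prod m))).comp (e.symm : Base n →L[ℝ] Base n),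
    fun a => e.symm (0, stdB n a), fun v => ?_, fun a => ?_⟩
  · simp [he]
  · simp [he]

/-! ### First-order consequences: conformality and complex (anti)linearity -/

/-- The bilinear form `(v, w) ↦ l v * l' w * c`. -/
def rankOne (l l' : Base n →L[ℝ] ℝ) (c : ℂ) : Base n →L[ℝ] Base n →L[ℝ] ℂ :=
  l.smulRight (l'.smulRight c)

@[simp] theorem rankOne_apply (l l' : Base n →L[ℝ] ℝ) (c : ℂ) (v w : Base n) :
    rankOne l l' c v w = ((l v * l' w : ℝ) : ℂ) * c := by
  simp [rankOne, mul_assoc]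

/-- The linear form `(t, x) ↦ ⟪ξ, x⟫`. -/
def spaceForm (ξ : Space n) : Base n →L[ℝ] ℝ :=
  (innerSL ℝ ξ).comp (ContinuousLinearMap.snd ℝ ℝ (Space n))

@[simp] theorem spaceForm_apply (ξ : Space n) (v : Base n) : spaceForm ξ v = inner ℝ ξ v.2 := rfl

/-- A vertical vector whose image is tangent to the graph of `m'` is itself tangent to the graph of
`m`, hence zero. -/
theorem graphForm_injective {D : Var n →L[ℝ] Var n} (hD : Function.Injective D)
    {m m' : Base n →L[ℝ] ℂ} (hm : ∀ v, (D (v, m v)).2 = m' (D (v, m v)).1) {z : ℂ}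
    (hz : graphForm m' (D (0, z)) = 0) : z = 0 := by
  obtain ⟨e, he⟩ := exists_equiv_of_injective _ (baseMap_injective hD hm)
  simp only [baseMap_apply] at he
  obtain ⟨v, hv⟩ := e.surjective (D (0, z)).1
  rw [← he] at hv
  have h1 : D (v, m v) = D (0, z) := by
    refine Prod.ext hv ?_
    rw [hm, hv]
    rw [graphForm_apply, sub_eq_zero] at hz
    exact hz.symm
  have h2 := hD h1
  have h3 : v = 0 := congrArg Prod.fst h2
  have h4 : m v = z := congrArg Prod.snd h2
  rw [← h4, h3, map_zero]

theorem sum_inner_stdB (ξ η : Space n) :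
    ∑ a, inner ℝ ξ (stdB n a) * inner ℝ η (stdB n a) = inner ℝ ξ η := by
  rw [← (stdB n).sum_inner_mul_inner ξ η]
  simp only [real_inner_comm]

/-- Trace-free quadratic forms are annihilated by the vectors that are mapped to the
standard basis. -/
theorem JetCondition.sum_eq_zero {D : Var n →L[ℝ] Var n} {Q : Var n →L[ℝ] Var n →L[ℝ] Var n}
    {F F' : ℂ} (hJ : JetCondition D Q F F') (hD : Function.Injective D) (a₀ : Fin n)
    {m m' : Base n →L[ℝ] ℂ} {f : Fin n → Base n}
    (hm : ∀ v, (D (v, m v)).2 = m' (D (v, m v)).1)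
    (hf : ∀ a, (D (f a, m (f a))).1 = (0, stdB n a)) {B : Base n →L[ℝ] Base n →L[ℝ] ℂ}
    (hB : ∀ v w, B v w = B w v) (htr : ∑ a, B (0, stdB n a) (0, stdB n a) = 0) :
    ∑ a, B (f a) (f a) = 0 := by
  -- `B₀` has exactly the trace that solves the source equation. So `B₀` and `B₀ + B` both solve it,
  -- and the difference of the two image equations involves `B` alone.
  let c : ℂ := -(Complex.I * m (1, 0)) - F
  let B₀ := rankOne (spaceForm (stdB n a₀)) (spaceForm (stdB n a₀)) c
  have hB₀ : ∀ v w, B₀ v w = B₀ w v := fun v w => by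
    simp only [B₀, rankOne_apply, mul_comm]
  have htr₀ : ∑ a, B₀ (0, stdB n a) (0, stdB n a) = c := by
    simp only [B₀, rankOne_apply, spaceForm_apply]
    rw [← Finset.sum_mul, ← Complex.ofReal_sum, sum_inner_stdB]
    simp
  have h1 := (hJ m m' f B₀ hm hf hB₀).1 (by rw [htr₀]; simp only [c]; ring)
  have h2 := (hJ m m' f (B₀ + B) hm hf (fun v w => by
    simp only [_root_.add_apply, hB₀ v w, hB v w])).1 (by
      simp only [_root_.add_apply]
      rw [Finset.sum_add_distrib, htr₀, htr]; simp only [c]; ring)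
  refine graphForm_injective hD hm ?_
  have h3 : ∑ a, graphForm m' (D (0, B (f a) (f a))) = 0 := by
    have h4 : ∀ a, graphForm m' (Q (f a, m (f a)) (f a, m (f a)) + D (0, (B₀ + B) (f a) (f a)))
        = graphForm m' (Q (f a, m (f a)) (f a, m (f a)) + D (0, B₀ (f a) (f a)))
          + graphForm m' (D (0, B (f a) (f a))) := by
      intro a
      have : ((0, (B₀ + B) (f a) (f a)) : Var n) = (0, B₀ (f a) (f a)) + (0, B (f a) (f a)) := by
        simp
      rw [this, map_add D, ← add_assoc, map_add (graphForm m')]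
    simp only [h4, Finset.sum_add_distrib] at h2
    linear_combination h2 - h1
  have h5 : ((0, ∑ a, B (f a) (f a)) : Var n) = ∑ a, ((0, B (f a) (f a)) : Var n) :=
    (Prod.ext (by simp [Prod.fst_sum]) (by simp [Prod.snd_sum]))
  rw [h5, map_sum, map_sum, h3]

/-- Two kinds of trace-free forms are tested. `dt ⊗ dt` makes the sum of the squared `t`-components
vanish. The symmetrised `ξ ⊗ η`, with its trace removed by a multiple of `e ⊗ e` for one basis
vector `e`, makes the frame operator of the vectors `f a` a scalar. -/
theorem JetCondition.exists_conformal {D : Var n →L[ℝ] Var n}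
    {Q : Var n →L[ℝ] Var n →L[ℝ] Var n}
    {F F' : ℂ} (hJ : JetCondition D Q F F') (hD : Function.Injective D) (a₀ : Fin n)
    {m m' : Base n →L[ℝ] ℂ} {f : Fin n → Base n}
    (hm : ∀ v, (D (v, m v)).2 = m' (D (v, m v)).1)
    (hf : ∀ a, (D (f a, m (f a))).1 = (0, stdB n a)) :
    (∀ a, (f a).1 = 0) ∧ ∃ k : ℝ, 0 < k ∧
      ∀ ξ η, ∑ a, inner ℝ ξ (f a).2 * inner ℝ η (f a).2 = k * inner ℝ ξ η := by
  have h0 : ∀ a, (f a).1 = 0 := by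
    have h := hJ.sum_eq_zero hD a₀ hm hf (B := rankOne (ContinuousLinearMap.fst ℝ ℝ (Space n))
        (ContinuousLinearMap.fst ℝ ℝ (Space n)) 1)
      (fun v w => by simp only [rankOne_apply, mul_comm]) (by simp)
    simp only [rankOne_apply, ContinuousLinearMap.coe_fst', mul_one] at h
    rw [← Complex.ofReal_sum, Complex.ofReal_eq_zero,
      Finset.sum_eq_zero_iff_of_nonneg (fun i _ => mul_self_nonneg _)] at h
    intro a
    exact mul_self_eq_zero.1 (h a (Finset.mem_univ a))
  refine ⟨h0, ?_⟩
  set k : ℝ := ∑ a, inner ℝ (stdB n a₀) (f a).2 * inner ℝ (stdB n a₀) (f a).2 with hk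
  have key : ∀ ξ η, ∑ a, inner ℝ ξ (f a).2 * inner ℝ η (f a).2 = k * inner ℝ ξ η := by
    intro ξ η
    have h := hJ.sum_eq_zero hD a₀ hm hf
      (B := rankOne (spaceForm ξ) (spaceForm η) 1 + rankOne (spaceForm η) (spaceForm ξ) 1
        + rankOne (spaceForm (stdB n a₀)) (spaceForm (stdB n a₀)) ((-2 * inner ℝ ξ η : ℝ) : ℂ))
      (fun v w => by
        simp only [_root_.add_apply, rankOne_apply]
        push_cast; ring)
      (by
        simp only [_root_.add_apply, rankOne_apply, spaceForm_apply, mul_one,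
          Finset.sum_add_distrib, ← Finset.sum_mul]
        simp only [← Complex.ofReal_sum, sum_inner_stdB, real_inner_comm ξ η]
        simp
        ring)
    simp only [_root_.add_apply, rankOne_apply, spaceForm_apply, mul_one,
          Finset.sum_add_distrib, ← Finset.sum_mul, ← Complex.ofReal_sum] at h
    rw [← hk, ← Complex.ofReal_mul, ← Complex.ofReal_add, ← Complex.ofReal_add,
      Complex.ofReal_eq_zero] at h
    have h2 : ∑ a, inner ℝ η (f a).2 * inner ℝ ξ (f a).2
        = ∑ a, inner ℝ ξ (f a).2 * inner ℝ η (f a).2 :=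
      Finset.sum_congr rfl fun a _ => mul_comm _ _
    rw [h2] at h
    linarith
  refine ⟨k, ?_, key⟩
  have hk0 : 0 ≤ k := Finset.sum_nonneg fun a _ => mul_self_nonneg _
  -- If `k` were zero, `f a₀` would vanish, although it is carried to a basis vector.
  refine lt_of_le_of_ne hk0 fun hk1 => ?_
  have h3 := key (f a₀).2 (f a₀).2
  rw [← hk1, zero_mul, Finset.sum_eq_zero_iff_of_nonneg (fun i _ => mul_self_nonneg _)] at h3
  have h4 : (f a₀).2 = 0 :=
    inner_self_eq_zero.1 (mul_self_eq_zero.1 (h3 a₀ (Finset.mem_univ a₀)))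
  have h5 : f a₀ = 0 := Prod.ext (h0 a₀) h4
  have h6 := hf a₀
  rw [h5, map_zero, Prod.mk_zero_zero, map_zero] at h6
  have h7 : stdB n a₀ = 0 := (congrArg Prod.snd h6).symm
  exact (stdB n).toBasis.ne_zero a₀ (by simp at h7)

/-- The frame identity inverts to `(0, ξ) = k⁻¹ ∑ ⟪ξ, f a⟫ f a`; as each `f a` goes to a basis
vector, the image of `(0, ξ)` can be read off. -/
theorem JetCondition.exists_baseMap_space {D : Var n →L[ℝ] Var n}
    {Q : Var n →L[ℝ] Var n →L[ℝ] Var n}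
    {F F' : ℂ} (hJ : JetCondition D Q F F') (hD : Function.Injective D) (a₀ : Fin n)
    {m m' : Base n →L[ℝ] ℂ} {f : Fin n → Base n}
    (hm : ∀ v, (D (v, m v)).2 = m' (D (v, m v)).1)
    (hf : ∀ a, (D (f a, m (f a))).1 = (0, stdB n a)) :
    (∀ a, (f a).1 = 0) ∧ ∃ k : ℝ, 0 < k ∧
      (∑ a, inner ℝ (stdB n a₀) (f a).2 * inner ℝ (stdB n a₀) (f a).2 = k) ∧
      (∀ ξ, (D ((0, ξ), m (0, ξ))).1.1 = 0) ∧
      ∀ ξ, ‖(D ((0, ξ), m (0, ξ))).1.2‖ ^ 2 = k⁻¹ * ‖ξ‖ ^ 2 := by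
  obtain ⟨hf0, k, hk, key⟩ := hJ.exists_conformal hD a₀ hm hf
  have h1 : ∀ ξ, ∑ a, inner ℝ ξ (f a).2 • (f a).2 = k • ξ := by
    intro ξ
    refine ext_inner_left ℝ fun η => ?_
    rw [inner_sum, inner_smul_right, real_inner_comm ξ η, ← key]
    refine Finset.sum_congr rfl fun a _ => ?_
    rw [inner_smul_right]
  have h2 : ∀ ξ, ((0, ξ) : Base n) = k⁻¹ • ∑ a, inner ℝ ξ (f a).2 • f a := by
    intro ξ
    refine Prod.ext ?_ ?_
    · simp [Prod.fst_sum, hf0]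
    · simp only [Prod.smul_snd, Prod.snd_sum, h1]
      rw [inv_smul_smul₀ hk.ne']
  have h3 : ∀ ξ, (D ((0, ξ), m (0, ξ))).1
      = (0, k⁻¹ • ∑ a, inner ℝ ξ (f a).2 • stdB n a) := by
    intro ξ
    have : (D ((0, ξ), m (0, ξ))).1 = baseMap D m (0, ξ) := rfl
    rw [this, h2 ξ, map_smul, map_sum]
    simp only [map_smul, baseMap_apply, hf]
    refine Prod.ext ?_ ?_
    · simp [Prod.fst_sum]
    · simp [Prod.snd_sum]
  refine ⟨hf0, k, hk, ?_, fun ξ => by rw [h3], fun ξ => ?_⟩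
  · rw [key]; simp
  · rw [h3, norm_smul, mul_pow, ← real_inner_self_eq_norm_sq, ← real_inner_self_eq_norm_sq]
    have h4 : inner ℝ (∑ a, inner ℝ ξ (f a).2 • stdB n a) (∑ a, inner ℝ ξ (f a).2 • stdB n a)
        = ∑ a, inner ℝ ξ (f a).2 * inner ℝ ξ (f a).2 := by
      rw [(stdB n).orthonormal.inner_sum]
      simp
    rw [h4, key]
    simp only [real_inner_self_eq_norm_sq, Real.norm_eq_abs, sq_abs]
    field_simp

/-- The `t`-component of the transformation depends on `t` only. -/
theorem JetCondition.time_eq_zero {D : Var n →L[ℝ] Var n}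
    {Q : Var n →L[ℝ] Var n →L[ℝ] Var n}
    {F F' : ℂ} (hJ : JetCondition D Q F F') (hD : Function.Bijective D) (a₀ : Fin n)
    (ξ : Space n) (z : ℂ) : (D ((0, ξ), z)).1.1 = 0 := by
  obtain ⟨m, hm⟩ := exists_baseMap_injective D hD.2
  have hval : ∀ m : Base n →L[ℝ] ℂ, Function.Injective (baseMap D m) →
      ∀ ξ, (D ((0, ξ), m (0, ξ))).1.1 = 0 := by
    intro m hm ξ
    obtain ⟨m', f, h1, h2⟩ := exists_jet_data hm
    obtain ⟨-, k, -, -, h3, -⟩ := hJ.exists_baseMap_space hD.1 a₀ h1 h2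
    exact h3 ξ
  -- The jets `m` and `m + s ⟪e, ·⟫ z` differ over the basis vector `e` by the vertical vector `s
  -- (0, z)`, which isolates the dependence on `ψ`.
  have hz : ∀ z : ℂ, (D (0, z)).1.1 = 0 := by
    intro z
    obtain ⟨s, hs, hs0⟩ := ((eventually_baseMap_injective hm
      ((spaceForm (stdB n a₀)).smulRight z)).filter_mono nhdsWithin_le_nhds |>.and
      (eventually_mem_nhdsWithin (a := (0 : ℝ)) (s := {0}ᶜ))).exists
    have h1 := hval m hm (stdB n a₀)
    have h2 := hval _ hs (stdB n a₀)
    have h3 : (((0, stdB n a₀), (m + s • (spaceForm (stdB n a₀)).smulRight z) (0, stdB n a₀)) : Var n)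
        = ((0, stdB n a₀), m (0, stdB n a₀)) + s • (0, z) := by
      refine Prod.ext (by simp) ?_
      simp
    rw [h3, map_add, map_smul] at h2
    simp only [Prod.fst_add, Prod.smul_fst, h1, zero_add, smul_eq_mul] at h2
    exact (mul_eq_zero.1 h2).resolve_left hs0
  have h1 := hval m hm ξ
  have h2 : (((0, ξ), z) : Var n) = ((0, ξ), m (0, ξ)) + (0, z - m (0, ξ)) := by simp
  rw [h2, map_add]
  simp [h1, hz]

theorem real_sign_eq {r k : ℝ} (hk : 0 < k) (h : (k * r) ^ 2 = 1) :
    k⁻¹ = |r| ∧ (k * r)⁻¹ = Real.sign r := by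
  have hr : r ≠ 0 := by rintro rfl; simp at h
  rcases hr.lt_or_gt with hr | hr
  · have h1 : k * r = -1 := by nlinarith [mul_neg_of_pos_of_neg hk hr]
    rw [Real.sign_of_neg hr, abs_of_neg hr, h1]
    refine ⟨?_, by norm_num⟩
    field_simp; linarith
  · have h1 : k * r = 1 := by nlinarith [mul_pos hk hr]
    rw [Real.sign_of_pos hr, abs_of_pos hr, h1]
    refine ⟨?_, by norm_num⟩
    field_simp; linarith

/-- Otherwise the `t`-component of `D` would vanish identically, against surjectivity. -/
theorem time_ne_zero {D : Var n →L[ℝ] Var n} (hD : Function.Surjective D)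
    (hT : ∀ ξ z, (D ((0, ξ), z)).1.1 = 0) : (D ((1, 0), 0)).1.1 ≠ 0 := by
  intro h
  obtain ⟨⟨⟨s, ξ⟩, z⟩, hw⟩ := hD ((1, 0), 0)
  have h2 : (((s, ξ), z) : Var n) = s • ((1, 0), 0) + ((0, ξ), z) := by simp
  rw [h2, map_add, map_smul] at hw
  have h3 := congrArg (fun w : Var n => w.1.1) hw
  simp [h, hT] at h3

/-- The factor of conformality and the complex (anti)linearity that are forced by the time
derivative. -/
theorem JetCondition.conformal_factor {D : Var n →L[ℝ] Var n}
    {Q : Var n →L[ℝ] Var n →L[ℝ] Var n}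
    {F F' : ℂ} (hJ : JetCondition D Q F F') (hD : Function.Bijective D) (a₀ : Fin n)
    (hT : ∀ ξ z, (D ((0, ξ), z)).1.1 = 0)
    (hQ : ∀ ξ z ξ' z', (Q ((0, ξ), z) ((0, ξ'), z')).1.1 = 0)
    {m m' : Base n →L[ℝ] ℂ} {f : Fin n → Base n}
    (hm : ∀ v, (D (v, m v)).2 = m' (D (v, m v)).1)
    (hf : ∀ a, (D (f a, m (f a))).1 = (0, stdB n a)) :
    (∀ ξ, ‖(D ((0, ξ), m (0, ξ))).1.2‖ ^ 2 = |(D ((1, 0), 0)).1.1| * ‖ξ‖ ^ 2) ∧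
    ∀ z, graphForm m' (D (0, Complex.I * z))
      = (Real.sign (D ((1, 0), 0)).1.1 : ℂ) * (Complex.I * graphForm m' (D (0, z))) := by
  obtain ⟨hf0, k, hk, hk0, -, hnorm⟩ := hJ.exists_baseMap_space hD.1 a₀ hm hf
  set r := (D ((1, 0), 0)).1.1 with hr
  have hr0 : r ≠ 0 := time_ne_zero hD.2 hT
  let B : ℂ → Base n →L[ℝ] Base n →L[ℝ] ℂ :=
    fun c => rankOne (spaceForm (stdB n a₀)) (spaceForm (stdB n a₀)) c
  have hB : ∀ c v w, B c v w = B c w v := fun c v w => by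
    simp only [B, rankOne_apply, mul_comm]
  have htr : ∀ c, ∑ a, B c (0, stdB n a) (0, stdB n a) = c := fun c => by
    simp only [B, rankOne_apply, spaceForm_apply]
    rw [← Finset.sum_mul, ← Complex.ofReal_sum, sum_inner_stdB]
    simp
  have htrf : ∀ c, ∑ a, B c (f a) (f a) = k * c := fun c => by
    simp only [B, rankOne_apply, spaceForm_apply]
    rw [← Finset.sum_mul, ← Complex.ofReal_sum, hk0]
  let L : ℂ →L[ℝ] ℂ := (graphForm m').comp (D.comp (ContinuousLinearMap.inr ℝ (Base n) ℂ))
  have hL : ∀ z, graphForm m' (D (0, z)) = L z := fun z => rfl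
  have hsplit : ∀ c, ∑ a, graphForm m' (Q (f a, m (f a)) (f a, m (f a)) + D (0, B c (f a) (f a)))
      = ∑ a, graphForm m' (Q (f a, m (f a)) (f a, m (f a))) + k * L c := by
    intro c
    simp only [map_add (graphForm m'), hL, Finset.sum_add_distrib]
    rw [← map_sum L, htrf]
    congr 1
    rw [← Complex.real_smul, map_smul, Complex.real_smul]
  -- Raising `ψ_t` by `ζ` and lowering the trace by `I * ζ` preserves the source equation. In the
  -- image the time derivative grows by `L ζ / r`, while the second-order part changes by `-k L (I
  -- ζ)`; these must balance.
  have key : ∀ ζ, Complex.I * L ζ * (r : ℂ)⁻¹ = k * L (Complex.I * ζ) := by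
    intro ζ
    let T₀ := ContinuousLinearMap.fst ℝ ℝ (Space n)
    let mh : Base n →L[ℝ] ℂ := m + T₀.smulRight ζ
    let mh' : Base n →L[ℝ] ℂ := m' + T₀.smulRight (L ζ * (r : ℂ)⁻¹)
    have hmh : ∀ v : Base n, ((v, mh v) : Var n) = (v, m v) + v.1 • ((0, ζ) : Var n) := by
      intro v
      refine Prod.ext (by simp) ?_
      simp [mh, T₀]
    have hDt : ∀ v : Base n, (D (v, m v)).1.1 = v.1 * r := by
      intro v
      have : ((v, m v) : Var n) = v.1 • (((1, 0), 0) : Var n) + ((0, v.2), m v) :=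
        Prod.ext (Prod.ext (by simp) (by simp)) (by simp)
      rw [this, map_add, map_smul]
      simp [hT, hr]
    have hD0 : (D (0, ζ)).1.1 = 0 := hT 0 ζ
    have hmf : ∀ a, mh (f a) = m (f a) := by
      intro a; simp [mh, T₀, hf0]
    have hm2 : ∀ v, (D (v, mh v)).2 = mh' (D (v, mh v)).1 := by
      intro v
      rw [hmh, map_add, map_smul]
      simp only [Prod.snd_add, Prod.fst_add, Prod.smul_snd, Prod.smul_fst, map_add, map_smul, hm]
      have e1 : mh' (D (v, m v)).1 = m' (D (v, m v)).1 + v.1 * L ζ := by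
        simp only [mh', T₀, _root_.add_apply, ContinuousLinearMap.smulRight_apply,
          ContinuousLinearMap.coe_fst', hDt, Complex.real_smul]
        have : (r : ℂ) ≠ 0 := by exact_mod_cast hr0
        push_cast
        field_simp
      have e2 : mh' (D (0, ζ)).1 = m' (D (0, ζ)).1 := by
        simp only [mh', T₀, _root_.add_apply, ContinuousLinearMap.smulRight_apply,
          ContinuousLinearMap.coe_fst', hD0, zero_smul, add_zero]
      have e3 : (D (0, ζ)).2 = m' (D (0, ζ)).1 + L ζ := by
        rw [← hL, graphForm_apply]; ring
      rw [e1, e2, e3]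
      simp only [Complex.real_smul]
      ring
    have h1 := (hJ m m' f (B (-(Complex.I * m (1, 0)) - F)) hm hf (hB _)).1 (by
      rw [htr]; ring)
    have h2 := (hJ mh mh' f (B (-(Complex.I * m (1, 0)) - F - Complex.I * ζ)) hm2
      (fun a => by rw [hmf, hf]) (hB _)).1 (by
      rw [htr]; simp [mh, T₀]; ring)
    have e1 : mh' (1, 0) = m' (1, 0) + L ζ * (r : ℂ)⁻¹ := by
      simp [mh', T₀]
    -- `mh'` differs from `m'` only through the `t`-component, and by `hT` and `hQ` the second-order
    -- terms have none.
    have e2 : ∀ w : Var n, w.1.1 = 0 → graphForm mh' w = graphForm m' w := by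
      intro w hw
      simp [mh', T₀, hw]
    have e3 : ∀ a c, graphForm mh' (Q (f a, mh (f a)) (f a, mh (f a)) + D (0, B c (f a) (f a)))
        = graphForm m' (Q (f a, m (f a)) (f a, m (f a)) + D (0, B c (f a) (f a))) := by
      intro a c
      rw [hmf]
      refine e2 _ ?_
      have h3 : f a = (0, (f a).2) := Prod.ext (hf0 a) rfl
      rw [h3, Prod.fst_add, Prod.fst_add, hQ]
      rw [zero_add]
      exact hT 0 _
    simp only [e3, e1] at h2
    rw [hsplit] at h1 h2
    rw [map_sub L (-(Complex.I * m (1, 0)) - F)] at h2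
    linear_combination h2 - h1
  have hcr : (r : ℂ) ≠ 0 := by exact_mod_cast hr0
  have hck : (k : ℂ) ≠ 0 := by exact_mod_cast hk.ne'
  have key2 : ∀ ζ, L (Complex.I * ζ) = (((k * r)⁻¹ : ℝ) : ℂ) * (Complex.I * L ζ) := by
    intro ζ
    have := key ζ
    push_cast
    field_simp at this ⊢
    linear_combination -this
  have hL1 : L 1 ≠ 0 := fun h => one_ne_zero (graphForm_injective hD.1 hm (z := 1) h)
  -- Multiplying by `I` twice is multiplication by `-1` on both sides, so the real factor in `key2`
  -- squares to one.
  have hsq : (k * r) ^ 2 = 1 := by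
    have h1 := key2 (Complex.I * 1)
    rw [key2 1] at h1
    have h2 : L (Complex.I * (Complex.I * 1)) = - L 1 := by
      rw [← map_neg]; congr 1; rw [← mul_assoc, Complex.I_mul_I]; ring
    rw [h2] at h1
    have h3 : (((k * r)⁻¹ : ℝ) : ℂ) ^ 2 = 1 := by
      have h4 : L 1 * ((((k * r)⁻¹ : ℝ) : ℂ) ^ 2 - 1) = 0 := by
        linear_combination h1 + (((k * r)⁻¹ : ℝ) : ℂ) ^ 2 * L 1 * Complex.I_mul_I
      rcases mul_eq_zero.1 h4 with h5 | h5
      · exact absurd h5 hL1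
      · linear_combination h5
    have h4 : ((k * r)⁻¹) ^ 2 = 1 := by exact_mod_cast h3
    rw [inv_pow] at h4
    exact inv_eq_one.1 h4
  obtain ⟨hs1, hs2⟩ := real_sign_eq hk hsq
  refine ⟨fun ξ => by rw [hnorm, hs1], fun z => ?_⟩
  rw [hL, hL, key2, hs2]

/-- The first-order structure of a transformation that maps one equation to another. -/
theorem JetCondition.first_order {D : Var n →L[ℝ] Var n}
    {Q : Var n →L[ℝ] Var n →L[ℝ] Var n}
    {F F' : ℂ} (hJ : JetCondition D Q F F') (hD : Function.Bijective D) (a₀ : Fin n)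
    (hT : ∀ ξ z, (D ((0, ξ), z)).1.1 = 0)
    (hQ : ∀ ξ z ξ' z', (Q ((0, ξ), z) ((0, ξ'), z')).1.1 = 0) :
    (∀ z, (D (0, z)).1 = 0) ∧
    (∀ ξ, ‖(D ((0, ξ), 0)).1.2‖ ^ 2 = |(D ((1, 0), 0)).1.1| * ‖ξ‖ ^ 2) ∧
    ∀ z, (D (0, Complex.I * z)).2
      = (Real.sign (D ((1, 0), 0)).1.1 : ℂ) * (Complex.I * (D (0, z)).2) := by
  obtain ⟨m, hm⟩ := exists_baseMap_injective D hD.2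
  have hval : ∀ m : Base n →L[ℝ] ℂ, Function.Injective (baseMap D m) → ∀ ξ,
      ‖(D ((0, ξ), m (0, ξ))).1.2‖ ^ 2 = |(D ((1, 0), 0)).1.1| * ‖ξ‖ ^ 2 := by
    intro m hm
    obtain ⟨m', f, h1, h2⟩ := exists_jet_data hm
    exact (hJ.conformal_factor hD a₀ hT hQ h1 h2).1
  have hz2 : ∀ z : ℂ, (D (0, z)).1.2 = 0 := by
    intro z
    set m₁ := (spaceForm (stdB n a₀)).smulRight z with hm₁
    have hev := eventually_baseMap_injective hm m₁
    have hev' := (continuous_neg.tendsto' (0 : ℝ) 0 neg_zero).eventually hev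
    obtain ⟨s, ⟨hs, hs'⟩, hs0⟩ := ((hev.and hev').filter_mono nhdsWithin_le_nhds |>.and
      (eventually_mem_nhdsWithin (a := (0 : ℝ)) (s := {0}ᶜ))).exists
    have h1 := hval m hm (stdB n a₀)
    have h2 := hval _ hs (stdB n a₀)
    have h2' := hval _ hs' (stdB n a₀)
    have h3 : ∀ s : ℝ, (((0, stdB n a₀), (m + s • m₁) (0, stdB n a₀)) : Var n)
        = ((0, stdB n a₀), m (0, stdB n a₀)) + s • (0, z) := by
      intro s
      refine Prod.ext (by simp) ?_
      simp [hm₁]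
    rw [h3, map_add, map_smul] at h2 h2'
    simp only [Prod.snd_add, Prod.fst_add, Prod.smul_fst, Prod.smul_snd, neg_smul,
      ← sub_eq_add_neg, Prod.fst_sub, Prod.snd_sub] at h2 h2'
    -- With `w` the `x`-part of `D (0, z)`, the vectors `v`, `v + s w` and `v - s w` all have the
    -- same norm, which leaves only `w = 0`.
    have h4 := parallelogram_law_with_norm ℝ (D ((0, stdB n a₀), m (0, stdB n a₀))).1.2
      (s • (D (0, z)).1.2)
    have h5 : ‖s • (D (0, z)).1.2‖ = 0 := by
      have : ‖s • (D (0, z)).1.2‖ * ‖s • (D (0, z)).1.2‖ = 0 := by linarith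
      exact mul_self_eq_zero.1 this
    rw [norm_eq_zero, smul_eq_zero] at h5
    exact h5.resolve_left hs0
  have hz : ∀ z : ℂ, (D (0, z)).1 = 0 := fun z => Prod.ext (hT 0 z) (hz2 z)
  refine ⟨hz, fun ξ => ?_, fun z => ?_⟩
  · rw [← hval m hm ξ]
    have h2 : (((0, ξ), m (0, ξ)) : Var n) = ((0, ξ), 0) + (0, m (0, ξ)) := by simp
    rw [h2, map_add, Prod.fst_add, hz, add_zero]
  · obtain ⟨m', f, h1, h2⟩ := exists_jet_data hm
    have h3 := (hJ.conformal_factor hD a₀ hT hQ h1 h2).2 z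
    simpa [graphForm_apply, hz] using h3

/-! ### Second-order structure of the transformation -/

section

variable {E F G : Type*} [NormedAddCommGroup E] [NormedSpace ℝ E]
  [NormedAddCommGroup F] [NormedSpace ℝ F] [NormedAddCommGroup G] [NormedSpace ℝ G]

theorem hasFDerivAt_fderiv_apply {φ : E → F} {P : E} (hφ : ContDiffAt ℝ 2 φ P) (w : E) :
    HasFDerivAt (fun R => fderiv ℝ φ R w) ((fderiv ℝ (fderiv ℝ φ) P).flip w) P := by
  have h := (differentiableAt_fderiv hφ).hasFDerivAt.clm_apply (hasFDerivAt_const w P)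
  refine h.congr_fderiv ?_
  ext v
  simp

/-- First-order relations hold on an open set and may therefore be differentiated; this is how
pointwise jet information reaches the second derivatives. -/
theorem fderiv_fderiv_of_const {φ : E → F} {U : Set E} (hU : IsOpen U)
    (hφ : ContDiffOn ℝ ∞ φ U) (l : F →L[ℝ] G) {w : E} {c : G}
    (h : ∀ P ∈ U, l (fderiv ℝ φ P w) = c) {P : E} (hP : P ∈ U) (v : E) :
    l (fderiv ℝ (fderiv ℝ φ) P v w) = 0 := by
  have hφP : ContDiffAt ℝ 2 φ P := ((hφ _ hP).contDiffAt (hU.mem_nhds hP)).of_le two_le_infty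
  have h1 : HasFDerivAt (fun R => l (fderiv ℝ φ R w)) _ P :=
    l.hasFDerivAt.comp P (hasFDerivAt_fderiv_apply hφP w)
  have h2 : HasFDerivAt (fun R => l (fderiv ℝ φ R w)) (0 : E →L[ℝ] G) P := by
    refine (hasFDerivAt_const c P).congr_of_eventuallyEq ?_
    filter_upwards [hU.mem_nhds hP] with R hR
    exact h R hR
  have h3 := congrArg (fun A : E →L[ℝ] G => A v) (h1.unique h2)
  simpa using h3

theorem fderiv_fderiv_symm {φ : E → F} {P : E} (hφ : ContDiffAt ℝ 2 φ P) (v w : E) :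
    fderiv ℝ (fderiv ℝ φ) P v w = fderiv ℝ (fderiv ℝ φ) P w v :=
  (hφ.isSymmSndFDerivAt (by simp)) v w

end

/-- The derivative of the `x`-component with respect to `x`. -/
def spaceMap (D : Var n →L[ℝ] Var n) : Space n →L[ℝ] Space n :=
  ((ContinuousLinearMap.snd ℝ ℝ (Space n)).comp (ContinuousLinearMap.fst ℝ (Base n) ℂ)).comp
    (D.comp ((ContinuousLinearMap.inl ℝ (Base n) ℂ).comp (ContinuousLinearMap.inr ℝ ℝ (Space n))))

@[simp] theorem spaceMap_apply (D : Var n →L[ℝ] Var n) (ξ : Space n) :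
    spaceMap D ξ = (D ((0, ξ), 0)).1.2 := rfl

/-- The structure of the `t`- and `x`-components of the first and second derivatives of a
transformation that maps one equation to another. -/
structure SliceStructure (D : Var n →L[ℝ] Var n) (Q : Var n →L[ℝ] Var n →L[ℝ] Var n) :
    Prop where
  time : ∀ ξ z, (D ((0, ξ), z)).1.1 = 0
  fiber : ∀ z, (D (0, z)).1 = 0
  time_ne : (D ((1, 0), 0)).1.1 ≠ 0
  conf : ∀ ξ η, inner ℝ (spaceMap D ξ) (spaceMap D η) = |(D ((1, 0), 0)).1.1| * inner ℝ ξ η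
  snd_fst : ∀ ξ z ξ' z', (Q ((0, ξ), z) ((0, ξ'), z')).1 = 0

theorem inner_of_norm_sq {E : Type*} [NormedAddCommGroup E] [InnerProductSpace ℝ E]
    {M : E →L[ℝ] E} {κ : ℝ} (h : ∀ ξ, ‖M ξ‖ ^ 2 = κ * ‖ξ‖ ^ 2) (ξ η : E) :
    inner ℝ (M ξ) (M η) = κ * inner ℝ ξ η := by
  have h1 := h (ξ + η)
  rw [map_add, norm_add_sq_real, norm_add_sq_real, h, h] at h1
  linarith

theorem surjective_of_inner {M : Space n →L[ℝ] Space n} {κ : ℝ} (hκ : κ ≠ 0)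
    (h : ∀ ξ η, inner ℝ (M ξ) (M η) = κ * inner ℝ ξ η) : Function.Surjective M := by
  have hinj : Function.Injective M := by
    refine (injective_iff_map_eq_zero _).2 fun v hv => ?_
    have h1 := h v v
    rw [hv, inner_zero_left, eq_comm, mul_eq_zero] at h1
    exact inner_self_eq_zero.1 (h1.resolve_left hκ)
  exact (LinearMap.injective_iff_surjective (f := M.toLinearMap)).1 hinj

/-- In this basis of the target the Laplacian pulls back to second derivatives along the standard
basis of the source. -/
theorem exists_orthonormalBasis {M : Space n →L[ℝ] Space n} {κ : ℝ} (hκ : 0 < κ)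
    (h : ∀ ξ η, inner ℝ (M ξ) (M η) = κ * inner ℝ ξ η) :
    ∃ b : OrthonormalBasis (Fin n) ℝ (Space n), ∀ i, b i = (√κ)⁻¹ • M (stdB n i) := by
  let A : Space n →ₗᵢ[ℝ] Space n :=
    { toLinearMap := (√κ)⁻¹ • M.toLinearMap
      norm_map' := fun ξ => by
        have h1 := h ξ ξ
        rw [real_inner_self_eq_norm_sq, real_inner_self_eq_norm_sq] at h1
        have h2 : ‖(√κ)⁻¹ • M ξ‖ ^ 2 = ‖ξ‖ ^ 2 := by
          rw [norm_smul, mul_pow, h1, norm_inv, Real.norm_eq_abs, abs_of_nonneg (Real.sqrt_nonneg _),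
            inv_pow, Real.sq_sqrt hκ.le]
          field_simp
        exact (pow_left_inj₀ (norm_nonneg _) (norm_nonneg _) two_ne_zero).1 h2 }
  exact ⟨(stdB n).map (A.toLinearIsometryEquiv rfl), fun i => by simp [A]⟩

/-- The image equation in terms of the original unknown function. -/
theorem SliceStructure.pulledBack {D : Var n →L[ℝ] Var n} {Q : Var n →L[ℝ] Var n →L[ℝ] Var n}
    (hS : SliceStructure D Q) {m m' : Base n →L[ℝ] ℂ} {B B' : Base n →L[ℝ] Base n →L[ℝ] ℂ}
    (hm : ∀ v, (D (v, m v)).2 = m' (D (v, m v)).1)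
    (hB : ∀ v w, B' (D (v, m v)).1 (D (w, m w)).1
      = (Q (v, m v) (w, m w) + D (0, B v w)).2 - m' (Q (v, m v) (w, m w) + D (0, B v w)).1)
    {ζ : Space n} (hζ : spaceMap D ζ = (D ((1, 0), 0)).1.2)
    {b : OrthonormalBasis (Fin n) ℝ (Space n)}
    (hb : ∀ i, b i = (√|(D ((1, 0), 0)).1.1|)⁻¹ • spaceMap D (stdB n i)) :
    Complex.I * m' (1, 0) + ∑ i, B' (0, b i) (0, b i)
      = Complex.I * ((D ((1, 0), 0)).1.1 : ℂ)⁻¹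
          * ((D ((1, 0), m (1, 0))).2 - (D ((0, ζ), m (0, ζ))).2)
        + ((|(D ((1, 0), 0)).1.1| : ℝ) : ℂ)⁻¹
          * ∑ i, ((Q ((0, stdB n i), m (0, stdB n i)) ((0, stdB n i), m (0, stdB n i))).2
            + (D (0, B (0, stdB n i) (0, stdB n i))).2) := by
  set r := (D ((1, 0), 0)).1.1 with hr
  have hr0 : (r : ℂ) ≠ 0 := by exact_mod_cast hS.time_ne
  have hfst : ∀ v z, (D (v, z)).1 = (D (v, 0)).1 := by
    intro v z
    have : ((v, z) : Var n) = (v, 0) + (0, z) := by simp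
    rw [this, map_add, Prod.fst_add, hS.fiber, add_zero]
  have hsp : ∀ ξ z, (D ((0, ξ), z)).1 = (0, spaceMap D ξ) := by
    intro ξ z
    rw [hfst]
    exact Prod.ext (hS.time ξ 0) rfl
  -- The base vector `r (1, 0)` is the image of `(1, -ζ)`: moving by `-ζ` cancels the drift of the
  -- new `x` in time.
  have h1 : r * m' (1, 0) = (D ((1, 0), m (1, 0))).2 - (D ((0, ζ), m (0, ζ))).2 := by
    rw [hm, hm, hfst, hsp, hζ]
    rw [← map_sub, ← Complex.real_smul, ← map_smul]
    congr 1
    refine Prod.ext ?_ ?_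
    · simp [hr]
    · simp
  have h2 : ∀ i, B' (0, b i) (0, b i) = ((|r| : ℝ) : ℂ)⁻¹ *
      ((Q ((0, stdB n i), m (0, stdB n i)) ((0, stdB n i), m (0, stdB n i))).2
            + (D (0, B (0, stdB n i) (0, stdB n i))).2) := by
    intro i
    have h3 := hB (0, stdB n i) (0, stdB n i)
    rw [Prod.fst_add, hS.snd_fst, hS.fiber, hsp] at h3
    have h4 : ((0, b i) : Base n) = (√|r|)⁻¹ • ((0, spaceMap D (stdB n i)) : Base n) := by
      rw [hb]; simp
    rw [h4, map_smul, map_smul, smul_apply, smul_smul, h3, ← mul_inv,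
      Real.mul_self_sqrt (abs_nonneg r), Complex.real_smul]
    simp
  rw [Finset.sum_congr rfl fun i _ => h2 i, ← Finset.mul_sum, ← h1]
  field_simp

theorem contDiffAt_two {φ : Var n → Var n} {U : Set (Var n)} (hU : IsOpen U)
    (hφ : ContDiffOn ℝ ∞ φ U) {P : Var n} (hP : P ∈ U) : ContDiffAt ℝ 2 φ P :=
  ((hφ _ hP).contDiffAt (hU.mem_nhds hP)).of_le two_le_infty

/-- The complex (anti)linearity of the derivative of the `ψ`-component with respect to `ψ`. -/
def FiberLinear (D : Var n →L[ℝ] Var n) : Prop :=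
  ∀ z, (D (0, Complex.I * z)).2
      = (Real.sign (D ((1, 0), 0)).1.1 : ℂ) * (Complex.I * (D (0, z)).2)

/-- The conformal factor `|T_t|` is constant on each slice `t = const`. So the argument that
isometries are affine applies, and no exceptional conformal maps arise for small `n`. -/
theorem sliceStructure_of_mapsEquation {lam : ℝ} {U : Set (Var n)} {φ : Var n → Var n}
    {θ θ' : ArbElem n} (a₀ : Fin n) (hU : IsOpen U) (hφ : IsPointTransformation U φ)
    (hM : MapsEquation lam U φ θ θ') {P : Var n} (hP : P ∈ U) :
    SliceStructure (fderiv ℝ φ P) (fderiv ℝ (fderiv ℝ φ) P) ∧ FiberLinear (fderiv ℝ φ P) := by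
  obtain ⟨hC, hbij, -⟩ := hφ
  have hJ := fun {R : Var n} (hR : R ∈ U) => jetCondition_of_mapsEquation hU hC hM hR (hbij R hR).1
  have hT : ∀ R ∈ U, ∀ ξ z, (fderiv ℝ φ R ((0, ξ), z)).1.1 = 0 := fun R hR ξ z =>
    (hJ hR).time_eq_zero (hbij R hR) a₀ ξ z
  let lt : Var n →L[ℝ] ℝ :=
    (ContinuousLinearMap.fst ℝ ℝ (Space n)).comp (ContinuousLinearMap.fst ℝ (Base n) ℂ)
  have hQt : ∀ R ∈ U, ∀ v ξ z, (fderiv ℝ (fderiv ℝ φ) R v ((0, ξ), z)).1.1 = 0 := by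
    intro R hR v ξ z
    exact fderiv_fderiv_of_const hU hC lt (c := 0) (fun S hS => hT S hS ξ z) hR v
  have hfo := fun R hR => (hJ hR).first_order (hbij R hR) a₀ (hT R hR)
    (fun ξ z ξ' z' => hQt R hR ((0, ξ), z) ξ' z')
  have hsymm := fun R hR => fderiv_fderiv_symm (contDiffAt_two hU hC (P := R) hR)
  have hQz : ∀ R ∈ U, ∀ v z, (fderiv ℝ (fderiv ℝ φ) R v (0, z)).1 = 0 := by
    intro R hR v z
    exact fderiv_fderiv_of_const hU hC (ContinuousLinearMap.fst ℝ (Base n) ℂ) (c := 0)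
      (fun S hS => (hfo S hS).1 z) hR v
  have hconf : ∀ R ∈ U, ∀ ξ η, inner ℝ (spaceMap (fderiv ℝ φ R) ξ) (spaceMap (fderiv ℝ φ R) η)
      = |(fderiv ℝ φ R ((1, 0), 0)).1.1| * inner ℝ ξ η := fun R hR =>
    inner_of_norm_sq (hfo R hR).2.1
  have hne : ∀ R ∈ U, (fderiv ℝ φ R ((1, 0), 0)).1.1 ≠ 0 := fun R hR =>
    time_ne_zero (hbij R hR).2 (hT R hR)
  have hanti : ∀ ζ ξ η : Space n,
      inner ℝ (fderiv ℝ (fderiv ℝ φ) P ((0, ζ), 0) ((0, ξ), 0)).1.2 (spaceMap (fderiv ℝ φ P) η)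
      + inner ℝ (spaceMap (fderiv ℝ φ P) ξ)
        (fderiv ℝ (fderiv ℝ φ) P ((0, ζ), 0) ((0, η), 0)).1.2 = 0 := by
    intro ζ ξ η
    let lx : Var n →L[ℝ] Space n :=
      (ContinuousLinearMap.snd ℝ ℝ (Space n)).comp (ContinuousLinearMap.fst ℝ (Base n) ℂ)
    have hφP := contDiffAt_two hU hC hP
    have h1 : ∀ ξ : Space n, HasFDerivAt (fun R => spaceMap (fderiv ℝ φ R) ξ) _ P := fun ξ =>
      lx.hasFDerivAt.comp P (hasFDerivAt_fderiv_apply hφP ((0, ξ), 0))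
    have h2 := (h1 ξ).inner ℝ (h1 η)
    have h3 : HasFDerivAt (fun R => (fderiv ℝ φ R ((1, 0), 0)).1.1) _ P :=
      lt.hasFDerivAt.comp P (hasFDerivAt_fderiv_apply hφP ((1, 0), 0))
    have h4 := ((hasDerivAt_abs (hne P hP)).comp_hasFDerivAt P h3).mul_const (inner ℝ ξ η)
    have h5 := h2.congr_of_eventuallyEq (f₁ := fun R => |(fderiv ℝ φ R ((1, 0), 0)).1.1|
      * inner ℝ ξ η) (by
        filter_upwards [hU.mem_nhds hP] with R hR
        exact (hconf R hR ξ η).symm)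
    have h6 := congrArg (fun A : Var n →L[ℝ] ℝ => A ((0, ζ), 0)) (h5.unique h4)
    -- `T_t` does not depend on `x`, so the conformal factor contributes nothing to the derivative
    -- of the conformality relation.
    have h7 : lt (fderiv ℝ (fderiv ℝ φ) P ((0, ζ), 0) ((1, 0), 0)) = 0 := by
      rw [hsymm P hP]
      exact hQt P hP _ ζ 0
    simp [h7] at h6
    rw [add_comm]
    exact h6
  refine ⟨⟨hT P hP, (hfo P hP).1, hne P hP, hconf P hP, ?_⟩, (hfo P hP).2.2⟩
  have hxx : ∀ ξ ξ' : Space n, (fderiv ℝ (fderiv ℝ φ) P ((0, ξ), 0) ((0, ξ'), 0)).1.2 = 0 := by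
    intro ξ ξ'
    refine ext_inner_right ℝ fun w => ?_
    obtain ⟨η, rfl⟩ := surjective_of_inner (abs_ne_zero.2 (hne P hP)) (hconf P hP) w
    rw [inner_zero_left]
    -- A trilinear form that is symmetric in its first two arguments and skew in its last two is
    -- zero; the three cyclic instances give this.
    have s1 := hanti ξ ξ' η
    have s2 := hanti η ξ ξ'
    have s3 := hanti ξ' η ξ
    rw [real_inner_comm (spaceMap (fderiv ℝ φ P) _)] at s1 s2 s3
    rw [hsymm P hP ((0, ξ'), 0) ((0, η), 0), hsymm P hP ((0, ξ'), 0) ((0, ξ), 0)] at s3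
    rw [hsymm P hP ((0, η), 0) ((0, ξ), 0)] at s2
    simp only [real_inner_comm] at s1 s2 s3 ⊢
    linarith
  intro ξ z ξ' z'
  have e1 : (((0, ξ'), z') : Var n) = ((0, ξ'), 0) + (0, z') := by simp
  have e2 : (((0, ξ), z) : Var n) = ((0, ξ), 0) + (0, z) := by simp
  rw [e1, map_add, Prod.fst_add, hQz P hP, add_zero, hsymm P hP, e2, map_add, Prod.fst_add,
    hQz P hP, add_zero]
  exact Prod.ext (hQt P hP _ ξ 0) (hxx ξ' ξ)

/-- The image equation in terms of the original unknown function, as a condition on 2-jets. -/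
theorem reduced_condition {lam : ℝ} {U : Set (Var n)} {φ : Var n → Var n}
    {θ θ' : ArbElem n} (hU : IsOpen U) (hC : ContDiffOn ℝ ∞ φ U)
    (hM : MapsEquation lam U φ θ θ') {P : Var n} (hP : P ∈ U)
    (hS : SliceStructure (fderiv ℝ φ P) (fderiv ℝ (fderiv ℝ φ) P))
    {ζ : Space n} (hζ : spaceMap (fderiv ℝ φ P) ζ = (fderiv ℝ φ P ((1, 0), 0)).1.2)
    (m : Base n →L[ℝ] ℂ) (B : Base n →L[ℝ] Base n →L[ℝ] ℂ) (hB : ∀ v w, B v w = B w v) :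
    Complex.I * m (1, 0) + ∑ a, B (0, stdB n a) (0, stdB n a) + potTerm lam θ P = 0 ↔
      Complex.I * ((fderiv ℝ φ P ((1, 0), 0)).1.1 : ℂ)⁻¹
          * ((fderiv ℝ φ P ((1, 0), m (1, 0))).2 - (fderiv ℝ φ P ((0, ζ), m (0, ζ))).2)
        + ((|(fderiv ℝ φ P ((1, 0), 0)).1.1| : ℝ) : ℂ)⁻¹
          * ∑ i, ((fderiv ℝ (fderiv ℝ φ) P ((0, stdB n i), m (0, stdB n i))
              ((0, stdB n i), m (0, stdB n i))).2
            + (fderiv ℝ φ P (0, B (0, stdB n i) (0, stdB n i))).2)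
        + potTerm lam θ' (φ P) = 0 := by
  obtain ⟨p, ψ⟩ := P
  have hφP := contDiffAt_two hU hC hP
  -- Under the slice structure every `m` has a nondegenerate image, so from here on the jet is
  -- unrestricted.
  have hinj : Function.Injective (baseMap (fderiv ℝ φ (p, ψ)) m) := by
    refine (injective_iff_map_eq_zero _).2 fun v hv => ?_
    have h1 : (fderiv ℝ φ (p, ψ) (v, m v)).1 = 0 := hv
    obtain ⟨s, ξ⟩ := v
    have e1 : (((s, ξ), m (s, ξ)) : Var n)
        = s • (((1, 0), 0) : Var n) + ((0, ξ), 0) + (0, m (s, ξ)) := by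
      refine Prod.ext (Prod.ext ?_ ?_) ?_ <;> simp
    rw [e1, map_add, map_add, map_smul, Prod.fst_add, hS.fiber, add_zero] at h1
    have h2 := congrArg Prod.fst h1
    simp only [Prod.fst_add, Prod.smul_fst, hS.time, add_zero, Prod.fst_zero, smul_eq_mul,
      mul_eq_zero, hS.time_ne, or_false] at h2
    subst h2
    rw [zero_smul, zero_add] at h1
    have h3 : spaceMap (fderiv ℝ φ (p, ψ)) ξ = 0 := congrArg Prod.snd h1
    have h4 := hS.conf ξ ξ
    rw [h3, inner_zero_left, eq_comm, mul_eq_zero, or_iff_right (abs_ne_zero.2 hS.time_ne),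
      inner_self_eq_zero] at h4
    rw [h4]; rfl
  obtain ⟨e, he⟩ := exists_equiv_of_injective _ hinj
  obtain ⟨b, hb⟩ := exists_orthonormalBasis (abs_pos.2 hS.time_ne) hS.conf
  obtain ⟨u, u', hup, hu, hu', hev, hum, huB⟩ := exists_prolongation hφP m B hB e he
  have hφ2 : ContDiffAt ℝ 2 φ (p, u p) := by rwa [hup]
  have hu'2 : ContDiffAt ℝ 2 u' (φ (p, u p)).1 := by rwa [hup]
  have h1 := prolong_fst hφ2 hu hu'2 hev
  have h2 := prolong_snd hφ2 hu hu'2 hev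
  have hkey := hM p u u' (by rwa [hup]) hu hu'2 hev
  rw [satisfiesAt_iff hu (stdB n), satisfiesAt_iff hu'2 b] at hkey
  have hval : u' (φ (p, u p)).1 = (φ (p, u p)).2 := hev.self_of_nhds
  rw [hval] at hkey
  rw [hum, hup] at h1 h2
  rw [hum, hup, huB] at hkey
  rw [huB] at h2
  rw [hS.pulledBack h1 h2 hζ hb] at hkey
  exact hkey

/-- The second-order structure of a transformation that maps one equation to another, and the
remaining condition, which is free of derivatives of the unknown function. -/
theorem second_order {lam : ℝ} {U : Set (Var n)} {φ : Var n → Var n}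
    {θ θ' : ArbElem n} (a₀ : Fin n) (hU : IsOpen U) (hC : ContDiffOn ℝ ∞ φ U)
    (hM : MapsEquation lam U φ θ θ') {P : Var n} (hP : P ∈ U)
    (hS : SliceStructure (fderiv ℝ φ P) (fderiv ℝ (fderiv ℝ φ) P))
    {ζ : Space n} (hζ : spaceMap (fderiv ℝ φ P) ζ = (fderiv ℝ φ P ((1, 0), 0)).1.2) :
    (∀ z z', (fderiv ℝ (fderiv ℝ φ) P (0, z) (0, z')).2 = 0) ∧
    (∀ ξ z, (fderiv ℝ (fderiv ℝ φ) P ((0, ξ), 0) (0, z)).2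
      = Complex.I * (2 * (fderiv ℝ φ P ((1, 0), 0)).1.1 : ℂ)⁻¹
        * (inner ℝ (spaceMap (fderiv ℝ φ P) ξ) (fderiv ℝ φ P ((1, 0), 0)).1.2 : ℝ)
        * (fderiv ℝ φ P (0, z)).2) ∧
    Complex.I * ((fderiv ℝ φ P ((1, 0), 0)).1.1 : ℂ)⁻¹
          * ((fderiv ℝ φ P ((1, 0), 0)).2 - (fderiv ℝ φ P ((0, ζ), 0)).2)
        + ((|(fderiv ℝ φ P ((1, 0), 0)).1.1| : ℝ) : ℂ)⁻¹
          * ∑ i, (fderiv ℝ (fderiv ℝ φ) P ((0, stdB n i), 0) ((0, stdB n i), 0)).2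
        - ((|(fderiv ℝ φ P ((1, 0), 0)).1.1| : ℝ) : ℂ)⁻¹ * (fderiv ℝ φ P (0, potTerm lam θ P)).2
        + potTerm lam θ' (φ P) = 0 := by
  have hsymm := fderiv_fderiv_symm (contDiffAt_two hU hC hP)
  have hred := reduced_condition hU hC hM hP hS hζ
  have hconf := hS.conf
  have hne := hS.time_ne
  set D := fderiv ℝ φ P
  set Q := fderiv ℝ (fderiv ℝ φ) P
  set r := (D ((1, 0), 0)).1.1
  have hr0 : (r : ℂ) ≠ 0 := by exact_mod_cast hne
  have hk0 : ((|r| : ℝ) : ℂ) ≠ 0 := by exact_mod_cast abs_ne_zero.2 hne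
  let F := potTerm lam θ P
  -- The trace `-F` makes the source equation hold for every `m` with `m (1, 0) = 0`.
  let B := rankOne (spaceForm (stdB n a₀)) (spaceForm (stdB n a₀)) (-F)
  have hB : ∀ v w, B v w = B w v := fun v w => by
    simp only [B, rankOne_apply, mul_comm]
  have htr : ∑ a, B (0, stdB n a) (0, stdB n a) = -F := by
    simp only [B, rankOne_apply, spaceForm_apply]
    rw [← Finset.sum_mul, ← Complex.ofReal_sum, sum_inner_stdB]
    simp
  let L : ℂ →L[ℝ] ℂ := (ContinuousLinearMap.snd ℝ (Base n) ℂ).comp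
    (D.comp (ContinuousLinearMap.inr ℝ (Base n) ℂ))
  have hL : ∀ z, (D (0, z)).2 = L z := fun _ => rfl
  have hB2 : ∑ i, (D (0, B (0, stdB n i) (0, stdB n i))).2 = -L F := by
    simp only [hL]
    rw [← map_sum, htr, map_neg]
  -- For the jets `m = ⟪ξ, ·⟫ z` the image equation is an identity in `ξ` and `z`. Its value at zero
  -- is the derivative-free condition, its part even in `ξ` contains `Ψ_{ψψ}`, and its odd part
  -- contains `Ψ_{xψ}`.
  have key : ∀ (ξ : Space n) (z : ℂ),
      Complex.I * (r : ℂ)⁻¹ * ((D ((1, 0), 0)).2 - (D ((0, ζ), 0)).2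
          - (inner ℝ ξ ζ : ℝ) * L z)
        + ((|r| : ℝ) : ℂ)⁻¹ * (∑ i, (Q ((0, stdB n i), 0) ((0, stdB n i), 0)).2
          + 2 * (Q ((0, ξ), 0) (0, z)).2 + (inner ℝ ξ ξ : ℝ) * (Q (0, z) (0, z)).2 - L F)
        + potTerm lam θ' (φ P) = 0 := by
    intro ξ z
    let m : Base n →L[ℝ] ℂ := (spaceForm ξ).smulRight z
    have hm : ∀ s η, m (s, η) = (inner ℝ ξ η : ℝ) • z := fun s η => rfl
    have h1 := (hred m B hB).1 (by rw [htr]; simp [hm, F])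
    have e1 : (D ((1, 0), m (1, 0))).2 = (D ((1, 0), 0)).2 := by simp [hm]
    have e2 : (D ((0, ζ), m (0, ζ))).2 = (D ((0, ζ), 0)).2 + (inner ℝ ξ ζ : ℝ) * L z := by
      have : (((0, ζ), m (0, ζ)) : Var n) = ((0, ζ), 0) + (inner ℝ ξ ζ : ℝ) • (0, z) := by
        rw [hm]; simp
      rw [this, map_add, map_smul, Prod.snd_add, Prod.smul_snd, hL, Complex.real_smul]
    have e3 : ∀ i, (Q ((0, stdB n i), m (0, stdB n i)) ((0, stdB n i), m (0, stdB n i))).2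
        = (Q ((0, stdB n i), 0) ((0, stdB n i), 0)).2
          + 2 * (inner ℝ ξ (stdB n i) • (Q ((0, stdB n i), 0) (0, z)).2)
          + ((inner ℝ ξ (stdB n i) * inner ℝ ξ (stdB n i) : ℝ) : ℂ) * (Q (0, z) (0, z)).2 := by
      intro i
      have : (((0, stdB n i), m (0, stdB n i)) : Var n)
          = ((0, stdB n i), 0) + (inner ℝ ξ (stdB n i) : ℝ) • (0, z) := by
        rw [hm]; simp
      rw [this]
      simp only [map_add, map_smul, _root_.add_apply, _root_.smul_apply, Prod.snd_add,
        Prod.smul_snd, Complex.real_smul]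
      rw [hsymm (0, z) ((0, stdB n i), 0)]
      push_cast
      ring
    have e4 : ∑ i, inner ℝ ξ (stdB n i) • (Q ((0, stdB n i), 0) (0, z)).2
        = (Q ((0, ξ), 0) (0, z)).2 := by
      let A : Space n →L[ℝ] ℂ := (ContinuousLinearMap.snd ℝ (Base n) ℂ).comp ((Q.flip (0, z)).comp
        ((ContinuousLinearMap.inl ℝ (Base n) ℂ).comp (ContinuousLinearMap.inr ℝ ℝ (Space n))))
      have hA : ∀ η, (Q ((0, η), 0) (0, z)).2 = A η := fun η => rfl
      simp only [hA, ← map_smul]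
      rw [← map_sum]
      congr 1
      have h3 := (stdB n).sum_repr' ξ
      simpa only [real_inner_comm] using h3
    rw [e1, e2, Finset.sum_add_distrib, hB2] at h1
    simp only [e3, Finset.sum_add_distrib] at h1
    rw [← Finset.mul_sum, e4, ← Finset.sum_mul, ← Complex.ofReal_sum, sum_inner_stdB] at h1
    linear_combination h1
  have key0 := key 0 0
  simp only [Prod.mk_zero_zero, map_zero, inner_zero_left,
    Complex.ofReal_zero, mul_zero, add_zero, sub_zero, Prod.snd_zero] at key0
  have hneg : ∀ ξ : Space n, (((0, -ξ), 0) : Var n) = -((0, ξ), 0) := fun ξ => by simp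
  have hzz : ∀ z, (Q (0, z) (0, z)).2 = 0 := by
    intro z
    have h1 := key (stdB n a₀) z
    have h2 := key (-(stdB n a₀)) z
    rw [hneg, map_neg] at h2
    simp only [inner_neg_left, inner_neg_right, neg_neg, Complex.ofReal_neg, _root_.neg_apply,
      Prod.snd_neg] at h2
    have h3 : inner ℝ (stdB n a₀) (stdB n a₀) = (1 : ℝ) := by simp
    rw [h3] at h1 h2
    have h4 : 2 * ((|r| : ℝ) : ℂ)⁻¹ * (Q (0, z) (0, z)).2 = 0 := by
      push_cast at h1 h2
      linear_combination h1 + h2 - 2 * key0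
    simpa [hk0, hne] using h4
  refine ⟨fun z z' => ?_, fun ξ z => ?_, ?_⟩
  · have h1 := hzz (z + z')
    have e1 : ((0, z + z') : Var n) = (0, z) + (0, z') := by simp
    rw [e1] at h1
    simp only [map_add, _root_.add_apply, Prod.snd_add, hzz] at h1
    rw [hsymm (0, z') (0, z)] at h1
    linear_combination h1 / 2
  · have h1 := key ξ z
    rw [hzz] at h1
    have h2 : (inner ℝ (spaceMap D ξ) (D ((1, 0), 0)).1.2 : ℝ) = |r| * inner ℝ ξ ζ := by
      rw [← hζ, hconf]
    rw [h2, hL]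
    push_cast
    field_simp
    field_simp at h1 key0
    linear_combination h1 - key0
  · have hF : (D (0, potTerm lam θ P)).2 = L F := rfl
    rw [hF]
    linear_combination key0

/-! ### A power nonlinearity admits no shift -/

theorem hasDerivAt_norm_rpow_mul {lam : ℝ} {w v : ℂ} (hw : w ≠ 0) :
    HasDerivAt (fun s : ℝ => ((‖w + s * v‖ ^ lam : ℝ) : ℂ) * (w + s * v))
      (((lam * (‖w‖ ^ 2) ^ (lam / 2 - 1) * inner ℝ w v : ℝ) : ℂ) * w + ((‖w‖ ^ lam : ℝ) : ℂ) * v)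
      0 := by
  have h0 : HasDerivAt (fun s : ℝ => w + s * v) v 0 := by
    have := ((hasDerivAt_id (0 : ℝ)).ofReal_comp.mul_const v).const_add w
    simpa using this
  have h1 := h0.norm_sq
  simp only [Complex.ofReal_zero, zero_mul, add_zero] at h1
  have hw2 : ‖w + ((0 : ℝ) : ℂ) * v‖ ^ 2 ≠ 0 := by simpa using hw
  have h2 := h1.rpow_const (p := lam / 2) (Or.inl hw2)
  have h3 := h2.ofReal_comp.mul h0
  have e1 : (fun s : ℝ => ((‖w + s * v‖ ^ lam : ℝ) : ℂ) * (w + s * v))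
      = fun s : ℝ => (((‖w + s * v‖ ^ 2) ^ (lam / 2) : ℝ) : ℂ) * (w + s * v) := by
    funext s
    rw [← Real.rpow_natCast, ← Real.rpow_mul (norm_nonneg _)]
    congr 4
    push_cast; ring
  rw [e1]
  refine h3.congr_deriv ?_
  have e2 : (‖w‖ ^ 2) ^ (lam / 2) = ‖w‖ ^ lam := by
    rw [← Real.rpow_natCast, ← Real.rpow_mul (norm_nonneg _)]
    congr 1
    push_cast; ring
  simp only [Complex.ofReal_zero, zero_mul, add_zero, e2]
  push_cast
  ring

/-- Sampling at the centre and at four symmetric points suffices. Second differences give `|b|² =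
K²`, first differences give `(a + b w₀) b̄ = K² w₀`, and together `a b̄ = 0`. -/
theorem shift_eq_zero_of_norm_sq {a b w₀ : ℂ} {ρ K : ℝ} (hρ : 0 < ρ) (hb : b ≠ 0)
    (hquad : ∀ w ∈ Metric.ball w₀ ρ, ‖a + b * w‖ ^ 2 = K ^ 2 * ‖w‖ ^ 2) : a = 0 := by
  have hball : ∀ v : ℂ, ‖v‖ ≤ 1 → w₀ + ((ρ / 2 : ℝ) : ℂ) * v ∈ Metric.ball w₀ ρ := by
    intro v hv
    rw [Metric.mem_ball, dist_eq_norm, add_sub_cancel_left, norm_mul, Complex.norm_real,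
      Real.norm_of_nonneg (by positivity)]
    nlinarith
  set s := ρ / 2 with hs
  have hs0 : 0 < s := by positivity
  have q0 := hquad _ (Metric.mem_ball_self hρ)
  have q1 := hquad _ (hball 1 (by simp))
  have q2 := hquad _ (hball (-1) (by simp))
  have q3 := hquad _ (hball Complex.I (by simp))
  have q4 := hquad _ (hball (-Complex.I) (by simp))
  simp only [← Complex.normSq_eq_norm_sq, Complex.normSq_apply, Complex.add_re, Complex.add_im,
    Complex.mul_re, Complex.mul_im, Complex.ofReal_re, Complex.ofReal_im, Complex.one_re,
    Complex.one_im, Complex.neg_re, Complex.neg_im, Complex.I_re, Complex.I_im] at q0 q1 q2 q3 q4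
  have hKb : b.re ^ 2 + b.im ^ 2 = K ^ 2 := by
    have : s ^ 2 * (b.re ^ 2 + b.im ^ 2 - K ^ 2) = 0 := by linear_combination (q1 + q2) / 2 - q0
    rcases mul_eq_zero.1 this with h5 | h5
    · exact absurd h5 (by positivity)
    · linarith
  have l1 : (a.re + (b.re * w₀.re - b.im * w₀.im)) * b.re
      + (a.im + (b.re * w₀.im + b.im * w₀.re)) * b.im = K ^ 2 * w₀.re := by
    have : s * ((a.re + (b.re * w₀.re - b.im * w₀.im)) * b.re
      + (a.im + (b.re * w₀.im + b.im * w₀.re)) * b.im - K ^ 2 * w₀.re) = 0 := by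
      linear_combination (q1 - q2) / 4
    rcases mul_eq_zero.1 this with h5 | h5
    · exact absurd h5 hs0.ne'
    · linarith
  have l2 : -(a.re + (b.re * w₀.re - b.im * w₀.im)) * b.im
      + (a.im + (b.re * w₀.im + b.im * w₀.re)) * b.re = K ^ 2 * w₀.im := by
    have : s * (-(a.re + (b.re * w₀.re - b.im * w₀.im)) * b.im
      + (a.im + (b.re * w₀.im + b.im * w₀.re)) * b.re - K ^ 2 * w₀.im) = 0 := by
      linear_combination (q3 - q4) / 4
    rcases mul_eq_zero.1 this with h5 | h5
    · exact absurd h5 hs0.ne'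
    · linarith
  have hbn : b.re ^ 2 + b.im ^ 2 ≠ 0 := by
    have := (Complex.normSq_pos.2 hb).ne'
    rw [Complex.normSq_apply] at this
    simpa [pow_two] using this
  rw [← hKb] at l1 l2
  apply Complex.ext
  · have : (b.re ^ 2 + b.im ^ 2) * a.re = 0 := by linear_combination l1 * b.re - l2 * b.im
    simpa [hbn] using this
  · have : (b.re ^ 2 + b.im ^ 2) * a.im = 0 := by linear_combination l1 * b.im + l2 * b.re
    simpa [hbn] using this

/-- A power nonlinearity is not shifted by a complex affine change of the unknown function. -/
theorem affine_shift_eq_zero {lam : ℝ} (hlam : lam ≠ 0) {a b c₁ c₂ α β w₀ : ℂ} {ρ : ℝ}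
    (hρ : 0 < ρ) (hb : b ≠ 0) (hc₁ : c₁ ≠ 0)
    (hw : ∀ w ∈ Metric.ball w₀ ρ, w ≠ 0) (hW : ∀ w ∈ Metric.ball w₀ ρ, a + b * w ≠ 0)
    (h : ∀ w ∈ Metric.ball w₀ ρ, c₁ * (((‖a + b * w‖ ^ lam : ℝ) : ℂ) * (a + b * w))
      = c₂ * (((‖w‖ ^ lam : ℝ) : ℂ) * w) + (α + β * w)) : a = 0 := by
  have hderiv : ∀ w ∈ Metric.ball w₀ ρ, ∀ v : ℂ,
      c₁ * (((lam * (‖a + b * w‖ ^ 2) ^ (lam / 2 - 1) * inner ℝ (a + b * w) (b * v) : ℝ) : ℂ)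
          * (a + b * w) + ((‖a + b * w‖ ^ lam : ℝ) : ℂ) * (b * v))
        = c₂ * (((lam * (‖w‖ ^ 2) ^ (lam / 2 - 1) * inner ℝ w v : ℝ) : ℂ) * w
          + ((‖w‖ ^ lam : ℝ) : ℂ) * v) + β * v := by
    intro w hwm v
    have h1 := (hasDerivAt_norm_rpow_mul (lam := lam) (v := b * v) (hW w hwm)).const_mul c₁
    have h2 := (hasDerivAt_norm_rpow_mul (lam := lam) (v := v) (hw w hwm)).const_mul c₂
    have h0 : HasDerivAt (fun s : ℝ => α + β * (w + s * v)) (β * v) 0 := by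
      have := ((((hasDerivAt_id (0 : ℝ)).ofReal_comp.mul_const v).const_add w).const_mul β).const_add α
      simpa using this
    have h3 := h2.add h0
    refine h1.unique (h3.congr_of_eventuallyEq ?_)
    have hcont : Tendsto (fun s : ℝ => w + s * v) (𝓝 0) (𝓝 w) := by
      have : Continuous fun s : ℝ => w + s * v := by fun_prop
      simpa using this.tendsto 0
    filter_upwards [hcont.eventually (Metric.isOpen_ball.mem_nhds hwm)] with s hs
    have h4 := h _ hs
    have e : a + b * w + s * (b * v) = a + b * (w + s * v) := by ring
    simp only [Pi.add_apply, e]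
    rw [h4]
  have hlamc : (lam : ℂ) ≠ 0 := by exact_mod_cast hlam
  -- The derivative along `I` minus `I` times the derivative along `1` is a multiple of `∂/∂w̄`,
  -- which kills `α + β * w`. With `W = a + b * w` there remains `c₁ b̄ |W|^(lam-2) W² = c₂
  -- |w|^(lam-2) w²`, where `lam ≠ 0` has been cancelled; then moduli are taken.
  have hnorm : ∀ w ∈ Metric.ball w₀ ρ, ‖c₁‖ * ‖b‖ * ‖a + b * w‖ ^ lam = ‖c₂‖ * ‖w‖ ^ lam := by
    intro w hwm
    have h1 := hderiv w hwm 1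
    have h2 := hderiv w hwm Complex.I
    have e1 : ((inner ℝ w Complex.I : ℝ) : ℂ) - Complex.I * ((inner ℝ w 1 : ℝ) : ℂ)
        = -(Complex.I * w) := by
      apply Complex.ext <;> simp [Complex.inner]
    have e2 : ((inner ℝ (a + b * w) (b * Complex.I) : ℝ) : ℂ)
        - Complex.I * ((inner ℝ (a + b * w) (b * 1) : ℝ) : ℂ)
        = -(Complex.I * ((a + b * w) * (starRingEnd ℂ) b)) := by
      generalize a + b * w = W
      apply Complex.ext <;> simp [Complex.inner] <;> ring
    push_cast at h1 h2
    have h3 : c₁ * (((‖a + b * w‖ ^ 2) ^ (lam / 2 - 1) : ℝ) : ℂ)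
          * ((a + b * w) * (starRingEnd ℂ) b) * (a + b * w)
        = c₂ * (((‖w‖ ^ 2) ^ (lam / 2 - 1) : ℝ) : ℂ) * w * w := by
      have h4 : lam * Complex.I * (c₁ * (((‖a + b * w‖ ^ 2) ^ (lam / 2 - 1) : ℝ) : ℂ)
          * ((a + b * w) * (starRingEnd ℂ) b) * (a + b * w)
          - c₂ * (((‖w‖ ^ 2) ^ (lam / 2 - 1) : ℝ) : ℂ) * w * w) = 0 := by
        linear_combination (-1) * h2 + Complex.I * h1
          + c₁ * lam * (((‖a + b * w‖ ^ 2) ^ (lam / 2 - 1) : ℝ) : ℂ) * (a + b * w) * e2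
          - c₂ * lam * (((‖w‖ ^ 2) ^ (lam / 2 - 1) : ℝ) : ℂ) * w * e1
      rcases mul_eq_zero.1 h4 with h5 | h5
      · exact absurd h5 (mul_ne_zero hlamc Complex.I_ne_zero)
      · exact sub_eq_zero.1 h5
    have h5 := congrArg norm h3
    have e3 : ∀ z : ℂ, z ≠ 0 → (‖z‖ ^ 2) ^ (lam / 2 - 1) * (‖z‖ * ‖z‖) = ‖z‖ ^ lam := by
      intro z hz
      have hz' : 0 < ‖z‖ := norm_pos_iff.2 hz
      rw [← Real.rpow_natCast, ← Real.rpow_mul hz'.le, ← pow_two, ← Real.rpow_natCast,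
        ← Real.rpow_add hz']
      congr 1
      push_cast; ring
    have e4 : ∀ z : ℂ, ‖(((‖z‖ ^ 2) ^ (lam / 2 - 1) : ℝ) : ℂ)‖ = (‖z‖ ^ 2) ^ (lam / 2 - 1) :=
      fun z => by
        rw [Complex.norm_real, Real.norm_of_nonneg (Real.rpow_nonneg (by positivity) _)]
    simp only [norm_mul, e4, RCLike.norm_conj] at h5
    rw [← e3 _ (hW w hwm), ← e3 _ (hw w hwm)]
    linear_combination h5
  have hc₁b : 0 < ‖c₁‖ * ‖b‖ := by positivity
  set K := (‖c₂‖ / (‖c₁‖ * ‖b‖)) ^ (1 / lam) with hK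
  have hquad : ∀ w ∈ Metric.ball w₀ ρ, ‖a + b * w‖ ^ 2 = K ^ 2 * ‖w‖ ^ 2 := by
    intro w hwm
    have h1 : ‖a + b * w‖ ^ lam = ‖c₂‖ / (‖c₁‖ * ‖b‖) * ‖w‖ ^ lam := by
      have := hnorm w hwm
      field_simp
      linear_combination this
    have h2 : ‖a + b * w‖ = K * ‖w‖ := by
      have e5 : ∀ x : ℝ, 0 ≤ x → (x ^ lam) ^ (1 / lam) = x := fun x hx => by
        rw [← Real.rpow_mul hx, mul_one_div_cancel hlam, Real.rpow_one]
      rw [← e5 _ (norm_nonneg (a + b * w)), h1,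
        Real.mul_rpow (by positivity) (Real.rpow_nonneg (norm_nonneg _) _), e5 _ (norm_nonneg _)]
    rw [h2, mul_pow]
  exact shift_eq_zero_of_norm_sq hρ hb hquad

/-! ### Conjugation by the sign of `T_t` and homogeneity in `ψ` -/

theorem hat_mul (r : ℝ) (z w : ℂ) : hat r (z * w) = hat r z * hat r w := by
  unfold hat; split_ifs <;> simp

theorem hat_add (r : ℝ) (z w : ℂ) : hat r (z + w) = hat r z + hat r w := by
  unfold hat; split_ifs <;> simp

theorem hat_sub (r : ℝ) (z w : ℂ) : hat r (z - w) = hat r z - hat r w := by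
  unfold hat; split_ifs <;> simp

@[simp] theorem hat_ofReal (r x : ℝ) : hat r (x : ℂ) = x := by
  unfold hat; split_ifs <;> simp

@[simp] theorem norm_hat (r : ℝ) (z : ℂ) : ‖hat r z‖ = ‖z‖ := by
  unfold hat; split_ifs <;> simp

@[simp] theorem hat_hat (r : ℝ) (z : ℂ) : hat r (hat r z) = z := by
  unfold hat; split_ifs <;> simp

@[simp] theorem hat_eq_zero {r : ℝ} {z : ℂ} : hat r z = 0 ↔ z = 0 := by
  unfold hat; split_ifs <;> simp

theorem hat_I {r : ℝ} (hr : r ≠ 0) : hat r Complex.I = (Real.sign r : ℂ) * Complex.I := by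
  unfold hat
  rcases hr.lt_or_gt with h | h
  · simp [h.not_gt, Real.sign_of_neg h]
  · simp [h, Real.sign_of_pos h]

theorem hat_congr {r r' : ℝ} (h : 0 < r ↔ 0 < r') (z : ℂ) : hat r z = hat r' z := by
  unfold hat; simp [h]

/-- Split `z` into real and imaginary parts: the image of `I` is `± I` times the image of `1`, with
the same sign as in `hat_I`. -/
theorem FiberLinear.apply {D : Var n →L[ℝ] Var n} (hD : FiberLinear D)
    (hr : (D ((1, 0), 0)).1.1 ≠ 0) (z : ℂ) :
    (D (0, z)).2 = (D (0, 1)).2 * hat (D ((1, 0), 0)).1.1 z := by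
  have h1 := hD 1
  rw [mul_one] at h1
  have e : ((0, z) : Var n) = z.re • (0, 1) + z.im • (0, Complex.I) := by
    refine Prod.ext (by simp) ?_
    simp [Complex.re_add_im]
  have e2 : hat (D ((1, 0), 0)).1.1 z = z.re + z.im * hat (D ((1, 0), 0)).1.1 Complex.I := by
    conv_lhs => rw [← Complex.re_add_im z, hat_add, hat_mul, hat_ofReal, hat_ofReal]
  rw [e2, hat_I hr, e, map_add, map_smul, map_smul, Prod.snd_add, Prod.smul_snd, Prod.smul_snd,
    h1, Complex.real_smul, Complex.real_smul]
  ring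

/-- Only a ball of the fibre is used, because the fibres of the domain over single points `(t, x)`
need not be connected. -/
theorem fiber_const {G : Type*} [NormedAddCommGroup G] [NormedSpace ℝ G] {f : Var n → G}
    {q : Base n} {ψ₀ ψ : ℂ} {ρ : ℝ} (hψ : ψ ∈ Metric.ball ψ₀ ρ)
    (hf : ∀ χ ∈ Metric.ball ψ₀ ρ, DifferentiableAt ℝ f (q, χ))
    (h0 : ∀ χ ∈ Metric.ball ψ₀ ρ, ∀ v, fderiv ℝ f (q, χ) (0, v) = 0) : f (q, ψ) = f (q, ψ₀) := by
  have hd : ∀ χ ∈ Metric.ball ψ₀ ρ, HasFDerivAt (fun χ => f (q, χ)) (0 : ℂ →L[ℝ] G) χ := by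
    intro χ hχ
    have h1 : HasFDerivAt (fun χ : ℂ => (q, χ)) (ContinuousLinearMap.inr ℝ (Base n) ℂ) χ :=
      (hasFDerivAt_const q χ).prodMk (hasFDerivAt_id χ)
    refine ((hf χ hχ).hasFDerivAt.comp χ h1).congr_fderiv ?_
    ext1 v
    exact h0 χ hχ v
  have hψ₀ : ψ₀ ∈ Metric.ball ψ₀ ρ := Metric.mem_ball_self (Metric.pos_of_mem_ball hψ)
  refine Metric.isOpen_ball.is_const_of_fderiv_eq_zero (𝕜 := ℝ) (f := fun χ => f (q, χ))
    (convex_ball ψ₀ ρ).isPreconnected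
    (fun χ hχ => (hd χ hχ).differentiableAt.differentiableWithinAt)
    (fun χ hχ => (hd χ hχ).fderiv) hψ hψ₀

theorem fderiv_partial {φ : Var n → Var n} {q : Base n} {ψ : ℂ} (hφ : ContDiffAt ℝ 2 φ (q, ψ))
    (v : Base n) :
    fderiv ℝ (fun q => (φ (q, ψ)).2) q v = (fderiv ℝ φ (q, ψ) (v, 0)).2 := by
  have hG : DifferentiableAt ℝ (fun q : Base n => (q, ψ)) q :=
    differentiableAt_id.prodMk (differentiableAt_const ψ)
  have hd := hφ.differentiableAt (by norm_num)
  have h1 := fderiv_clm_comp (f := fun q => φ (q, ψ)) (hd.comp q hG)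
    (ContinuousLinearMap.snd ℝ (Base n) ℂ) v
  simp only [ContinuousLinearMap.coe_snd'] at h1
  rw [h1, fderiv_fun_comp (f := fun q : Base n => (q, ψ)) q hd hG]
  simp only [ContinuousLinearMap.coe_comp, Function.comp_apply]
  rw [fderiv_graph (u := fun _ => ψ) (differentiableAt_const ψ)]
  simp

theorem fderiv_fderiv_partial {φ : Var n → Var n} {q : Base n} {ψ : ℂ}
    (hφ : ContDiffAt ℝ 2 φ (q, ψ)) (v w : Base n) :
    fderiv ℝ (fderiv ℝ (fun q => (φ (q, ψ)).2)) q v w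
      = (fderiv ℝ (fderiv ℝ φ) (q, ψ) (v, 0) (w, 0)).2 := by
  have hG : ContDiffAt ℝ 2 (fun q : Base n => (q, ψ)) q := contDiffAt_id.prodMk contDiffAt_const
  have h1 := fderiv_fderiv_clm_comp (f := fun q => φ (q, ψ)) (hφ.comp q hG)
    (ContinuousLinearMap.snd ℝ (Base n) ℂ) v w
  simp only [ContinuousLinearMap.coe_snd'] at h1
  rw [h1, fderiv_fderiv_comp hG hφ]
  simp only [fderiv_graph (u := fun _ => ψ) (differentiableAt_const ψ),
    fderiv_fderiv_graph (u := fun _ => ψ) contDiffAt_const]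
  simp
  exact congrArg Prod.snd (map_zero (fderiv ℝ φ (q, ψ)))

theorem fderiv_lincomb {f g : Base n → ℂ} {q : Base n} (hf : ContDiffAt ℝ 2 f q)
    (hg : ContDiffAt ℝ 2 g q) (c d : ℂ) (v w : Base n) :
    fderiv ℝ (fun q => c * f q + d * g q) q v = c * fderiv ℝ f q v + d * fderiv ℝ g q v ∧
    fderiv ℝ (fderiv ℝ (fun q => c * f q + d * g q)) q v w
      = c * fderiv ℝ (fderiv ℝ f) q v w + d * fderiv ℝ (fderiv ℝ g) q v w := by
  have key : ∀ᶠ p in 𝓝 q, fderiv ℝ (fun q => c * f q + d * g q) p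
      = c • fderiv ℝ f p + d • fderiv ℝ g p := by
    filter_upwards [eventually_differentiableAt hf, eventually_differentiableAt hg] with p h1 h2
    exact ((h1.hasFDerivAt.const_mul c).add (h2.hasFDerivAt.const_mul d)).fderiv
  refine ⟨by rw [key.self_of_nhds]; simp, ?_⟩
  have h1 : HasFDerivAt (fun p => c • fderiv ℝ f p + d • fderiv ℝ g p) _ q :=
    ((differentiableAt_fderiv hf).hasFDerivAt.const_smul c).add
      ((differentiableAt_fderiv hg).hasFDerivAt.const_smul d)
  rw [Filter.EventuallyEq.fderiv_eq key, h1.fderiv]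
  simp

/-- The `ψ`-component of the transformation is homogeneous in `ψ`. -/
theorem fiber_homogeneous {lam : ℝ} (hlam : lam ≠ 0) {U : Set (Var n)} {φ : Var n → Var n}
    {θ θ' : ArbElem n} (a₀ : Fin n) (hU : IsOpen U) (hne : ∀ p ∈ U, p.2 ≠ 0)
    (hφ : IsPointTransformation U φ)
    (hM : MapsEquation lam U φ θ θ') (hδ' : θ'.δ ≠ 0) {P : Var n} (hP : P ∈ U) :
    (fderiv ℝ φ P (0, P.2)).2 = (φ P).2 := by
  have hstr := fun R hR => sliceStructure_of_mapsEquation (P := R) a₀ hU hφ hM hR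
  obtain ⟨hC, hbij, hφ0⟩ := hφ
  obtain ⟨q₀, ψ₀⟩ := P
  have hC2 := fun R hR => contDiffAt_two (P := R) hU hC hR
  set r := (fderiv ℝ φ (q₀, ψ₀) ((1, 0), 0)).1.1 with hr
  have hr0 : r ≠ 0 := (hstr _ hP).1.time_ne
  have hκ0 : |r| ≠ 0 := abs_ne_zero.2 hr0
  obtain ⟨ζ, hζ⟩ := surjective_of_inner hκ0 (hstr _ hP).1.conf
    (fderiv ℝ φ (q₀, ψ₀) ((1, 0), 0)).1.2
  have hrC : ContinuousAt (fun R => (fderiv ℝ φ R ((1, 0), 0)).1.1) (q₀, ψ₀) :=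
    (hasFDerivAt_fderiv_apply (hC2 _ hP) ((1, 0), 0)).continuousAt.fst.fst
  have hsign : ∀ᶠ R in 𝓝 (q₀, ψ₀), (0 < (fderiv ℝ φ R ((1, 0), 0)).1.1 ↔ 0 < r) := by
    rcases hr0.lt_or_gt with h | h
    · filter_upwards [hrC.eventually_lt continuousAt_const h] with R hR
      exact ⟨fun h' => absurd h' hR.not_gt, fun h' => absurd h' h.not_gt⟩
    · filter_upwards [continuousAt_const.eventually_lt hrC h] with R hR
      exact ⟨fun _ => h, fun _ => hR⟩
  -- On this product of balls `T_t` keeps its sign, so that `hat` denotes the same operation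
  -- throughout.
  obtain ⟨ρ, hρ, hball⟩ := Metric.mem_nhds_iff.1 (Filter.inter_mem (hU.mem_nhds hP) hsign)
  have hbU : ∀ q ∈ Metric.ball q₀ ρ, ∀ ψ ∈ Metric.ball ψ₀ ρ, (q, ψ) ∈ U := by
    intro q hq ψ hψ
    refine (hball ?_).1
    rw [← ball_prod_same]
    exact ⟨hq, hψ⟩
  have hbs : ∀ q ∈ Metric.ball q₀ ρ, ∀ ψ ∈ Metric.ball ψ₀ ρ,
      (0 < (fderiv ℝ φ (q, ψ) ((1, 0), 0)).1.1 ↔ 0 < r) := by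
    intro q hq ψ hψ
    refine (hball ?_).2
    rw [← ball_prod_same]
    exact ⟨hq, hψ⟩
  have hq₀ : q₀ ∈ Metric.ball q₀ ρ := Metric.mem_ball_self hρ
  have hψ₀ : ψ₀ ∈ Metric.ball ψ₀ ρ := Metric.mem_ball_self hρ
  have hsec : ∀ R (hR : R ∈ U), (∀ z z', (fderiv ℝ (fderiv ℝ φ) R (0, z) (0, z')).2 = 0) := by
    intro R hR
    obtain ⟨ζ', hζ'⟩ := surjective_of_inner (abs_ne_zero.2 (hstr _ hR).1.time_ne)
      (hstr _ hR).1.conf (fderiv ℝ φ R ((1, 0), 0)).1.2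
    exact (second_order a₀ hU hC hM hR (hstr R hR).1 hζ').1
  -- constancy along the fibres
  have hL : ∀ q ∈ Metric.ball q₀ ρ, ∀ ψ ∈ Metric.ball ψ₀ ρ, ∀ z,
      (fderiv ℝ φ (q, ψ) (0, z)).2 = (fderiv ℝ φ (q, ψ₀) (0, z)).2 := by
    intro q hq ψ hψ z
    have hd := fun χ hχ => (hasFDerivAt_fderiv_apply (hC2 _ (hbU q hq χ hχ)) (0, z)).snd
    refine fiber_const (f := fun R => (fderiv ℝ φ R (0, z)).2) hψ
      (fun χ hχ => (hd χ hχ).differentiableAt) (fun χ hχ v => ?_)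
    rw [(hd χ hχ).fderiv]
    exact hsec _ (hbU q hq χ hχ) v z
  have hD1 : ∀ ψ ∈ Metric.ball ψ₀ ρ, ∀ w,
      (fderiv ℝ φ (q₀, ψ) w).1 = (fderiv ℝ φ (q₀, ψ₀) w).1 := by
    intro ψ hψ w
    have hd := fun χ hχ => (hasFDerivAt_fderiv_apply (hC2 _ (hbU q₀ hq₀ χ hχ)) w).fst
    refine fiber_const (f := fun R => (fderiv ℝ φ R w).1) hψ
      (fun χ hχ => (hd χ hχ).differentiableAt) (fun χ hχ v => ?_)
    rw [(hd χ hχ).fderiv]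
    change (fderiv ℝ (fderiv ℝ φ) (q₀, χ) (0, v) w).1 = 0
    rw [fderiv_fderiv_symm (hC2 _ (hbU q₀ hq₀ χ hχ))]
    exact fderiv_fderiv_of_const hU hC (ContinuousLinearMap.fst ℝ (Base n) ℂ) (c := 0)
      (fun S hS => (hstr S hS).1.fiber v) (hbU q₀ hq₀ χ hχ) w
  have hφ1 : ∀ ψ ∈ Metric.ball ψ₀ ρ, (φ (q₀, ψ)).1 = (φ (q₀, ψ₀)).1 := by
    intro ψ hψ
    have hd := fun χ hχ =>
      ((hC2 _ (hbU q₀ hq₀ χ hχ)).differentiableAt (by norm_num)).hasFDerivAt.fst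
    refine fiber_const (f := fun R => (φ R).1) hψ
      (fun χ hχ => (hd χ hχ).differentiableAt) (fun χ hχ v => ?_)
    rw [(hd χ hχ).fderiv]
    exact (hstr _ (hbU q₀ hq₀ χ hχ)).1.fiber v
  set β := fun q => (fderiv ℝ φ (q, ψ₀) (0, 1)).2 with hβ
  have hLz : ∀ q ∈ Metric.ball q₀ ρ, ∀ z, (fderiv ℝ φ (q, ψ₀) (0, z)).2 = β q * hat r z := by
    intro q hq z
    have h1 := hstr _ (hbU q hq ψ₀ hψ₀)
    rw [h1.2.apply h1.1.time_ne, hat_congr (hbs q hq ψ₀ hψ₀)]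
  have hΨ : ∀ q ∈ Metric.ball q₀ ρ, ∀ ψ ∈ Metric.ball ψ₀ ρ,
      (φ (q, ψ)).2 = (φ (q, ψ₀)).2 + β q * (hat r ψ - hat r ψ₀) := by
    intro q hq ψ hψ
    let l : Var n →L[ℝ] ℂ := (ContinuousLinearMap.snd ℝ (Base n) ℂ).comp
      ((fderiv ℝ φ (q, ψ₀)).comp ((ContinuousLinearMap.inr ℝ (Base n) ℂ).comp
        (ContinuousLinearMap.snd ℝ (Base n) ℂ)))
    have hd := fun χ hχ =>
      ((hC2 _ (hbU q hq χ hχ)).differentiableAt (by norm_num)).hasFDerivAt.snd.fun_sub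
        (l.hasFDerivAt (x := (q, χ)))
    have h1 := fiber_const (f := fun R => (φ R).2 - l R) hψ
      (fun χ hχ => (hd χ hχ).differentiableAt) (fun χ hχ v => by
        rw [HasFDerivAt.fderiv (hd χ hχ)]
        change (fderiv ℝ φ (q, χ) (0, v)).2 - (fderiv ℝ φ (q, ψ₀) (0, v)).2 = 0
        rw [hL q hq χ hχ, sub_self])
    have h2 : ∀ χ, l (q, χ) = β q * hat r χ := fun χ => hLz q hq χ
    simp only [h2] at h1
    linear_combination h1
  -- the remaining condition along the fibre over `q₀`
  let G : ℂ → ℂ := fun ψ => Complex.I * (r : ℂ)⁻¹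
          * ((fderiv ℝ φ (q₀, ψ) ((1, 0), 0)).2 - (fderiv ℝ φ (q₀, ψ) ((0, ζ), 0)).2)
        + ((|r| : ℝ) : ℂ)⁻¹
          * ∑ i, (fderiv ℝ (fderiv ℝ φ) (q₀, ψ) ((0, stdB n i), 0) ((0, stdB n i), 0)).2
  have hzero : ∀ ψ ∈ Metric.ball ψ₀ ρ,
      G ψ - ((|r| : ℝ) : ℂ)⁻¹ * (β q₀ * hat r (potTerm lam θ (q₀, ψ)))
        + potTerm lam θ' (φ (q₀, ψ)) = 0 := by
    intro ψ hψ
    have hR := hbU q₀ hq₀ ψ hψ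
    have h0 := hD1 ψ hψ
    have hζ' : spaceMap (fderiv ℝ φ (q₀, ψ)) ζ = (fderiv ℝ φ (q₀, ψ) ((1, 0), 0)).1.2 := by
      rw [h0, ← hζ, spaceMap_apply, spaceMap_apply, h0]
    have h1 := (second_order a₀ hU hC hM hR (hstr _ hR).1 hζ').2.2
    rw [h0, hL q₀ hq₀ ψ hψ, hLz q₀ hq₀, ← hr] at h1
    exact h1
  set h : ℝ := ρ / 2 with hh
  have hh0 : (h : ℂ) ≠ 0 := by
    have : h ≠ 0 := by positivity
    exact_mod_cast this
  have hψh : ψ₀ + h ∈ Metric.ball ψ₀ ρ := by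
    rw [Metric.mem_ball, dist_eq_norm, add_sub_cancel_left, Complex.norm_real,
      Real.norm_of_nonneg (by positivity)]
    rw [hh]; linarith
  -- Near `q₀` the function `Ψ(·, ψ)` interpolates affinely between `Ψ(·, ψ₀)` and `Ψ(·, ψ₀ + h)`,
  -- with weights independent of the base point. `G` is linear in base derivatives of `Ψ` and
  -- interpolates alike, so no derivative of `β` is needed.
  have hG : ∀ ψ ∈ Metric.ball ψ₀ ρ,
      G ψ = (1 - (hat r ψ - hat r ψ₀) / h) * G ψ₀ + (hat r ψ - hat r ψ₀) / h * G (ψ₀ + h) := by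
    intro ψ hψ
    set c := (hat r ψ - hat r ψ₀) / h with hc
    have hev : (fun q => (φ (q, ψ)).2) =ᶠ[𝓝 q₀]
        fun q => (1 - c) * (φ (q, ψ₀)).2 + c * (φ (q, ψ₀ + h)).2 := by
      filter_upwards [Metric.isOpen_ball.mem_nhds hq₀] with q hq
      rw [hΨ q hq ψ hψ, hΨ q hq (ψ₀ + h) hψh, hat_add, hat_ofReal, hc]
      field_simp
      ring
    have hCψ : ∀ χ ∈ Metric.ball ψ₀ ρ, ContDiffAt ℝ 2 (fun q => (φ (q, χ)).2) q₀ := by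
      intro χ hχ
      have hG : ContDiffAt ℝ 2 (fun q : Base n => (q, χ)) q₀ :=
        contDiffAt_id.prodMk contDiffAt_const
      exact ((hC2 _ (hbU q₀ hq₀ χ hχ)).comp q₀ hG).snd
    have h1 : ∀ v, (fderiv ℝ φ (q₀, ψ) (v, 0)).2
        = (1 - c) * (fderiv ℝ φ (q₀, ψ₀) (v, 0)).2
          + c * (fderiv ℝ φ (q₀, ψ₀ + h) (v, 0)).2 := by
      intro v
      rw [← fderiv_partial (hC2 _ (hbU q₀ hq₀ ψ hψ)), ← fderiv_partial (hC2 _ (hbU q₀ hq₀ ψ₀ hψ₀)),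
        ← fderiv_partial (hC2 _ (hbU q₀ hq₀ _ hψh)), hev.fderiv_eq]
      exact (fderiv_lincomb (hCψ _ hψ₀) (hCψ _ hψh) (1 - c) c v v).1
    have h2 : ∀ v, (fderiv ℝ (fderiv ℝ φ) (q₀, ψ) (v, 0) (v, 0)).2
        = (1 - c) * (fderiv ℝ (fderiv ℝ φ) (q₀, ψ₀) (v, 0) (v, 0)).2
          + c * (fderiv ℝ (fderiv ℝ φ) (q₀, ψ₀ + h) (v, 0) (v, 0)).2 := by
      intro v
      rw [← fderiv_fderiv_partial (hC2 _ (hbU q₀ hq₀ ψ hψ)),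
        ← fderiv_fderiv_partial (hC2 _ (hbU q₀ hq₀ ψ₀ hψ₀)),
        ← fderiv_fderiv_partial (hC2 _ (hbU q₀ hq₀ _ hψh)), hev.fderiv.fderiv_eq]
      exact (fderiv_lincomb (hCψ _ hψ₀) (hCψ _ hψh) (1 - c) c v v).2
    simp only [G, h1, h2, Finset.sum_add_distrib, ← Finset.mul_sum]
    ring
  have hβ0 : β q₀ ≠ 0 := by
    intro h0
    have h1 : fderiv ℝ φ (q₀, ψ₀) (0, 1) = 0 := Prod.ext ((hstr _ hP).1.fiber 1) h0
    have h2 := (injective_iff_map_eq_zero _).1 (hbij _ hP).1 _ h1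
    exact one_ne_zero (congrArg Prod.snd h2)
  have hmem : ∀ w ∈ Metric.ball (hat r ψ₀) ρ, hat r w ∈ Metric.ball ψ₀ ρ := by
    intro w hw
    rw [Metric.mem_ball, dist_eq_norm] at hw ⊢
    rw [← norm_hat r, hat_sub, hat_hat]
    exact hw
  have hΨw : ∀ w ∈ Metric.ball (hat r ψ₀) ρ, (φ (q₀, hat r w)).2
      = ((φ (q₀, ψ₀)).2 - β q₀ * hat r ψ₀) + β q₀ * w := by
    intro w hw
    rw [hΨ q₀ hq₀ _ (hmem w hw), hat_hat]
    ring
  -- In the variable `w = hat r ψ` the new unknown is `a + b * w`, where `a` is its extrapolation to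
  -- `ψ = 0`. The potentials and `G` only contribute an affine function of `w`.
  have hfin := affine_shift_eq_zero hlam (a := (φ (q₀, ψ₀)).2 - β q₀ * hat r ψ₀) (b := β q₀)
    (c₁ := θ'.δ) (c₂ := ((|r| : ℝ) : ℂ)⁻¹ * β q₀ * hat r θ.δ)
    (α := -(θ'.V (φ (q₀, ψ₀)).1 * ((φ (q₀, ψ₀)).2 - β q₀ * hat r ψ₀)) - G ψ₀
      + hat r ψ₀ / h * (G (ψ₀ + h) - G ψ₀))
    (β := -(θ'.V (φ (q₀, ψ₀)).1 * β q₀) + ((|r| : ℝ) : ℂ)⁻¹ * β q₀ * hat r (θ.V q₀)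
      - 1 / h * (G (ψ₀ + h) - G ψ₀))
    (w₀ := hat r ψ₀) hρ hβ0 hδ'
    (fun w hw => by
      have := hne _ (hbU q₀ hq₀ _ (hmem w hw))
      simpa using this)
    (fun w hw => by
      rw [← hΨw w hw]
      exact hφ0 _ (hbU q₀ hq₀ _ (hmem w hw)))
    (fun w hw => by
      have h1 := hzero _ (hmem w hw)
      rw [hG _ (hmem w hw)] at h1
      simp only [potTerm] at h1
      rw [hφ1 _ (hmem w hw), hΨw w hw] at h1
      simp only [hat_add, hat_mul, hat_hat, hat_ofReal, norm_hat] at h1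
      linear_combination h1)
  rw [hLz q₀ hq₀]
  linear_combination -hfin

/-! ### Functions of `t` alone, signs and logarithms -/

theorem isOpen_timesOf {U : Set (Var n)} (hU : IsOpen U) : IsOpen (timesOf U) :=
  (isOpenMap_fst.comp isOpenMap_fst) U hU

theorem mem_timesOf {U : Set (Var n)} {P : Var n} (hP : P ∈ U) : P.1.1 ∈ timesOf U :=
  ⟨P, hP, rfl⟩

theorem eventually_mem_time {U : Set (Var n)} (hU : IsOpen U) {P : Var n} (hP : P ∈ U) :
    ∀ᶠ t in 𝓝 P.1.1, ((t, P.1.2), P.2) ∈ U := by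
  have h : Continuous fun t : ℝ => (((t, P.1.2), P.2) : Var n) := by fun_prop
  exact h.continuousAt.eventually (hU.mem_nhds hP)

section

variable {G : Type*} [NormedAddCommGroup G] [NormedSpace ℝ G]

theorem hasDerivAt_time {f : Var n → G} {P : Var n} (hf : DifferentiableAt ℝ f P) :
    HasDerivAt (fun t : ℝ => f ((t, P.1.2), P.2)) (fderiv ℝ f P ((1, 0), 0)) P.1.1 := by
  have h1 : HasDerivAt (fun t : ℝ => (((t, P.1.2), P.2) : Var n)) ((1, 0), 0) P.1.1 :=
    ((hasDerivAt_id P.1.1).prodMk (hasDerivAt_const P.1.1 P.1.2)).prodMk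
      (hasDerivAt_const P.1.1 P.2)
  exact HasFDerivAt.comp_hasDerivAt (f := fun t : ℝ => (((t, P.1.2), P.2) : Var n))
      P.1.1 hf.hasFDerivAt h1

theorem hasDerivAt_slice {f : Var n → G} {P : Var n} (hf : DifferentiableAt ℝ f P) (ξ : Space n)
    (z : ℂ) :
    HasDerivAt (fun s : ℝ => f ((P.1.1, P.1.2 + s • ξ), P.2 + s • z))
      (fderiv ℝ f P ((0, ξ), z)) 0 := by
  have h0 : ∀ {E : Type _} [NormedAddCommGroup E] [NormedSpace ℝ E] (x v : E),
      HasDerivAt (fun s : ℝ => x + s • v) v 0 := by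
    intro E _ _ x v
    have := ((hasDerivAt_id (0 : ℝ)).smul_const v).const_add x
    simpa using this
  have h1 : HasDerivAt (fun s : ℝ => (((P.1.1, P.1.2 + s • ξ), P.2 + s • z) : Var n))
      ((0, ξ), z) 0 := ((hasDerivAt_const (0 : ℝ) P.1.1).prodMk (h0 P.1.2 ξ)).prodMk (h0 P.2 z)
  have h2 : HasFDerivAt f (fderiv ℝ f P) (((P.1.1, P.1.2 + (0 : ℝ) • ξ), P.2 + (0 : ℝ) • z)) := by
    simpa using hf.hasFDerivAt
  exact HasFDerivAt.comp_hasDerivAt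
    (f := fun s : ℝ => (((P.1.1, P.1.2 + s • ξ), P.2 + s • z) : Var n)) 0 h2 h1

theorem hasDerivAt_of_eq_time {U : Set (Var n)} (hU : IsOpen U) {f : Var n → G} {g : ℝ → G}
    (hfg : ∀ P ∈ U, f P = g P.1.1) {P : Var n} (hP : P ∈ U) (hf : DifferentiableAt ℝ f P) :
    HasDerivAt g (fderiv ℝ f P ((1, 0), 0)) P.1.1 := by
  have h2 := hasDerivAt_time hf
  refine h2.congr_of_eventuallyEq ?_
  filter_upwards [eventually_mem_time hU hP] with t ht
  exact (hfg _ ht).symm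

/-- A smooth function whose derivatives in the directions of `x` and `ψ` vanish is a smooth
function of `t`. -/
theorem exists_eq_time {U : Set (Var n)} (hU : IsVarDomain U) {f : Var n → G}
    (hf : ContDiffOn ℝ ∞ f U) (h0 : ∀ P ∈ U, ∀ ξ z, fderiv ℝ f P ((0, ξ), z) = 0) :
    ∃ g : ℝ → G, ContDiffOn ℝ ∞ g (timesOf U) ∧ ∀ P ∈ U, f P = g P.1.1 := by
  -- Connectedness of the slices is used here: on each of them the derivative vanishes.
  have hconst : ∀ P ∈ U, ∀ R ∈ U, P.1.1 = R.1.1 → f P = f R := by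
    rintro ⟨⟨t, x⟩, ψ⟩ hP ⟨⟨t', x'⟩, ψ'⟩ hR htt
    obtain rfl : t = t' := htt
    let S := {q : Space n × ℂ | (((t, q.1), q.2) : Var n) ∈ U}
    have hc : Continuous fun q : Space n × ℂ => (((t, q.1), q.2) : Var n) := by fun_prop
    have hS : IsOpen S := hU.isOpen.preimage hc
    have hd : ∀ q ∈ S, HasFDerivAt (fun q : Space n × ℂ => f ((t, q.1), q.2))
        (0 : Space n × ℂ →L[ℝ] G) q := by
      intro q hq
      have h1 : HasFDerivAt (fun q : Space n × ℂ => (((t, q.1), q.2) : Var n)) _ q :=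
        ((hasFDerivAt_const (𝕜 := ℝ) t q).prodMk (hasFDerivAt_fst (𝕜 := ℝ) (p := q))).prodMk
          (hasFDerivAt_snd (𝕜 := ℝ) (p := q))
      have h2 : DifferentiableAt ℝ f ((t, q.1), q.2) :=
        ((hf _ hq).contDiffAt (hU.isOpen.mem_nhds hq)).differentiableAt (by simp)
      refine (HasFDerivAt.comp (f := fun q : Space n × ℂ => (((t, q.1), q.2) : Var n))
        q h2.hasFDerivAt h1).congr_fderiv ?_
      refine ContinuousLinearMap.ext fun v => ?_
      exact h0 _ hq v.1 v.2
    exact hS.is_const_of_fderiv_eq_zero (𝕜 := ℝ)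
      (f := fun q : Space n × ℂ => f ((t, q.1), q.2)) (hU.slice_connected t)
      (fun q hq => (hd q hq).differentiableAt.differentiableWithinAt)
      (fun q hq => (hd q hq).fderiv) (x := (x, ψ)) (y := (x', ψ')) hP hR
  choose! s hsU hs using fun (t : ℝ) (ht : t ∈ timesOf U) => ht
  have hfg : ∀ P ∈ U, f P = f (s P.1.1) := fun P hP =>
    hconst P hP _ (hsU _ (mem_timesOf hP)) (hs _ (mem_timesOf hP)).symm
  -- The choice `s` of points may be discontinuous. Smoothness is seen near each time by evaluating
  -- `f` with `x` and `ψ` held fixed instead.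
  refine ⟨fun t => f (s t), ?_, hfg⟩
  rintro _ ⟨P, hP, rfl⟩
  have h1 : ContDiffAt ℝ ∞ (fun t : ℝ => (((t, P.1.2), P.2) : Var n)) P.1.1 :=
    (contDiffAt_id.prodMk contDiffAt_const).prodMk contDiffAt_const
  have h2 : ContDiffAt ℝ ∞ (fun t : ℝ => f ((t, P.1.2), P.2)) P.1.1 :=
    ContDiffAt.comp (f := fun t : ℝ => (((t, P.1.2), P.2) : Var n)) P.1.1
      ((hf P hP).contDiffAt (hU.isOpen.mem_nhds hP)) h1
  refine (h2.congr_of_eventuallyEq ?_).contDiffWithinAt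
  filter_upwards [eventually_mem_time hU.isOpen hP] with t ht
  exact (hfg _ ht).symm

theorem eq_const_of_hasDerivAt_zero {I : Set ℝ} (hI : IsOpen I) (hI' : IsPreconnected I)
    {f : ℝ → G} (h : ∀ t ∈ I, HasDerivAt f 0 t) {s t : ℝ} (hs : s ∈ I) (ht : t ∈ I) :
    f s = f t :=
  hI.is_const_of_deriv_eq_zero hI' (fun t ht => (h t ht).differentiableAt.differentiableWithinAt)
    (fun t ht => (h t ht).deriv) hs ht

end

theorem pos_or_neg_of_ne_zero {I : Set ℝ} (hI : IsPreconnected I) {f : ℝ → ℝ}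
    (hf : ContinuousOn f I) (h0 : ∀ t ∈ I, f t ≠ 0) :
    (∀ t ∈ I, 0 < f t) ∨ ∀ t ∈ I, f t < 0 := by
  by_contra! h
  obtain ⟨⟨s, hs, hs'⟩, t, ht, ht'⟩ := h
  obtain ⟨c, hc, hc'⟩ := hI.intermediate_value hs ht hf ⟨hs', ht'⟩
  exact h0 c hc hc'

/-- Lets `|T_t|`, `sgn T_t` and the conjugation be replaced by expressions that are visibly smooth
in `t`. -/
theorem exists_sign {I : Set ℝ} (hI : IsPreconnected I) {f : ℝ → ℝ}
    (hf : ContinuousOn f I) (h0 : ∀ t ∈ I, f t ≠ 0) :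
    ∃ σ : ℝ, σ * σ = 1 ∧ ∀ t ∈ I, |f t| = σ * f t ∧ Real.sign (f t) = σ ∧ (0 < f t ↔ 0 < σ) := by
  rcases pos_or_neg_of_ne_zero hI hf h0 with h | h
  · exact ⟨1, one_mul 1, fun t ht => ⟨by rw [abs_of_pos (h t ht), one_mul],
      Real.sign_of_pos (h t ht), by simp [h t ht]⟩⟩
  · refine ⟨-1, by norm_num, fun t ht => ⟨by rw [abs_of_neg (h t ht)]; ring,
      Real.sign_of_neg (h t ht), ?_⟩⟩
    have := h t ht
    constructor <;> intro h' <;> linarith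

theorem contDiffOn_infty_deriv {F : Type*} [NormedAddCommGroup F] [NormedSpace ℝ F] {I : Set ℝ}
    (hI : IsOpen I) {f : ℝ → F} (hf : ContDiffOn ℝ ∞ f I) : ContDiffOn ℝ ∞ (deriv f) I :=
  hf.deriv_of_isOpen hI (by simp)

theorem hasDerivAt_of_contDiffOn {F : Type*} [NormedAddCommGroup F] [NormedSpace ℝ F] {I : Set ℝ}
    (hI : IsOpen I) {f : ℝ → F} (hf : ContDiffOn ℝ ∞ f I) {t : ℝ} (ht : t ∈ I) :
    HasDerivAt f (deriv f t) t :=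
  (((hf t ht).contDiffAt (hI.mem_nhds ht)).differentiableAt (by simp)).hasDerivAt

/-- A smooth nonvanishing complex-valued function on an interval has a smooth logarithm. -/
theorem exists_smooth_log {I : Set ℝ} (hI : IsOpen I) (hI' : IsPreconnected I) {R : ℝ → ℂ}
    (hR : ContDiffOn ℝ ∞ R I) (h0 : ∀ t ∈ I, R t ≠ 0) :
    ∃ S Z : ℝ → ℝ, ContDiffOn ℝ ∞ S I ∧ ContDiffOn ℝ ∞ Z I ∧
      ∀ t ∈ I, R t = Complex.exp (Complex.I * S t + Z t) := by
  rcases I.eq_empty_or_nonempty with rfl | ⟨t₀, ht₀⟩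
  · exact ⟨0, 0, contDiffOn_empty, contDiffOn_empty, by simp⟩
  have hR' := contDiffOn_infty_deriv hI hR
  set g : ℝ → ℂ := fun t => deriv R t * (R t)⁻¹ with hg
  have hgC : ContDiffOn ℝ ∞ g I := hR'.mul (hR.inv h0)
  -- A primitive of `R' / R`, normalised at `t₀`; the principal logarithm of `R` itself could jump
  -- when `R` winds around zero.
  set H : ℝ → ℂ := fun t => Complex.log (R t₀) + ∫ s in t₀..t, g s with hH
  have hHd : ∀ t ∈ I, HasDerivAt H (g t) t := by
    intro t ht
    have hsub : Set.uIcc t₀ t ⊆ I := hI'.ordConnected.uIcc_subset ht₀ ht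
    have h1 : IntervalIntegrable g MeasureTheory.volume t₀ t :=
      (hgC.continuousOn.mono hsub).intervalIntegrable
    have h2 : StronglyMeasurableAtFilter g (𝓝 t) MeasureTheory.volume :=
      hgC.continuousOn.stronglyMeasurableAtFilter hI t ht
    exact (intervalIntegral.integral_hasDerivAt_right h1 h2
      (hgC.continuousOn.continuousAt (hI.mem_nhds ht))).const_add _
  have hHC : ContDiffOn ℝ ∞ H I := by
    rw [contDiffOn_infty_iff_deriv_of_isOpen hI]
    exact ⟨fun t ht => (hHd t ht).differentiableAt.differentiableWithinAt,
      hgC.congr fun t ht => (hHd t ht).deriv⟩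
  have hconst : ∀ t ∈ I, R t * Complex.exp (-H t) = 1 := by
    intro t ht
    have h1 : R t₀ * Complex.exp (-H t₀) = 1 := by
      simp only [hH, intervalIntegral.integral_same, add_zero]
      rw [Complex.exp_neg, Complex.exp_log (h0 t₀ ht₀), mul_inv_cancel₀ (h0 t₀ ht₀)]
    rw [← h1]
    refine eq_const_of_hasDerivAt_zero hI hI' (f := fun t => R t * Complex.exp (-H t))
      (fun s hs => ?_) ht ht₀
    have h2 := (hasDerivAt_of_contDiffOn hI hR hs).mul (hHd s hs).neg.cexp
    refine h2.congr_deriv ?_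
    have := h0 s hs
    simp only [hg]
    field_simp
    ring
  refine ⟨fun t => (H t).im, fun t => (H t).re, ?_, ?_, fun t ht => ?_⟩
  · exact Complex.imCLM.contDiff.comp_contDiffOn hHC
  · exact Complex.reCLM.contDiff.comp_contDiffOn hHC
  · have h1 := hconst t ht
    rw [Complex.exp_neg, mul_inv_eq_one₀ (Complex.exp_ne_zero _)] at h1
    rw [h1]
    congr 1
    rw [add_comm, mul_comm, Complex.re_add_im]

/-! ### Orthogonal matrices and the quadratic phase -/

/-- The linear map of the space of the variables `x` with a given matrix. -/
def matMap (O : Matrix (Fin n) (Fin n) ℝ) : Space n →L[ℝ] Space n :=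
  LinearMap.toContinuousLinearMap (Matrix.toEuclideanLin O)

theorem matMap_apply (O : Matrix (Fin n) (Fin n) ℝ) (x : Space n) (a : Fin n) :
    matMap O x a = ∑ b, O a b * x b := rfl

theorem inner_eq_sum (x y : Space n) : inner ℝ x y = ∑ a, x a * y a := by
  simp [PiLp.inner_apply, mul_comm]

theorem inner_matMap {O : Matrix (Fin n) (Fin n) ℝ} (hO : O ∈ Matrix.orthogonalGroup (Fin n) ℝ)
    (ξ η : Space n) : inner ℝ (matMap O ξ) (matMap O η) = inner ℝ ξ η := by
  have h1 := (Matrix.mem_orthogonalGroup_iff' (Fin n) ℝ).1 hO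
  have h2 : ∀ b c, ∑ a, O a b * O a c = if b = c then 1 else 0 := by
    intro b c
    have := congrFun (congrFun h1 b) c
    simpa [Matrix.mul_apply, Matrix.star_eq_conjTranspose, Matrix.one_apply] using this
  simp only [inner_eq_sum, matMap_apply, Finset.sum_mul_sum]
  rw [Finset.sum_comm]
  refine Finset.sum_congr rfl fun b _ => ?_
  rw [Finset.sum_comm]
  have h3 : ∀ c, ∑ a, O a b * ξ b * (O a c * η c) = (∑ a, O a b * O a c) * (ξ b * η c) := by
    intro c
    rw [Finset.sum_mul]
    exact Finset.sum_congr rfl fun a _ => by ring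
  simp [h3, h2]

theorem exists_matMap {A : Space n →L[ℝ] Space n}
    (hA : ∀ ξ η, inner ℝ (A ξ) (A η) = inner ℝ ξ η) :
    ∃ O ∈ Matrix.orthogonalGroup (Fin n) ℝ, matMap O = A := by
  refine ⟨Matrix.of fun a b => A (stdB n b) a, ?_, ?_⟩
  · rw [Matrix.mem_orthogonalGroup_iff']
    ext b c
    have h1 := hA (stdB n b) (stdB n c)
    rw [inner_eq_sum, orthonormal_iff_ite.1 (stdB n).orthonormal] at h1
    simpa [Matrix.mul_apply, Matrix.star_eq_conjTranspose, Matrix.one_apply] using h1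
  · refine ContinuousLinearMap.ext fun x => ?_
    ext a
    rw [matMap_apply]
    have h1 := (stdB n).sum_repr x
    conv_rhs => rw [← h1, map_sum]
    simp [mul_comm]

/-- The phase in terms of the inner product. -/
theorem psiExponent_eq (T : ℝ → ℝ) (X : ℝ → Space n) (S Z : ℝ → ℝ)
    (O : Matrix (Fin n) (Fin n) ℝ) {t : ℝ} (hX : DifferentiableAt ℝ X t) (x : Space n) :
    psiExponent T (fun a s => X s a) S Z O t x
      = Complex.I * ((1 / 8 * (deriv (deriv T) t / |deriv T t|) * inner ℝ x x
        + 1 / 2 * (Real.sign (deriv T t) / √|deriv T t|) * inner ℝ (matMap O x) (deriv X t)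
        + S t : ℝ) : ℂ) + (Z t : ℂ) := by
  have h1 : ∀ a, deriv (fun s => X s a) t = deriv X t a := fun a =>
    ((EuclideanSpace.proj (𝕜 := ℝ) a).hasFDerivAt.comp_hasDerivAt t hX.hasDerivAt).deriv
  unfold psiExponent
  simp only [h1, inner_eq_sum, matMap_apply]
  have h2 : ∑ b, ∑ a, Real.sign (deriv T t) * deriv X t b / √|deriv T t| * O b a * x a
      = Real.sign (deriv T t) / √|deriv T t| * ∑ b, (∑ a, O b a * x a) * deriv X t b := by
    rw [Finset.mul_sum]
    refine Finset.sum_congr rfl fun b _ => ?_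
    rw [Finset.sum_mul, Finset.mul_sum]
    exact Finset.sum_congr rfl fun a _ => by ring
  rw [h2, mul_assoc (1 / 2 : ℝ)]

/-- The transformation of the variables has the explicit form with the parameters `T`, `X`, `S`,
`Z`, `O`. -/
structure HasVarForm (U : Set (Var n)) (φ : Var n → Var n) (T : ℝ → ℝ) (X : ℝ → Space n)
    (S Z : ℝ → ℝ) (O : Matrix (Fin n) (Fin n) ℝ) : Prop where
  T_smooth : ContDiffOn ℝ ∞ T (timesOf U)
  X_smooth : ContDiffOn ℝ ∞ X (timesOf U)
  S_smooth : ContDiffOn ℝ ∞ S (timesOf U)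
  Z_smooth : ContDiffOn ℝ ∞ Z (timesOf U)
  T_ne : ∀ t ∈ timesOf U, deriv T t ≠ 0
  orth : O ∈ Matrix.orthogonalGroup (Fin n) ℝ
  time : ∀ P ∈ U, (φ P).1.1 = T P.1.1
  space : ∀ P ∈ U, (φ P).1.2 = √|deriv T P.1.1| • matMap O P.1.2 + X P.1.1
  fiber : ∀ P ∈ U, (φ P).2
    = Complex.exp (psiExponent T (fun a s => X s a) S Z O P.1.1 P.1.2) * hat (deriv T P.1.1) P.2

/-- The derivative of the phase with respect to `x`. -/
theorem hasDerivAt_psiExponent (T : ℝ → ℝ) {X : ℝ → Space n} (S Z : ℝ → ℝ)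
    (O : Matrix (Fin n) (Fin n) ℝ) {t : ℝ} (hX : DifferentiableAt ℝ X t) (x ξ : Space n) :
    HasDerivAt (fun s : ℝ => psiExponent T (fun a s => X s a) S Z O t (x + s • ξ))
      (Complex.I * ((1 / 4 * (deriv (deriv T) t / |deriv T t|) * inner ℝ x ξ
        + 1 / 2 * (Real.sign (deriv T t) / √|deriv T t|) * inner ℝ (matMap O ξ) (deriv X t) : ℝ)
          : ℂ)) 0 := by
  simp only [psiExponent_eq T X S Z O hX]
  have h0 : HasDerivAt (fun s : ℝ => x + s • ξ) ξ 0 := by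
    have := ((hasDerivAt_id (0 : ℝ)).smul_const ξ).const_add x
    simpa using this
  have h1 := h0.inner ℝ h0
  have h2 : HasDerivAt (fun s : ℝ => matMap O (x + s • ξ)) (matMap O ξ) 0 :=
    (matMap O).hasFDerivAt.comp_hasDerivAt 0 h0
  have h3 := h2.inner ℝ (hasDerivAt_const (0 : ℝ) (deriv X t))
  have h4 := (((h1.const_mul (1 / 8 * (deriv (deriv T) t / |deriv T t|))).add
    (h3.const_mul (1 / 2 * (Real.sign (deriv T t) / √|deriv T t|)))).add_const (S t))
  have h5 := (h4.ofReal_comp.const_mul Complex.I).add_const (Z t : ℂ)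
  refine h5.congr_deriv ?_
  simp only [zero_smul, add_zero, inner_zero_right, zero_add, real_inner_comm x ξ]
  push_cast
  ring

/-- The derivative of the phase agrees with the logarithmic derivative of `ψ` that is forced by
the equation. -/
theorem phase_identity {r r₂ : ℝ} (hr : r ≠ 0) {A : Space n →L[ℝ] Space n}
    (hA : ∀ ξ η, inner ℝ (A ξ) (A η) = inner ℝ ξ η) (x ξ v : Space n) :
    1 / 4 * (r₂ / |r|) * inner ℝ x ξ + 1 / 2 * (Real.sign r / √|r|) * inner ℝ (A ξ) v
      = (2 * r)⁻¹ * inner ℝ (√|r| • A ξ) ((r₂ / (2 * r)) • (√|r| • A x) + v) := by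
  have hs : 0 < √|r| := Real.sqrt_pos.2 (abs_pos.2 hr)
  have hsq : √|r| * √|r| = |r| := Real.mul_self_sqrt (abs_nonneg r)
  have habs : |r| * |r| = r * r := abs_mul_abs_self r
  have habs0 : |r| ≠ 0 := abs_ne_zero.2 hr
  rw [inner_add_right, inner_smul_left, inner_smul_right, inner_smul_right, inner_smul_left, hA,
    real_inner_comm ξ x]
  simp only [conj_trivial]
  have e1 : 1 / 4 * (r₂ / |r|) = (2 * r)⁻¹ * (√|r| * (r₂ / (2 * r) * √|r|)) := by
    field_simp
    linear_combination -4 * r₂ * (habs + |r| * hsq)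
  have e2 : 1 / 2 * (Real.sign r / √|r|) = (2 * r)⁻¹ * √|r| := by
    have hsg' : Real.sign r * r = |r| := by
      rcases hr.lt_or_gt with h | h
      · rw [Real.sign_of_neg h, abs_of_neg h]; ring
      · rw [Real.sign_of_pos h, abs_of_pos h]; ring
    field_simp
    linear_combination hsg' - hsq
  rw [e1, e2]
  ring

/-! ### Integration to the explicit form -/

set_option maxHeartbeats 1600000 in
/-- A transformation that maps one equation of the class to another has the explicit form. -/
theorem exists_varForm {lam : ℝ} (hlam : lam ≠ 0) {U : Set (Var n)} {φ : Var n → Var n}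
    {θ θ' : ArbElem n} (a₀ : Fin n) (hU : IsVarDomain U) (hφ : IsPointTransformation U φ)
    (hM : MapsEquation lam U φ θ θ') (hδ' : θ'.δ ≠ 0) :
    ∃ T X S Z O, HasVarForm U φ T X S Z O := by
  have hstr := fun R hR => sliceStructure_of_mapsEquation (P := R) a₀ hU.isOpen hφ hM hR
  have hhom := fun R hR => fiber_homogeneous (P := R) hlam a₀ hU.isOpen hU.ne_zero hφ hM hδ' hR
  obtain ⟨hC, hbij, hφ0⟩ := hφ
  have hO := hU.isOpen
  have hIo := isOpen_timesOf hO
  have hIc := hU.times_connected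
  have hC2 := fun R hR => contDiffAt_two (P := R) hO hC hR
  have hd := fun R hR => ((hC2 R hR).differentiableAt (by norm_num))
  -- the time component
  obtain ⟨T, hTC, hT⟩ := exists_eq_time hU (f := fun P => (φ P).1.1) hC.fst.fst (by
    intro P hP ξ z
    have h1 : HasFDerivAt (fun P => (φ P).1.1) _ P := (hd P hP).hasFDerivAt.fst.fst
    rw [h1.fderiv]
    exact (hstr P hP).1.time ξ z)
  have hTd : ∀ P ∈ U, deriv T P.1.1 = (fderiv ℝ φ P ((1, 0), 0)).1.1 := by
    intro P hP
    have h1 : HasFDerivAt (fun P => (φ P).1.1) _ P := (hd P hP).hasFDerivAt.fst.fst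
    rw [(hasDerivAt_of_eq_time hO hT hP h1.differentiableAt).deriv, h1.fderiv]
    rfl
  have hTne : ∀ t ∈ timesOf U, deriv T t ≠ 0 := by
    rintro _ ⟨P, hP, rfl⟩
    change deriv T P.1.1 ≠ 0
    rw [hTd P hP]
    exact (hstr P hP).1.time_ne
  have hT'C := contDiffOn_infty_deriv hIo hTC
  obtain ⟨σ, hσσ, hσ⟩ := exists_sign hIc hT'C.continuousOn hTne
  have hσ0 : σ ≠ 0 := by rintro rfl; simp at hσσ
  -- the linear part of the space component
  obtain ⟨M, hMC, hMeq⟩ := exists_eq_time hU (f := fun P => spaceMap (fderiv ℝ φ P))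
    (contDiffOn_const.clm_comp ((hC.fderiv_of_isOpen hO (by simp)).clm_comp contDiffOn_const)) (by
    intro P hP ξ z
    refine ContinuousLinearMap.ext fun η => ?_
    have h1 : DifferentiableAt ℝ (fun P => spaceMap (fderiv ℝ φ P)) P :=
      (differentiableAt_const _).clm_comp
        ((differentiableAt_fderiv (hC2 P hP)).clm_comp (differentiableAt_const _))
    have h2 := h1.hasFDerivAt.clm_apply (hasFDerivAt_const η P)
    have h3 : HasFDerivAt (fun R => spaceMap (fderiv ℝ φ R) η) _ P :=
      (hasFDerivAt_fderiv_apply (hC2 P hP) ((0, η), 0)).fst.snd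
    have h4 := congrArg (fun A : Var n →L[ℝ] Space n => A ((0, ξ), z)) (h2.unique h3)
    have h5 : (fderiv ℝ (fderiv ℝ φ) P ((0, ξ), z) ((0, η), 0)).1.2 = 0 := by
      rw [(hstr P hP).1.snd_fst]; rfl
    simpa [h5] using h4)
  have hconf : ∀ t ∈ timesOf U, ∀ ξ η, inner ℝ (M t ξ) (M t η) = |deriv T t| * inner ℝ ξ η := by
    rintro _ ⟨P, hP, rfl⟩ ξ η
    have h1 := (hstr P hP).1.conf ξ η
    rw [← hTd P hP] at h1
    rw [← h1]
    change inner ℝ (M P.1.1 ξ) (M P.1.1 η) = _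
    rw [← hMeq P hP]
  have hsp : ∀ P ∈ U, ∀ ξ z, (fderiv ℝ φ P ((0, ξ), z)).1.2 = M P.1.1 ξ := by
    intro P hP ξ z
    have e : (((0, ξ), z) : Var n) = ((0, ξ), 0) + (0, z) := by simp
    rw [← hMeq P hP, e, map_add, Prod.fst_add, (hstr P hP).1.fiber, add_zero]
    rfl
  have htime : ContDiffOn ℝ ∞ (fun P : Var n => P.1.1) U := contDiff_fst.fst.contDiffOn
  have hmaps : Set.MapsTo (fun P : Var n => P.1.1) U (timesOf U) := fun P hP => mem_timesOf hP
  -- Subtracting the linear part `M x` leaves a quantity without slice derivatives.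
  obtain ⟨X, hXC, hX⟩ := exists_eq_time hU (f := fun P => (φ P).1.2 - M P.1.1 P.1.2)
    (hC.fst.snd.sub ((hMC.comp htime hmaps).clm_apply contDiff_fst.snd.contDiffOn)) (by
    intro P hP ξ z
    have h0 : ContDiffAt ℝ ∞ (fun P : Var n => (φ P).1.2 - M P.1.1 P.1.2) P :=
      ((hC.fst.snd.sub ((hMC.comp htime hmaps).clm_apply contDiff_fst.snd.contDiffOn)) P
        hP).contDiffAt (hO.mem_nhds hP)
    have h1 := hasDerivAt_slice (h0.differentiableAt (by simp)) ξ z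
    have h2 := hasDerivAt_slice (f := fun P => (φ P).1.2)
      (hd P hP).hasFDerivAt.fst.snd.differentiableAt ξ z
    have h3 : HasDerivAt (fun s : ℝ => M P.1.1 (P.1.2 + s • ξ)) (M P.1.1 ξ) 0 := by
      have h4 : HasDerivAt (fun s : ℝ => P.1.2 + s • ξ) ξ 0 := by
        have := ((hasDerivAt_id (0 : ℝ)).smul_const ξ).const_add P.1.2
        simpa using this
      exact (M P.1.1).hasFDerivAt.comp_hasDerivAt 0 h4
    rw [h1.unique (h2.sub h3)]
    have h5 : HasFDerivAt (fun P => (φ P).1.2) _ P := (hd P hP).hasFDerivAt.fst.snd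
    rw [h5.fderiv, sub_eq_zero]
    exact hsp P hP ξ z)
  have hXt : ∀ P ∈ U, (fderiv ℝ φ P ((1, 0), 0)).1.2
      = deriv M P.1.1 P.1.2 + deriv X P.1.1 := by
    intro P hP
    have h5 : HasFDerivAt (fun P => (φ P).1.2) _ P := (hd P hP).hasFDerivAt.fst.snd
    have h1 := hasDerivAt_time h5.differentiableAt
    rw [h5.fderiv] at h1
    have h2 := ((hasDerivAt_of_contDiffOn hIo hMC (mem_timesOf hP)).clm_apply
      (hasDerivAt_const P.1.1 P.1.2)).add (hasDerivAt_of_contDiffOn hIo hXC (mem_timesOf hP))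
    have h3 := h1.unique (h2.congr_of_eventuallyEq (by
      filter_upwards [eventually_mem_time hO hP] with t ht
      have := hX _ ht
      simp only at this
      simp only [Pi.add_apply, ← this]
      abel))
    simpa using h3
  -- the derivatives of the `ψ`-component
  have hΨx : ∀ P ∈ U, ∀ ξ, (fderiv ℝ φ P ((0, ξ), 0)).2
      = Complex.I * (((2 * deriv T P.1.1)⁻¹
        * inner ℝ (M P.1.1 ξ) (deriv M P.1.1 P.1.2 + deriv X P.1.1) : ℝ) : ℂ) * (φ P).2 := by
    intro P hP ξ
    obtain ⟨ζ, hζ⟩ := surjective_of_inner (abs_ne_zero.2 (hstr _ hP).1.time_ne)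
      (hstr _ hP).1.conf (fderiv ℝ φ P ((1, 0), 0)).1.2
    have h1 := (second_order a₀ hO hC hM hP (hstr P hP).1 hζ).2.1 ξ P.2
    rw [hhom P hP, hMeq P hP, hXt P hP, ← hTd P hP] at h1
    -- Differentiating Euler's identity `hhom` along `x` converts the mixed derivative known from
    -- `second_order` into `Ψ_x` itself.
    have h2 : HasFDerivAt (fun R : Var n => ((0, R.2) : Var n))
        ((0 : Var n →L[ℝ] Base n).prod (ContinuousLinearMap.snd ℝ (Base n) ℂ)) P :=
      (hasFDerivAt_const (𝕜 := ℝ) (0 : Base n) P).prodMk (hasFDerivAt_snd (𝕜 := ℝ) (p := P))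
    have h3 := ((differentiableAt_fderiv (hC2 P hP)).hasFDerivAt.clm_apply h2).snd
    have h4 := h3.unique ((hd P hP).hasFDerivAt.snd.congr_of_eventuallyEq (by
      filter_upwards [hO.mem_nhds hP] with R hR
      exact hhom R hR))
    have h5 := congrArg (fun A : Var n →L[ℝ] ℂ => A ((0, ξ), 0)) h4
    have h6 : (fderiv ℝ φ P (0, 0)).2 = 0 := congrArg Prod.snd (map_zero (fderiv ℝ φ P))
    simp only [ContinuousLinearMap.comp_apply, _root_.add_apply, ContinuousLinearMap.coe_snd',
      ContinuousLinearMap.flip_apply, ContinuousLinearMap.prod_apply, _root_.zero_apply, h6,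
      Prod.snd_add, zero_add] at h5
    rw [← h5, h1]
    push_cast
    ring
  have hΨz : ∀ P ∈ U, ∀ z, (fderiv ℝ φ P (0, z)).2
      = (φ P).2 * (hat σ P.2)⁻¹ * hat σ z := by
    intro P hP z
    have h0 : ∀ z, (fderiv ℝ φ P (0, z)).2 = (fderiv ℝ φ P (0, 1)).2 * hat σ z := by
      intro z
      rw [(hstr P hP).2.apply (hstr P hP).1.time_ne, ← hTd P hP,
        hat_congr (hσ _ (mem_timesOf hP)).2.2]
    have hne : hat σ P.2 ≠ 0 := by
      rw [Ne, hat_eq_zero]; exact hU.ne_zero P hP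
    rw [← hhom P hP, h0 z, h0 P.2]
    field_simp
  -- the linear part of the space component is a multiple of a constant orthogonal map
  have hsymm : ∀ t ∈ timesOf U, ∀ ξ η,
      inner ℝ (M t ξ) (deriv M t η) = inner ℝ (M t η) (deriv M t ξ) := by
    rintro _ ⟨P, hP, rfl⟩ ξ η
    change inner ℝ (M P.1.1 ξ) (deriv M P.1.1 η) = inner ℝ (M P.1.1 η) (deriv M P.1.1 ξ)
    have key : ∀ ξ η : Space n, (fderiv ℝ (fderiv ℝ φ) P ((0, η), 0) ((0, ξ), 0)).2
        = Complex.I * (((2 * deriv T P.1.1)⁻¹ * inner ℝ (M P.1.1 ξ) (deriv M P.1.1 η) : ℝ) : ℂ)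
            * (φ P).2
          + Complex.I * (((2 * deriv T P.1.1)⁻¹
            * inner ℝ (M P.1.1 ξ) (deriv M P.1.1 P.1.2 + deriv X P.1.1) : ℝ) : ℂ)
            * (Complex.I * (((2 * deriv T P.1.1)⁻¹
            * inner ℝ (M P.1.1 η) (deriv M P.1.1 P.1.2 + deriv X P.1.1) : ℝ) : ℂ) * (φ P).2) := by
      intro ξ η
      have h1 : HasFDerivAt (fun R => (fderiv ℝ φ R ((0, ξ), 0)).2) _ P :=
        (hasFDerivAt_fderiv_apply (hC2 P hP) ((0, ξ), 0)).snd
      have h2 := hasDerivAt_slice h1.differentiableAt η 0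
      rw [h1.fderiv] at h2
      have h3 : HasFDerivAt (fun P => (φ P).2) _ P := (hd P hP).hasFDerivAt.snd
      have h4 := hasDerivAt_slice h3.differentiableAt η 0
      rw [h3.fderiv] at h4
      have h0 : HasDerivAt (fun s : ℝ => P.1.2 + s • η) η 0 := by
        have := ((hasDerivAt_id (0 : ℝ)).smul_const η).const_add P.1.2
        simpa using this
      have h5 : HasDerivAt (fun s : ℝ => deriv M P.1.1 (P.1.2 + s • η) + deriv X P.1.1)
          (deriv M P.1.1 η) 0 :=
        ((deriv M P.1.1).hasFDerivAt.comp_hasDerivAt 0 h0).add_const _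
      have h6 := (((((hasDerivAt_const (0 : ℝ) (M P.1.1 ξ)).inner ℝ h5).const_mul
        ((2 * deriv T P.1.1)⁻¹)).ofReal_comp).const_mul Complex.I).mul h4
      have hcont : Tendsto (fun s : ℝ => (((P.1.1, P.1.2 + s • η), P.2 + s • (0 : ℂ)) : Var n))
          (𝓝 0) (𝓝 P) := by
        have : Continuous fun s : ℝ => (((P.1.1, P.1.2 + s • η), P.2 + s • (0 : ℂ)) : Var n) := by
          fun_prop
        have h7 := this.tendsto 0
        simpa using h7
      have h8 := h2.unique (h6.congr_of_eventuallyEq (by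
        filter_upwards [hcont.eventually (hO.mem_nhds hP)] with s hs
        exact hΨx _ hs ξ))
      have h9 : (fderiv ℝ φ P ((0, η), 0)).2 = _ := hΨx P hP η
      simp only [ContinuousLinearMap.comp_apply, ContinuousLinearMap.coe_snd',
        ContinuousLinearMap.flip_apply, zero_smul, add_zero, h9, inner_zero_left] at h8
      exact h8
    -- The product of the two logarithmic derivatives is symmetric, so the symmetry of `Ψ_xx` passes
    -- to the form `⟪M ξ, M_t η⟫`; here `Ψ ≠ 0` is used.
    have h1 := key ξ η
    have h2 := key η ξ
    rw [fderiv_fderiv_symm (hC2 P hP), h2] at h1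
    have hψ := hφ0 P hP
    have h3 : Complex.I * (φ P).2 * (((2 * deriv T P.1.1 : ℝ) : ℂ))⁻¹
        * ((inner ℝ (M P.1.1 ξ) (deriv M P.1.1 η) : ℝ) - (inner ℝ (M P.1.1 η) (deriv M P.1.1 ξ) : ℝ))
        = 0 := by
      push_cast at h1 ⊢
      linear_combination -h1
    rcases mul_eq_zero.1 h3 with h4 | h4
    · exfalso
      revert h4
      push_cast
      simp [hψ, hTne _ (mem_timesOf hP)]
    · exact_mod_cast sub_eq_zero.1 h4
  -- Differentiating the conformality relation fixes the symmetric part of `Mᵀ M_t`, and `hsymm`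
  -- excludes a skew part. A rotation depending on `t` is thereby impossible.
  have hM' : ∀ t ∈ timesOf U, deriv M t = (deriv (deriv T) t / (2 * deriv T t)) • M t := by
    intro t ht
    refine ContinuousLinearMap.ext fun ξ => ?_
    refine ext_inner_left ℝ fun w => ?_
    obtain ⟨η, rfl⟩ := surjective_of_inner (abs_ne_zero.2 (hTne t ht)) (hconf t ht) w
    have hMd := hasDerivAt_of_contDiffOn hIo hMC ht
    have h1 := fun ξ => hMd.clm_apply (hasDerivAt_const t ξ)
    have h2 := (h1 ξ).inner ℝ (h1 η)
    have h3 := ((hasDerivAt_of_contDiffOn hIo hT'C ht).const_mul σ).mul_const (inner ℝ ξ η)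
    have h4 := h2.unique (h3.congr_of_eventuallyEq (by
      filter_upwards [hIo.mem_nhds ht] with s hs
      rw [hconf s hs, (hσ s hs).1]))
    simp only [map_zero, add_zero] at h4
    have h5 := hsymm t ht ξ η
    have h6 := hconf t ht η ξ
    rw [(hσ t ht).1, real_inner_comm ξ η] at h6
    rw [real_inner_comm (M t η) (deriv M t ξ)] at h4
    rw [_root_.smul_apply, inner_smul_right, h6]
    have := hTne t ht
    field_simp
    linarith
  obtain ⟨t₀, ht₀⟩ : (timesOf U).Nonempty := hU.nonempty.image _
  have hN : ∀ t ∈ timesOf U, HasDerivAt (fun t => (√|deriv T t|)⁻¹ • M t) 0 t := by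
    intro t ht
    have hpos : 0 < |deriv T t| := abs_pos.2 (hTne t ht)
    have h1 : HasDerivAt (fun s => |deriv T s|) (σ * deriv (deriv T) t) t := by
      refine ((hasDerivAt_of_contDiffOn hIo hT'C ht).const_mul σ).congr_of_eventuallyEq ?_
      filter_upwards [hIo.mem_nhds ht] with s hs
      exact (hσ s hs).1
    have h2 := (h1.sqrt hpos.ne').inv (Real.sqrt_pos.2 hpos).ne'
    have h3 := h2.smul (hasDerivAt_of_contDiffOn hIo hMC ht)
    refine h3.congr_deriv ?_
    have hs := Real.sqrt_pos.2 hpos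
    have hsq : √|deriv T t| ^ 2 = σ * deriv T t := by rw [Real.sq_sqrt hpos.le, (hσ t ht).1]
    have hT0 := hTne t ht
    have e : (√|deriv T t|)⁻¹ * (deriv (deriv T) t / (2 * deriv T t))
        + -(σ * deriv (deriv T) t / (2 * √|deriv T t|)) / √|deriv T t| ^ 2 = 0 := by
      rw [hsq]
      field_simp
      ring
    refine ContinuousLinearMap.ext fun ξ => ?_
    change (√|deriv T t|)⁻¹ • deriv M t ξ
      + (-(σ * deriv (deriv T) t / (2 * √|deriv T t|)) / √|deriv T t| ^ 2) • M t ξ = 0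
    rw [hM' t ht, _root_.smul_apply, smul_smul, ← add_smul, e, zero_smul]
  obtain ⟨O, hOo, hOM⟩ := exists_matMap (A := (√|deriv T t₀|)⁻¹ • M t₀) (fun ξ η => by
    have hpos : 0 < |deriv T t₀| := abs_pos.2 (hTne t₀ ht₀)
    simp only [_root_.smul_apply, inner_smul_left, inner_smul_right, conj_trivial, hconf t₀ ht₀]
    rw [← mul_assoc, ← mul_assoc, ← mul_inv, Real.mul_self_sqrt hpos.le, inv_mul_cancel₀ hpos.ne',
      one_mul])
  have hMO : ∀ t ∈ timesOf U, ∀ ξ, M t ξ = √|deriv T t| • matMap O ξ := by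
    intro t ht ξ
    have h1 := eq_const_of_hasDerivAt_zero hIo hIc hN ht₀ ht
    have hpos := Real.sqrt_pos.2 (abs_pos.2 (hTne t ht))
    rw [hOM, h1, _root_.smul_apply, smul_smul, mul_inv_cancel₀ hpos.ne', one_smul]
  -- the phase and the amplitude
  have hpe : ∀ P ∈ U, ∀ ξ, HasDerivAt
      (fun s : ℝ => psiExponent T (fun a s => X s a) 0 0 O P.1.1 (P.1.2 + s • ξ))
      (Complex.I * (((2 * deriv T P.1.1)⁻¹
        * inner ℝ (M P.1.1 ξ) (deriv M P.1.1 P.1.2 + deriv X P.1.1) : ℝ) : ℂ)) 0 := by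
    intro P hP ξ
    have ht := mem_timesOf hP
    have h1 := hasDerivAt_psiExponent T 0 0 O
      (hasDerivAt_of_contDiffOn hIo hXC ht).differentiableAt P.1.2 ξ
    rw [phase_identity (hTne _ ht) (inner_matMap hOo)] at h1
    rw [hM' _ ht, _root_.smul_apply, hMO _ ht, hMO _ ht]
    exact h1
  -- With `|T_t|` replaced by `σ T_t` and the square root absorbed into `M`, the phase becomes an
  -- expression of evidently smooth functions.
  have hpeC : ContDiffOn ℝ ∞
      (fun P : Var n => psiExponent T (fun a s => X s a) 0 0 O P.1.1 P.1.2) U := by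
    have e : ∀ P ∈ U, psiExponent T (fun a s => X s a) 0 0 O P.1.1 P.1.2
        = Complex.I * ((1 / 8 * (deriv (deriv T) P.1.1 / (σ * deriv T P.1.1)) * inner ℝ P.1.2 P.1.2
        + (2 * deriv T P.1.1)⁻¹ * inner ℝ (M P.1.1 P.1.2) (deriv X P.1.1) : ℝ) : ℂ) := by
      intro P hP
      have ht := mem_timesOf hP
      rw [psiExponent_eq T X _ _ O (hasDerivAt_of_contDiffOn hIo hXC ht).differentiableAt,
        (hσ _ ht).1]
      have h1 := phase_identity (r₂ := 0) (hTne _ ht) (inner_matMap hOo) 0 P.1.2 (deriv X P.1.1)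
      simp only [zero_div, mul_zero, zero_mul, map_zero, smul_zero, zero_add] at h1
      rw [← (hσ _ ht).1, h1, ← hMO _ ht]
      simp
    refine ContDiffOn.congr ?_ e
    have hx : ContDiffOn ℝ ∞ (fun P : Var n => P.1.2) U := contDiff_fst.snd.contDiffOn
    have hT1 := hT'C.comp htime hmaps
    have hT2 := (contDiffOn_infty_deriv hIo hT'C).comp htime hmaps
    have hX1 := (contDiffOn_infty_deriv hIo hXC).comp htime hmaps
    have hM1 := (hMC.comp htime hmaps).clm_apply hx
    have hne : ∀ P ∈ U, deriv T P.1.1 ≠ 0 := fun P hP => hTne _ (mem_timesOf hP)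
    have h1 : ContDiffOn ℝ ∞ (fun P : Var n => 1 / 8 * (deriv (deriv T) P.1.1
        / (σ * deriv T P.1.1)) * inner ℝ P.1.2 P.1.2
        + (2 * deriv T P.1.1)⁻¹ * inner ℝ (M P.1.1 P.1.2) (deriv X P.1.1)) U :=
      ((contDiffOn_const.mul (hT2.div (contDiffOn_const.mul hT1)
        (fun P hP => mul_ne_zero hσ0 (hne P hP)))).mul (hx.inner ℝ hx)).add
      (((contDiffOn_const.mul hT1).inv (fun P hP => mul_ne_zero two_ne_zero (hne P hP))).mul
        (hM1.inner ℝ hX1))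
    exact contDiffOn_const.mul (Complex.ofRealCLM.contDiff.comp_contDiffOn h1)
  have hhat : ContDiff ℝ ∞ (hat σ) := by
    unfold hat
    split_ifs
    · exact contDiff_id
    · exact Complex.conjCLE.contDiff
  have hhatne : ∀ P ∈ U, hat σ P.2 ≠ 0 := fun P hP => by
    rw [Ne, hat_eq_zero]; exact hU.ne_zero P hP
  have hfC : ContDiffOn ℝ ∞ (fun P : Var n => (φ P).2
      * Complex.exp (-psiExponent T (fun a s => X s a) 0 0 O P.1.1 P.1.2) * (hat σ P.2)⁻¹) U :=
    (hC.snd.mul hpeC.neg.cexp).mul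
      ((hhat.comp_contDiffOn contDiff_snd.contDiffOn).inv hhatne)
  -- `Ψ`, divided by its `x`-phase (taken with `S = Z = 0`) and by `hat σ ψ`, has no slice
  -- derivatives left; the logarithm of the quotient supplies `S` and `Z`.
  obtain ⟨R, hRC, hR⟩ := exists_eq_time hU hfC (by
    intro P hP ξ z
    have h0 := ((hfC P hP).contDiffAt (hO.mem_nhds hP)).differentiableAt (by simp)
    have h1 := hasDerivAt_slice h0 ξ z
    have h3 : HasFDerivAt (fun P => (φ P).2) _ P := (hd P hP).hasFDerivAt.snd
    have h4 := hasDerivAt_slice h3.differentiableAt ξ z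
    rw [h3.fderiv] at h4
    have h5 : HasDerivAt (fun s : ℝ => hat σ (P.2 + s • z)) (hat σ z) 0 := by
      have e : (fun s : ℝ => hat σ (P.2 + s • z)) = fun s : ℝ => hat σ P.2 + s • hat σ z := by
        funext s
        rw [hat_add, Complex.real_smul, hat_mul, hat_ofReal, Complex.real_smul]
      rw [e]
      have := ((hasDerivAt_id (0 : ℝ)).smul_const (hat σ z)).const_add (hat σ P.2)
      simpa using this
    have h6 := (h4.mul (hpe P hP ξ).neg.cexp).mul (h5.inv (by simpa using hhatne P hP))
    rw [h1.unique h6]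
    have h7 : (fderiv ℝ φ P ((0, ξ), z)).2 = (fderiv ℝ φ P ((0, ξ), 0)).2
        + (fderiv ℝ φ P (0, z)).2 := by
      have e : (((0, ξ), z) : Var n) = ((0, ξ), 0) + (0, z) := by simp
      rw [e, map_add, Prod.snd_add]
    have hne := hhatne P hP
    simp only [ContinuousLinearMap.comp_apply, ContinuousLinearMap.coe_snd', zero_smul, add_zero,
      h7, hΨx P hP, hΨz P hP, Pi.mul_apply, Pi.inv_apply]
    field_simp
    ring)
  obtain ⟨S, Z, hSC, hZC, hSZ⟩ := exists_smooth_log hIo hIc hRC (by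
    rintro _ ⟨P, hP, rfl⟩
    change R P.1.1 ≠ 0
    rw [← hR P hP]
    exact mul_ne_zero (mul_ne_zero (hφ0 P hP) (Complex.exp_ne_zero _)) (inv_ne_zero (hhatne P hP)))
  refine ⟨T, X, S, Z, O, hTC, hXC, hSC, hZC, hTne, hOo, hT, fun P hP => ?_, fun P hP => ?_⟩
  · rw [← hMO _ (mem_timesOf hP), ← hX P hP]
    abel
  · have ht := mem_timesOf hP
    have h1 := hR P hP
    rw [hSZ _ ht] at h1
    have hXd := (hasDerivAt_of_contDiffOn hIo hXC ht).differentiableAt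
    have e : psiExponent T (fun a s => X s a) S Z O P.1.1 P.1.2
        = psiExponent T (fun a s => X s a) 0 0 O P.1.1 P.1.2
          + (Complex.I * S P.1.1 + Z P.1.1) := by
      rw [psiExponent_eq T X S Z O hXd, psiExponent_eq T X 0 0 O hXd]
      push_cast
      simp only [Pi.zero_apply, Complex.ofReal_zero]
      ring
    rw [e, Complex.exp_add, ← h1, hat_congr (hσ _ ht).2.2]
    have hne := hhatne P hP
    rw [Complex.exp_neg]
    field_simp [Complex.exp_ne_zero]

/-! ### The time derivative of the phase and the potential shift -/

/-- The potential shift in terms of the inner product. -/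
theorem potentialShift_eq (T : ℝ → ℝ) {X : ℝ → Space n} (S : ℝ → ℝ)
    (O : Matrix (Fin n) (Fin n) ℝ) {t : ℝ} (hX : ∀ᶠ s in 𝓝 t, DifferentiableAt ℝ X s)
    (hX' : DifferentiableAt ℝ (deriv X) t) (hT' : DifferentiableAt ℝ (deriv T) t)
    (hT0 : deriv T t ≠ 0) (x : Space n) :
    potentialShift T (fun a s => X s a) S O t x
      = (2 * deriv (deriv (deriv T)) t * deriv T t - 3 * deriv (deriv T) t ^ 2)
          / (16 * Real.sign (deriv T t) * deriv T t ^ 3) * inner ℝ x x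
        + Real.sign (deriv T t) / 2 / √|deriv T t|
          * (inner ℝ (matMap O x) (deriv (deriv X) t) / deriv T t
            - inner ℝ (matMap O x) (deriv X t) * deriv (deriv T) t / deriv T t ^ 2)
        + deriv S t / deriv T t - inner ℝ (deriv X t) (deriv X t) / (4 * deriv T t ^ 2) := by
  have h1 : ∀ a, ∀ᶠ s in 𝓝 t, deriv (fun s => X s a) s = deriv X s a := fun a => by
    filter_upwards [hX] with s hs
    exact ((EuclideanSpace.proj (𝕜 := ℝ) a).hasFDerivAt.comp_hasDerivAt s hs.hasDerivAt).deriv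
  have h1t : ∀ a, deriv (fun s => X s a) t = deriv X t a := fun a => (h1 a).self_of_nhds
  have h2 : ∀ a, deriv (fun s => deriv (fun s => X s a) s / deriv T s) t
      = deriv (deriv X) t a / deriv T t - deriv X t a * deriv (deriv T) t / deriv T t ^ 2 := by
    intro a
    have h3 : HasDerivAt (fun s => deriv X s a) (deriv (deriv X) t a) t :=
      (EuclideanSpace.proj (𝕜 := ℝ) a).hasFDerivAt.comp_hasDerivAt t hX'.hasDerivAt
    have h4 : HasDerivAt (fun s => deriv (fun s => X s a) s / deriv T s) _ t :=
      (h3.div hT'.hasDerivAt hT0).congr_of_eventuallyEq (by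
        filter_upwards [h1 a] with s hs
        simp [hs])
    rw [h4.deriv]
    field_simp
  unfold potentialShift
  simp only [h1t, h2, inner_eq_sum, matMap_apply]
  have h5 : Real.sign (deriv T t) / 2 * ∑ b, ∑ a,
      (deriv (deriv X) t b / deriv T t - deriv X t b * deriv (deriv T) t / deriv T t ^ 2)
        * (O b a * x a) / √|deriv T t|
      = Real.sign (deriv T t) / 2 / √|deriv T t|
        * ((∑ b, (∑ a, O b a * x a) * deriv (deriv X) t b) / deriv T t
          - (∑ b, (∑ a, O b a * x a) * deriv X t b) * deriv (deriv T) t / deriv T t ^ 2) := by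
    rw [Finset.sum_mul, Finset.sum_div, Finset.sum_div, ← Finset.sum_sub_distrib, Finset.mul_sum,
      Finset.mul_sum]
    refine Finset.sum_congr rfl fun b _ => ?_
    rw [← Finset.sum_div, ← Finset.mul_sum]
    ring
  rw [h5]

/-- Scalar core of the formula that the potential shift is the time derivative of the phase over
`T_t`, minus `|v|² / (4 T_t²)` with `v` the velocity of the new `x`. Here `r`, `r₂`, `r₃` stand for
the derivatives of `T`, `k` for `|T_t|^{1/2}`, and `a`, `b`, `c`, `d` for the inner products of `O
x`, `X_t`, `X_tt`. Only the coefficients of `a` and `b` need work. -/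
theorem shift_identity {σ r r₂ r₃ k a b c d s : ℝ} (hσ : σ * σ = 1) (hr : r ≠ 0) (hk : k ≠ 0)
    (hkk : k * k = σ * r) :
    (1 / 8 * ((r₃ * (σ * r) - r₂ * (σ * r₂)) / (σ * r) ^ 2) * a
        + 1 / 2 * (σ * (c / k - b * (σ * r₂ / (2 * k)) / k ^ 2)) + s) / r
      - ((r₂ / (2 * r) * k) ^ 2 * a + 2 * (r₂ / (2 * r) * k) * b + d) / (4 * r ^ 2)
    = (2 * r₃ * r - 3 * r₂ ^ 2) / (16 * σ * r ^ 3) * a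
      + σ / 2 / k * (c / r - b * r₂ / r ^ 2) + s / r - d / (4 * r ^ 2) := by
  have hσ0 : σ ≠ 0 := by rintro rfl; simp at hσ
  have e1 : 1 / 8 * ((r₃ * (σ * r) - r₂ * (σ * r₂)) / (σ * r) ^ 2) / r
      - (r₂ / (2 * r) * k) ^ 2 / (4 * r ^ 2)
      = (2 * r₃ * r - 3 * r₂ ^ 2) / (16 * σ * r ^ 3) := by
    have : (r₂ / (2 * r) * k) ^ 2 = r₂ ^ 2 / (4 * r ^ 2) * (σ * r) := by
      rw [mul_pow, pow_two k, hkk]; ring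
    rw [this]
    field_simp
    linear_combination (-128 * r₂ ^ 2) * hσ
  have e2 : 1 / 2 * (σ * (-(σ * r₂ / (2 * k)) / k ^ 2)) / r
      - 2 * (r₂ / (2 * r) * k) / (4 * r ^ 2) = σ / 2 / k * (-r₂ / r ^ 2) := by
    rw [pow_two k, hkk]
    field_simp
    linear_combination (-4 * r₂) * hkk
  linear_combination a * e1 + b * e2

variable {U : Set (Var n)} {φ : Var n → Var n} {T : ℝ → ℝ} {X : ℝ → Space n} {S Z : ℝ → ℝ}
  {O : Matrix (Fin n) (Fin n) ℝ}

/-- The derivative of the `x`-component with respect to `t`. -/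
def timeVelocity (T : ℝ → ℝ) (X : ℝ → Space n) (O : Matrix (Fin n) (Fin n) ℝ) (t : ℝ)
    (x : Space n) : Space n :=
  (deriv (deriv T) t / (2 * deriv T t)) • (√|deriv T t| • matMap O x) + deriv X t

theorem HasVarForm.hasDerivAt_sqrt (h : HasVarForm U φ T X S Z O) (hU : IsVarDomain U) {t : ℝ}
    (ht : t ∈ timesOf U) :
    HasDerivAt (fun s => √|deriv T s|) (deriv (deriv T) t / (2 * deriv T t) * √|deriv T t|) t := by
  have hIo := isOpen_timesOf hU.isOpen
  have hT'C := contDiffOn_infty_deriv hIo h.T_smooth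
  obtain ⟨σ, hσσ, hσ⟩ := exists_sign hU.times_connected hT'C.continuousOn h.T_ne
  have hpos : 0 < |deriv T t| := abs_pos.2 (h.T_ne t ht)
  have h1 : HasDerivAt (fun s => |deriv T s|) (σ * deriv (deriv T) t) t := by
    refine ((hasDerivAt_of_contDiffOn hIo hT'C ht).const_mul σ).congr_of_eventuallyEq ?_
    filter_upwards [hIo.mem_nhds ht] with s hs
    exact (hσ s hs).1
  refine (h1.sqrt hpos.ne').congr_deriv ?_
  have hsq : √|deriv T t| ^ 2 = σ * deriv T t := by rw [Real.sq_sqrt hpos.le, (hσ t ht).1]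
  have hs := Real.sqrt_pos.2 hpos
  have hT0 := h.T_ne t ht
  field_simp
  rw [hsq]
  ring

/-- The derivative of the phase with respect to `t`. -/
theorem HasVarForm.hasDerivAt_psiExponent_time (h : HasVarForm U φ T X S Z O) (hU : IsVarDomain U)
    {t : ℝ} (ht : t ∈ timesOf U) (x : Space n) :
    HasDerivAt (fun s => psiExponent T (fun a s => X s a) S Z O s x)
      (Complex.I * ((deriv T t * (potentialShift T (fun a s => X s a) S O t x
        + inner ℝ (timeVelocity T X O t x) (timeVelocity T X O t x) / (4 * deriv T t ^ 2)) : ℝ) : ℂ)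
        + ((deriv Z t : ℝ) : ℂ)) t := by
  have hIo := isOpen_timesOf hU.isOpen
  have hT'C := contDiffOn_infty_deriv hIo h.T_smooth
  have hX'C := contDiffOn_infty_deriv hIo h.X_smooth
  obtain ⟨σ, hσσ, hσ⟩ := exists_sign hU.times_connected hT'C.continuousOn h.T_ne
  have hT0 := h.T_ne t ht
  have hσ0 : σ ≠ 0 := by rintro rfl; simp at hσσ
  have hpos : 0 < |deriv T t| := abs_pos.2 hT0
  have hs := Real.sqrt_pos.2 hpos
  have hkk : √|deriv T t| * √|deriv T t| = σ * deriv T t := by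
    rw [Real.mul_self_sqrt hpos.le, (hσ t ht).1]
  have hXd : ∀ᶠ s in 𝓝 t, DifferentiableAt ℝ X s := by
    filter_upwards [hIo.mem_nhds ht] with s hs
    exact (hasDerivAt_of_contDiffOn hIo h.X_smooth hs).differentiableAt
  have hT2 := hasDerivAt_of_contDiffOn hIo hT'C ht
  have hT3 := hasDerivAt_of_contDiffOn hIo (contDiffOn_infty_deriv hIo hT'C) ht
  have hX2 := hasDerivAt_of_contDiffOn hIo hX'C ht
  have h1 := ((hT3.div (hT2.const_mul σ) (mul_ne_zero hσ0 hT0)).const_mul (1 / 8)).mul_const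
    (inner ℝ x x)
  have h2 := (((hasDerivAt_const t (matMap O x)).inner ℝ hX2).div (h.hasDerivAt_sqrt hU ht)
    hs.ne').const_mul (1 / 2 * σ)
  have h3 := ((h1.add h2).add (hasDerivAt_of_contDiffOn hIo h.S_smooth ht)).ofReal_comp.const_mul
    Complex.I
  have h4 := (h3.add (hasDerivAt_of_contDiffOn hIo h.Z_smooth ht).ofReal_comp).congr_of_eventuallyEq
    (f₁ := fun s => psiExponent T (fun a s => X s a) S Z O s x) (by
      filter_upwards [hIo.mem_nhds ht] with s hs
      rw [psiExponent_eq T X S Z O (hasDerivAt_of_contDiffOn hIo h.X_smooth hs).differentiableAt,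
        (hσ s hs).1, (hσ s hs).2.1]
      simp only [Pi.add_apply]
      congr 4
      simp only [Pi.div_apply, (hσ s hs).1]
      ring)
  refine h4.congr_deriv ?_
  congr 3
  rw [potentialShift_eq T S O hXd hX2.differentiableAt hT2.differentiableAt hT0, (hσ t ht).2.1]
  have h5 := shift_identity (r₂ := deriv (deriv T) t) (r₃ := deriv (deriv (deriv T)) t)
    (a := inner ℝ x x) (b := inner ℝ (matMap O x) (deriv X t))
    (c := inner ℝ (matMap O x) (deriv (deriv X) t)) (d := inner ℝ (deriv X t) (deriv X t))
    (s := deriv S t) hσσ hT0 hs.ne' hkk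
  rw [← h5]
  have h6 : inner ℝ (timeVelocity T X O t x) (timeVelocity T X O t x)
      = (deriv (deriv T) t / (2 * deriv T t) * √|deriv T t|) ^ 2 * inner ℝ x x
        + 2 * (deriv (deriv T) t / (2 * deriv T t) * √|deriv T t|)
          * inner ℝ (matMap O x) (deriv X t) + inner ℝ (deriv X t) (deriv X t) := by
    unfold timeVelocity
    rw [smul_smul, inner_add_left, inner_add_right, inner_add_right, inner_smul_left,
      inner_smul_right, inner_smul_right, inner_smul_left, inner_matMap h.orth,
      real_inner_comm (matMap O x) (deriv X t)]
    simp only [conj_trivial]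
    ring
  rw [h6, sub_add_cancel, inner_zero_left, add_zero]
  have e : deriv (deriv T) t / (2 * deriv T t) * √|deriv T t|
      = σ * deriv (deriv T) t / (2 * √|deriv T t|) := by
    field_simp
    rw [pow_two, hkk]
    ring
  rw [e]
  field_simp

/-! ### The image equation for an explicit transformation -/

section ExplicitForm

theorem eventually_mem_slice {U : Set (Var n)} (hU : IsOpen U) {P : Var n} (hP : P ∈ U)
    (ξ : Space n) (z : ℂ) :
    ∀ᶠ s : ℝ in 𝓝 0, (((P.1.1, P.1.2 + s • ξ), P.2 + s • z) : Var n) ∈ U := by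
  have h : Continuous fun s : ℝ => (((P.1.1, P.1.2 + s • ξ), P.2 + s • z) : Var n) := by fun_prop
  have h1 := h.tendsto 0
  simp only [zero_smul, add_zero] at h1
  exact h1.eventually (hU.mem_nhds hP)

theorem hasDerivAt_line {E : Type*} [NormedAddCommGroup E] [NormedSpace ℝ E] (x v : E) :
    HasDerivAt (fun s : ℝ => x + s • v) v 0 := by
  have := ((hasDerivAt_id (0 : ℝ)).smul_const v).const_add x
  simpa using this

theorem hasDerivAt_hat (r : ℝ) (ψ z : ℂ) :
    HasDerivAt (fun s : ℝ => hat r (ψ + s • z)) (hat r z) 0 := by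
  have e : (fun s : ℝ => hat r (ψ + s • z)) = fun s : ℝ => hat r ψ + s • hat r z := by
    funext s
    rw [hat_add, Complex.real_smul, hat_mul, hat_ofReal, Complex.real_smul]
  rw [e]
  exact hasDerivAt_line _ _

variable {U : Set (Var n)} {φ : Var n → Var n} {T : ℝ → ℝ} {X : ℝ → Space n} {S Z : ℝ → ℝ}
  {O : Matrix (Fin n) (Fin n) ℝ}

/-- The logarithmic derivative of the phase factor with respect to `x`. -/
def phaseForm (T : ℝ → ℝ) (X : ℝ → Space n) (O : Matrix (Fin n) (Fin n) ℝ) (t : ℝ)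
    (x ξ : Space n) : ℝ :=
  (2 * deriv T t)⁻¹ * inner ℝ (√|deriv T t| • matMap O ξ) (timeVelocity T X O t x)

theorem HasVarForm.fderiv_slice_fst (h : HasVarForm U φ T X S Z O) (hU : IsOpen U)
    (hC : ContDiffOn ℝ ∞ φ U) {P : Var n} (hP : P ∈ U) (ξ : Space n) (z : ℂ) :
    (fderiv ℝ φ P ((0, ξ), z)).1 = (0, √|deriv T P.1.1| • matMap O ξ) := by
  have hd := ((contDiffAt_two hU hC hP).differentiableAt (by norm_num)).hasFDerivAt
  have hev := eventually_mem_slice hU hP ξ z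
  refine Prod.ext ?_ ?_
  · have h1 : HasFDerivAt (fun P => (φ P).1.1) _ P := hd.fst.fst
    have h2 := hasDerivAt_slice h1.differentiableAt ξ z
    rw [h1.fderiv] at h2
    exact h2.unique ((hasDerivAt_const (0 : ℝ) (T P.1.1)).congr_of_eventuallyEq (by
      filter_upwards [hev] with s hs
      exact h.time _ hs))
  · have h1 : HasFDerivAt (fun P => (φ P).1.2) _ P := hd.fst.snd
    have h2 := hasDerivAt_slice h1.differentiableAt ξ z
    rw [h1.fderiv] at h2
    have h3 := (((matMap O).hasFDerivAt.comp_hasDerivAt 0 (hasDerivAt_line P.1.2 ξ)).const_smul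
      (√|deriv T P.1.1|)).add_const (X P.1.1)
    exact h2.unique (h3.congr_of_eventuallyEq (by
      filter_upwards [hev] with s hs
      exact h.space _ hs))

theorem HasVarForm.fderiv_slice_snd (h : HasVarForm U φ T X S Z O) (hU : IsVarDomain U)
    (hC : ContDiffOn ℝ ∞ φ U) {P : Var n} (hP : P ∈ U) (ξ : Space n) (z : ℂ) :
    (fderiv ℝ φ P ((0, ξ), z)).2
      = (Complex.I * (phaseForm T X O P.1.1 P.1.2 ξ : ℂ)
        + hat (deriv T P.1.1) z / hat (deriv T P.1.1) P.2) * (φ P).2 := by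
  have hd := ((contDiffAt_two hU.isOpen hC hP).differentiableAt (by norm_num)).hasFDerivAt
  have ht := mem_timesOf hP
  have hIo := isOpen_timesOf hU.isOpen
  have h1 : HasFDerivAt (fun P => (φ P).2) _ P := hd.snd
  have h2 := hasDerivAt_slice h1.differentiableAt ξ z
  rw [h1.fderiv] at h2
  have h3 := hasDerivAt_psiExponent T S Z O
    (hasDerivAt_of_contDiffOn hIo h.X_smooth ht).differentiableAt P.1.2 ξ
  rw [phase_identity (h.T_ne _ ht) (inner_matMap h.orth)] at h3
  have h4 := h3.cexp.mul (hasDerivAt_hat (deriv T P.1.1) P.2 z)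
  have h5 := h2.unique (h4.congr_of_eventuallyEq (by
    filter_upwards [eventually_mem_slice hU.isOpen hP ξ z] with s hs
    exact h.fiber _ hs))
  have hne : hat (deriv T P.1.1) P.2 ≠ 0 := by
    rw [Ne, hat_eq_zero]; exact hU.ne_zero P hP
  simp only [ContinuousLinearMap.comp_apply, ContinuousLinearMap.coe_snd', zero_smul,
    add_zero] at h5
  rw [h5, h.fiber P hP]
  unfold phaseForm timeVelocity
  field_simp

theorem HasVarForm.fderiv_time (h : HasVarForm U φ T X S Z O) (hU : IsVarDomain U)
    (hC : ContDiffOn ℝ ∞ φ U) {P : Var n} (hP : P ∈ U) :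
    (fderiv ℝ φ P ((1, 0), 0)).1 = (deriv T P.1.1, timeVelocity T X O P.1.1 P.1.2) ∧
    (fderiv ℝ φ P ((1, 0), 0)).2
      = (Complex.I * ((deriv T P.1.1 * (potentialShift T (fun a s => X s a) S O P.1.1 P.1.2
        + inner ℝ (timeVelocity T X O P.1.1 P.1.2) (timeVelocity T X O P.1.1 P.1.2)
          / (4 * deriv T P.1.1 ^ 2)) : ℝ) : ℂ) + ((deriv Z P.1.1 : ℝ) : ℂ)) * (φ P).2 := by
  have hd := ((contDiffAt_two hU.isOpen hC hP).differentiableAt (by norm_num)).hasFDerivAt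
  have ht := mem_timesOf hP
  have hIo := isOpen_timesOf hU.isOpen
  have hev := eventually_mem_time hU.isOpen hP
  refine ⟨Prod.ext ?_ ?_, ?_⟩
  · have h1 : HasFDerivAt (fun P => (φ P).1.1) _ P := hd.fst.fst
    have h2 := hasDerivAt_time h1.differentiableAt
    rw [h1.fderiv] at h2
    exact h2.unique ((hasDerivAt_of_contDiffOn hIo h.T_smooth ht).congr_of_eventuallyEq (by
      filter_upwards [hev] with s hs
      exact h.time _ hs))
  · have h1 : HasFDerivAt (fun P => (φ P).1.2) _ P := hd.fst.snd
    have h2 := hasDerivAt_time h1.differentiableAt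
    rw [h1.fderiv] at h2
    have h3 := ((h.hasDerivAt_sqrt hU ht).smul_const (matMap O P.1.2)).add
      (hasDerivAt_of_contDiffOn hIo h.X_smooth ht)
    have h4 := h2.unique (h3.congr_of_eventuallyEq (by
      filter_upwards [hev] with s hs
      exact h.space _ hs))
    rw [← smul_smul] at h4
    exact h4
  · have h1 : HasFDerivAt (fun P => (φ P).2) _ P := hd.snd
    have h2 := hasDerivAt_time h1.differentiableAt
    rw [h1.fderiv] at h2
    have h3 := (h.hasDerivAt_psiExponent_time hU ht P.1.2).cexp.mul_const
      (hat (deriv T P.1.1) P.2)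
    obtain ⟨σ, -, hσ⟩ := exists_sign hU.times_connected
      (contDiffOn_infty_deriv hIo h.T_smooth).continuousOn h.T_ne
    have h4 := h2.unique (h3.congr_of_eventuallyEq (by
      filter_upwards [hev, hIo.mem_nhds ht] with s hs hs'
      rw [h.fiber _ hs, hat_congr ((hσ s hs').2.2.trans (hσ _ ht).2.2.symm)]))
    simp only [ContinuousLinearMap.comp_apply, ContinuousLinearMap.coe_snd'] at h4
    rw [h4, h.fiber P hP]
    ring

theorem HasVarForm.conf (h : HasVarForm U φ T X S Z O) {t : ℝ} (ξ η : Space n) :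
    inner ℝ (√|deriv T t| • matMap O ξ) (√|deriv T t| • matMap O η)
      = |deriv T t| * inner ℝ ξ η := by
  rw [inner_smul_left, inner_smul_right, inner_matMap h.orth, conj_trivial, ← mul_assoc,
    Real.mul_self_sqrt (abs_nonneg _)]

/-- For an explicit transformation this structure is verified directly, without any equation, so
that the pulled-back form of the image equation becomes available for the converse direction. -/
theorem HasVarForm.sliceStructure (h : HasVarForm U φ T X S Z O) (hU : IsVarDomain U)
    (hC : ContDiffOn ℝ ∞ φ U) {P : Var n} (hP : P ∈ U) :
    SliceStructure (fderiv ℝ φ P) (fderiv ℝ (fderiv ℝ φ) P) := by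
  have ht := mem_timesOf hP
  refine ⟨fun ξ z => ?_, fun z => ?_, ?_, fun ξ η => ?_, fun ξ z ξ' z' => ?_⟩
  · rw [h.fderiv_slice_fst hU.isOpen hC hP]
  · have := h.fderiv_slice_fst hU.isOpen hC hP 0 z
    rw [map_zero, smul_zero] at this
    exact this
  · rw [(h.fderiv_time hU hC hP).1]
    exact h.T_ne _ ht
  · rw [(h.fderiv_time hU hC hP).1, spaceMap_apply, spaceMap_apply,
      h.fderiv_slice_fst hU.isOpen hC hP, h.fderiv_slice_fst hU.isOpen hC hP]
    exact h.conf ξ η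
  · have h1 : HasFDerivAt (fun R => (fderiv ℝ φ R ((0, ξ'), z')).1) _ P :=
      (hasFDerivAt_fderiv_apply (contDiffAt_two hU.isOpen hC hP) ((0, ξ'), z')).fst
    have h2 := hasDerivAt_slice h1.differentiableAt ξ z
    rw [h1.fderiv] at h2
    exact h2.unique ((hasDerivAt_const (0 : ℝ)
      ((0, √|deriv T P.1.1| • matMap O ξ') : Base n)).congr_of_eventuallyEq (by
        filter_upwards [eventually_mem_slice hU.isOpen hP ξ z] with s hs
        exact h.fderiv_slice_fst hU.isOpen hC hs ξ' z'))

/-- The first derivative is `(i ω + hat z / hat ψ) Ψ` with `ω` the phase form. On differentiating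
once more the terms `(hat z / hat ψ)²` cancel, since `Ψ` is linear in `hat ψ`. -/
theorem HasVarForm.fderiv_fderiv_snd (h : HasVarForm U φ T X S Z O) (hU : IsVarDomain U)
    (hC : ContDiffOn ℝ ∞ φ U) {P : Var n} (hP : P ∈ U) (ξ : Space n) (z : ℂ) :
    (fderiv ℝ (fderiv ℝ φ) P ((0, ξ), z) ((0, ξ), z)).2
      = (Complex.I * ((|deriv T P.1.1| * deriv (deriv T) P.1.1 / (4 * deriv T P.1.1 ^ 2)
          * inner ℝ ξ ξ : ℝ) : ℂ) - (phaseForm T X O P.1.1 P.1.2 ξ : ℂ) ^ 2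
        + 2 * Complex.I * (phaseForm T X O P.1.1 P.1.2 ξ : ℂ)
          * (hat (deriv T P.1.1) z / hat (deriv T P.1.1) P.2)) * (φ P).2 := by
  have ht := mem_timesOf hP
  have hT0 := h.T_ne _ ht
  have h1 : HasFDerivAt (fun R => (fderiv ℝ φ R ((0, ξ), z)).2) _ P :=
    (hasFDerivAt_fderiv_apply (contDiffAt_two hU.isOpen hC hP) ((0, ξ), z)).snd
  have h2 := hasDerivAt_slice h1.differentiableAt ξ z
  rw [h1.fderiv] at h2
  have hd := ((contDiffAt_two hU.isOpen hC hP).differentiableAt (by norm_num)).hasFDerivAt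
  have h3 : HasFDerivAt (fun P => (φ P).2) _ P := hd.snd
  have h4 := hasDerivAt_slice h3.differentiableAt ξ z
  rw [h3.fderiv] at h4
  have hne : hat (deriv T P.1.1) P.2 ≠ 0 := by
    rw [Ne, hat_eq_zero]; exact hU.ne_zero P hP
  have h5 : HasDerivAt (fun s : ℝ => phaseForm T X O P.1.1 (P.1.2 + s • ξ) ξ)
      (|deriv T P.1.1| * deriv (deriv T) P.1.1 / (4 * deriv T P.1.1 ^ 2) * inner ℝ ξ ξ) 0 := by
    have h6 := ((((matMap O).hasFDerivAt.comp_hasDerivAt 0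
      (hasDerivAt_line P.1.2 ξ)).const_smul (√|deriv T P.1.1|)).const_smul
      (deriv (deriv T) P.1.1 / (2 * deriv T P.1.1))).add_const (deriv X P.1.1)
    have h7 := ((hasDerivAt_const (0 : ℝ) (√|deriv T P.1.1| • matMap O ξ)).inner ℝ h6).const_mul
      ((2 * deriv T P.1.1)⁻¹)
    refine h7.congr_deriv ?_
    rw [inner_zero_left, add_zero, inner_smul_right, h.conf]
    field_simp
    ring
  have h8 := ((h5.ofReal_comp.const_mul Complex.I).add ((hasDerivAt_const (0 : ℝ)
    (hat (deriv T P.1.1) z)).div (hasDerivAt_hat (deriv T P.1.1) P.2 z) (by simpa using hne))).mul h4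
  have h9 := h2.unique (h8.congr_of_eventuallyEq (by
    filter_upwards [eventually_mem_slice hU.isOpen hP ξ z] with s hs
    exact h.fderiv_slice_snd hU hC hs ξ z))
  have h10 := h.fderiv_slice_snd hU hC hP ξ z
  simp only [ContinuousLinearMap.comp_apply, ContinuousLinearMap.coe_snd', zero_smul,
    add_zero, ContinuousLinearMap.flip_apply, h10, Pi.add_apply, Pi.div_apply] at h9
  rw [h9]
  field_simp
  linear_combination ((hat (deriv T P.1.1) P.2) ^ 2 * (phaseForm T X O P.1.1 P.1.2 ξ : ℂ) ^ 2
    * (φ P).2) * Complex.I_sq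

/-- The condition on the arbitrary elements that expresses that a transformation of the explicit
form maps one equation to another. -/
def PotentialRelation (lam : ℝ) (φ : Var n → Var n) (T : ℝ → ℝ) (X : ℝ → Space n) (S Z : ℝ → ℝ)
    (O : Matrix (Fin n) (Fin n) ℝ) (θ θ' : ArbElem n) (P : Var n) : Prop :=
  θ'.δ * ((‖(φ P).2‖ ^ lam : ℝ) : ℂ) + θ'.V (φ P).1
    = (hat (deriv T P.1.1) θ.δ * ((‖P.2‖ ^ lam : ℝ) : ℂ) + hat (deriv T P.1.1) (θ.V P.1))
        / ((|deriv T P.1.1| : ℝ) : ℂ)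
      + (potentialShift T (fun a s => X s a) S O P.1.1 P.1.2 : ℂ)
      + Complex.I * ((-(deriv Z P.1.1 / deriv T P.1.1)
        - n / 4 * (deriv (deriv T) P.1.1 / deriv T P.1.1 ^ 2) : ℝ) : ℂ)

/-- The image equation for a transformation of the explicit form. -/
theorem HasVarForm.image_equation {lam : ℝ} {θ θ' : ArbElem n} (h : HasVarForm U φ T X S Z O)
    (hU : IsVarDomain U) (hC : ContDiffOn ℝ ∞ φ U) {P : Var n} (hP : P ∈ U)
    {ζ : Space n} (hζ : √|deriv T P.1.1| • matMap O ζ = timeVelocity T X O P.1.1 P.1.2)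
    (m : Base n →L[ℝ] ℂ) (B : Base n →L[ℝ] Base n →L[ℝ] ℂ) :
    Complex.I * ((fderiv ℝ φ P ((1, 0), 0)).1.1 : ℂ)⁻¹
          * ((fderiv ℝ φ P ((1, 0), m (1, 0))).2 - (fderiv ℝ φ P ((0, ζ), m (0, ζ))).2)
        + ((|(fderiv ℝ φ P ((1, 0), 0)).1.1| : ℝ) : ℂ)⁻¹
          * ∑ i, ((fderiv ℝ (fderiv ℝ φ) P ((0, stdB n i), m (0, stdB n i))
              ((0, stdB n i), m (0, stdB n i))).2
            + (fderiv ℝ φ P (0, B (0, stdB n i) (0, stdB n i))).2)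
        + potTerm lam θ' (φ P)
      = (φ P).2 / (hat (deriv T P.1.1) P.2 * ((|deriv T P.1.1| : ℝ) : ℂ))
          * hat (deriv T P.1.1) (Complex.I * m (1, 0) + ∑ a, B (0, stdB n a) (0, stdB n a)
            + potTerm lam θ P)
        + (φ P).2 * (θ'.δ * ((‖(φ P).2‖ ^ lam : ℝ) : ℂ) + θ'.V (φ P).1
          - ((hat (deriv T P.1.1) θ.δ * ((‖P.2‖ ^ lam : ℝ) : ℂ) + hat (deriv T P.1.1) (θ.V P.1))
            / ((|deriv T P.1.1| : ℝ) : ℂ)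
          + (potentialShift T (fun a s => X s a) S O P.1.1 P.1.2 : ℂ)
          + Complex.I * ((-(deriv Z P.1.1 / deriv T P.1.1)
            - n / 4 * (deriv (deriv T) P.1.1 / deriv T P.1.1 ^ 2) : ℝ) : ℂ))) := by
  have ht := mem_timesOf hP
  have hT0 := h.T_ne _ ht
  obtain ⟨ht1, ht2⟩ := h.fderiv_time hU hC hP
  have hne : hat (deriv T P.1.1) P.2 ≠ 0 := by
    rw [Ne, hat_eq_zero]; exact hU.ne_zero P hP
  rw [ht1]
  set r := deriv T P.1.1 with hr
  set κ := |r| with hκ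
  have hκ0 : κ ≠ 0 := abs_ne_zero.2 hT0
  have hrc : (r : ℂ) ≠ 0 := by exact_mod_cast hT0
  have hκc : (κ : ℂ) ≠ 0 := by exact_mod_cast hκ0
  -- Expressed through `ζ`, the phase gradient makes the first-order terms `m (0, ζ)` coming from
  -- the time derivative and from the Laplacian cancel.
  have hω : ∀ ξ, phaseForm T X O P.1.1 P.1.2 ξ = (2 * r)⁻¹ * (κ * inner ℝ ξ ζ) := by
    intro ξ
    unfold phaseForm
    rw [← hζ, h.conf]
  have hvel : inner ℝ (timeVelocity T X O P.1.1 P.1.2) (timeVelocity T X O P.1.1 P.1.2)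
      = κ * inner ℝ ζ ζ := by
    rw [← hζ, h.conf]
  have hfib : ∀ z, (fderiv ℝ φ P (0, z)).2 = hat r z / hat r P.2 * (φ P).2 := by
    intro z
    have h1 := h.fderiv_slice_snd hU hC hP 0 z
    rw [hω, inner_zero_left] at h1
    simp only [mul_zero, Complex.ofReal_zero, zero_add] at h1
    exact h1
  have e1 : (fderiv ℝ φ P ((1, 0), m (1, 0))).2
      = (fderiv ℝ φ P ((1, 0), 0)).2 + hat r (m (1, 0)) / hat r P.2 * (φ P).2 := by
    have : (((1, 0), m (1, 0)) : Var n) = ((1, 0), 0) + (0, m (1, 0)) := by simp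
    rw [this, map_add, Prod.snd_add, hfib]
  have hhatsum : ∀ g : Fin n → ℂ, ∑ i, hat r (g i) = hat r (∑ i, g i) := by
    intro g
    unfold hat
    split_ifs
    · rfl
    · rw [map_sum]
  have e2 : ∑ i, inner ℝ (stdB n i) ζ * hat r (m (0, stdB n i)) = hat r (m (0, ζ)) := by
    have h2 : ((0, ζ) : Base n) = ∑ i, inner ℝ (stdB n i) ζ • ((0, stdB n i) : Base n) := by
      refine Prod.ext (by simp [Prod.fst_sum]) ?_
      simp only [Prod.snd_sum, Prod.smul_snd]
      exact ((stdB n).sum_repr' ζ).symm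
    rw [h2, map_sum, ← hhatsum]
    refine Finset.sum_congr rfl fun i _ => ?_
    rw [map_smul, Complex.real_smul, hat_mul, hat_ofReal]
  have e3 : ∑ i, (inner ℝ (stdB n i) ζ : ℝ) ^ 2 = inner ℝ ζ ζ := by
    rw [← sum_inner_stdB ζ ζ]
    refine Finset.sum_congr rfl fun i _ => ?_
    rw [real_inner_comm, pow_two]
  have e3c : ∑ i, (((inner ℝ (stdB n i) ζ : ℝ) ^ 2 : ℝ) : ℂ) = ((inner ℝ ζ ζ : ℝ) : ℂ) := by
    rw [← Complex.ofReal_sum, e3]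
  have e4 : ∑ i, ((fderiv ℝ (fderiv ℝ φ) P ((0, stdB n i), m (0, stdB n i))
              ((0, stdB n i), m (0, stdB n i))).2
            + (fderiv ℝ φ P (0, B (0, stdB n i) (0, stdB n i))).2)
      = (Complex.I * (n * (κ * deriv (deriv T) P.1.1 / (4 * r ^ 2)))
        - (κ / (2 * r)) ^ 2 * (inner ℝ ζ ζ : ℝ)
        + Complex.I * (κ / r) * (hat r (m (0, ζ)) / hat r P.2)
        + hat r (∑ i, B (0, stdB n i) (0, stdB n i)) / hat r P.2) * (φ P).2 := by
    have h3 : ∀ i, (fderiv ℝ (fderiv ℝ φ) P ((0, stdB n i), m (0, stdB n i))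
              ((0, stdB n i), m (0, stdB n i))).2
            + (fderiv ℝ φ P (0, B (0, stdB n i) (0, stdB n i))).2
        = (Complex.I * (κ * deriv (deriv T) P.1.1 / (4 * r ^ 2))
          - (κ / (2 * r)) ^ 2 * (((inner ℝ (stdB n i) ζ : ℝ) ^ 2 : ℝ) : ℂ)
          + Complex.I * (κ / r) * (inner ℝ (stdB n i) ζ * hat r (m (0, stdB n i)) / hat r P.2)
          + hat r (B (0, stdB n i) (0, stdB n i)) / hat r P.2) * (φ P).2 := by
      intro i
      have h4 : inner ℝ (stdB n i) (stdB n i) = (1 : ℝ) := by simp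
      rw [h.fderiv_fderiv_snd hU hC hP, hfib, hω, h4, ← hr, ← hκ]
      push_cast
      field_simp
    rw [Finset.sum_congr rfl fun i _ => h3 i, ← Finset.sum_mul]
    simp only [Finset.sum_add_distrib, Finset.sum_sub_distrib, ← Finset.mul_sum, ← Finset.sum_div]
    rw [e2, e3c, hhatsum, Finset.sum_const, Finset.card_univ, Fintype.card_fin, nsmul_eq_mul]
    ring
  have e5 : hat r (Complex.I * m (1, 0)) = κ / r * Complex.I * hat r (m (1, 0)) := by
    rw [hat_mul, hat_I hT0]
    congr 2
    have h3 : Real.sign r = κ / r := by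
      rw [hκ]
      rcases hT0.lt_or_gt with h | h
      · rw [Real.sign_of_neg h, abs_of_neg h]; field_simp
      · rw [Real.sign_of_pos h, abs_of_pos h]; field_simp
    rw [h3]; push_cast; rfl
  have h7 := h.fderiv_slice_snd hU hC hP ζ (m (0, ζ))
  rw [← hr] at h7
  rw [e1, e4, h7, ht2, hω ζ, hvel, hat_add, hat_add, e5]
  simp only [potTerm, hat_add, hat_mul, hat_ofReal]
  have hκκ : (κ : ℂ) ^ 2 = (r : ℂ) ^ 2 := by
    rw [← Complex.ofReal_pow, hκ, sq_abs, Complex.ofReal_pow]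
  push_cast
  field_simp
  ring_nf
  simp only [Complex.I_sq]
  ring

end ExplicitForm

/-! ### The transformation law of the arbitrary elements -/

section TransformationLaw

variable {U : Set (Var n)} {φ : Var n → Var n} {T : ℝ → ℝ} {X : ℝ → Space n} {S Z : ℝ → ℝ}
  {O : Matrix (Fin n) (Fin n) ℝ} {lam : ℝ} {θ θ' : ArbElem n}

theorem HasVarForm.fiber_ne_zero (h : HasVarForm U φ T X S Z O) (hU : IsVarDomain U)
    {P : Var n} (hP : P ∈ U) : (φ P).2 ≠ 0 := by
  rw [h.fiber P hP]
  refine mul_ne_zero (Complex.exp_ne_zero _) ?_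
  rw [Ne, hat_eq_zero]
  exact hU.ne_zero P hP

theorem HasVarForm.exists_velocity (h : HasVarForm U φ T X S Z O) {P : Var n} (hP : P ∈ U) :
    ∃ ζ : Space n, √|deriv T P.1.1| • matMap O ζ = timeVelocity T X O P.1.1 P.1.2 := by
  have h1 : Function.Surjective (√|deriv T P.1.1| • matMap O) :=
    surjective_of_inner (abs_ne_zero.2 (h.T_ne _ (mem_timesOf hP))) fun ξ η => h.conf ξ η
  exact h1 _

/-- A transformation of the explicit form maps one equation to another if and only if the
arbitrary elements are related by its transformation law. -/
theorem HasVarForm.mapsEquation_iff (h : HasVarForm U φ T X S Z O) (hU : IsVarDomain U)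
    (hC : ContDiffOn ℝ ∞ φ U) :
    MapsEquation lam U φ θ θ' ↔ ∀ P ∈ U, PotentialRelation lam φ T X S Z O θ θ' P := by
  have hζ' : ∀ {P : Var n}, P ∈ U → ∀ {ζ : Space n},
      √|deriv T P.1.1| • matMap O ζ = timeVelocity T X O P.1.1 P.1.2 →
      spaceMap (fderiv ℝ φ P) ζ = (fderiv ℝ φ P ((1, 0), 0)).1.2 := by
    intro P hP ζ hζ
    rw [(h.fderiv_time hU hC hP).1, spaceMap_apply, h.fderiv_slice_fst hU.isOpen hC hP]
    exact hζ
  refine ⟨fun hM P hP => ?_, fun hR p u u' hp hu hu' hev => ?_⟩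
  · obtain ⟨ζ, hζ⟩ := h.exists_velocity hP
    -- The jet with zero second derivative and `ψ_t` solved from the source equation; for it the
    -- image equation reduces to `Ψ` times the defect.
    let m : Base n →L[ℝ] ℂ :=
      (ContinuousLinearMap.fst ℝ ℝ (Space n)).smulRight (Complex.I * potTerm lam θ P)
    have h0 : Complex.I * m (1, 0)
        + ∑ a, (0 : Base n →L[ℝ] Base n →L[ℝ] ℂ) (0, stdB n a) (0, stdB n a)
        + potTerm lam θ P = 0 := by
      simp only [m, ContinuousLinearMap.smulRight_apply, ContinuousLinearMap.coe_fst', one_smul,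
        zero_apply, Finset.sum_const_zero]
      linear_combination potTerm lam θ P * Complex.I_sq
    have h1 := (reduced_condition hU.isOpen hC hM hP (h.sliceStructure hU hC hP) (hζ' hP hζ) m 0
      fun v w => rfl).1 h0
    have hhat : ∀ r, hat r 0 = 0 := fun r => hat_eq_zero.2 rfl
    rw [h.image_equation (θ := θ) hU hC hP hζ, h0, hhat, mul_zero, zero_add, mul_eq_zero,
      or_iff_right (h.fiber_ne_zero hU hP), sub_eq_zero] at h1
    exact h1
  · obtain ⟨ζ, hζ⟩ := h.exists_velocity hp
    have hS := h.sliceStructure hU hC hp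
    obtain ⟨b, hb⟩ := exists_orthonormalBasis (abs_pos.2 hS.time_ne) hS.conf
    have hφ2 := contDiffAt_two hU.isOpen hC hp
    have h1 := prolong_fst hφ2 hu hu' hev
    have h2 := prolong_snd hφ2 hu hu' hev
    have hval : u' (φ (p, u p)).1 = (φ (p, u p)).2 := hev.self_of_nhds
    rw [satisfiesAt_iff hu (stdB n), satisfiesAt_iff hu' b, hval,
      hS.pulledBack h1 h2 (hζ' hp hζ) hb]
    have h3 := h.image_equation (θ := θ) (θ' := θ') (lam := lam) hU hC hp hζ (fderiv ℝ u p)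
      (fderiv ℝ (fderiv ℝ u) p)
    have h4 := hR _ hp
    unfold PotentialRelation at h4
    rw [h4, sub_self, mul_zero, add_zero] at h3
    unfold potTerm at h3
    rw [h3, mul_eq_zero, hat_eq_zero, or_iff_right]
    have hT := h.T_ne _ (mem_timesOf hp)
    refine div_ne_zero (h.fiber_ne_zero hU hp) (mul_ne_zero ?_ ?_)
    · rw [Ne, hat_eq_zero]; exact hU.ne_zero _ hp
    · exact_mod_cast abs_ne_zero.2 hT

theorem norm_exp_psiExponent (T : ℝ → ℝ) (X : Fin n → ℝ → ℝ) (S Z : ℝ → ℝ)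
    (O : Matrix (Fin n) (Fin n) ℝ) (t : ℝ) (x : Space n) :
    ‖Complex.exp (psiExponent T X S Z O t x)‖ = Real.exp (Z t) := by
  rw [Complex.norm_exp]
  congr 1
  unfold psiExponent
  simp only [Complex.add_re, Complex.mul_re, Complex.I_re, Complex.I_im, Complex.ofReal_re,
    Complex.ofReal_im]
  ring

theorem HasVarForm.norm_fiber_rpow (h : HasVarForm U φ T X S Z O) {P : Var n} (hP : P ∈ U) :
    ‖(φ P).2‖ ^ lam = Real.exp (Z P.1.1) ^ lam * ‖P.2‖ ^ lam := by
  rw [h.fiber P hP, norm_mul, norm_exp_psiExponent, norm_hat,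
    Real.mul_rpow (Real.exp_nonneg _) (norm_nonneg _)]

/-- Compare the relation at `ψ` and at `(1 + s) ψ` over the same `(t, x)`. Only `‖ψ‖ ^ lam` changes,
and it does change because `lam ≠ 0`, so its coefficients on the two sides agree. -/
theorem HasVarForm.hat_coefficient (h : HasVarForm U φ T X S Z O) (hlam : lam ≠ 0)
    (hU : IsVarDomain U) (hR : ∀ P ∈ U, PotentialRelation lam φ T X S Z O θ θ' P)
    {P : Var n} (hP : P ∈ U) :
    θ'.δ * ((Real.exp (Z P.1.1) ^ lam * |deriv T P.1.1| : ℝ) : ℂ) = hat (deriv T P.1.1) θ.δ := by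
  have hP0 : 0 < ‖P.2‖ := norm_pos_iff.2 (hU.ne_zero P hP)
  obtain ⟨s, hs, hsU⟩ : ∃ s : ℝ, 0 < s ∧ ((P.1, P.2 + s • P.2) : Var n) ∈ U := by
    have h1 := eventually_mem_slice hU.isOpen hP 0 P.2
    simp only [smul_zero, add_zero] at h1
    have h2 := (h1.filter_mono nhdsWithin_le_nhds).and (self_mem_nhdsWithin (s := Set.Ioi (0 : ℝ)))
    obtain ⟨s, hs, hs0⟩ := h2.exists
    exact ⟨s, hs0, hs⟩
  have hT := h.T_ne _ (mem_timesOf hP)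
  have hTc : ((|deriv T P.1.1| : ℝ) : ℂ) ≠ 0 := by exact_mod_cast abs_ne_zero.2 hT
  have e1 := hR P hP
  have e2 := hR _ hsU
  have e3 : (φ (P.1, P.2 + s • P.2)).1 = (φ P).1 := by
    refine Prod.ext ?_ ?_
    · rw [h.time _ hsU, h.time _ hP]
    · rw [h.space _ hsU, h.space _ hP]
  unfold PotentialRelation at e1 e2
  rw [h.norm_fiber_rpow hP] at e1
  rw [h.norm_fiber_rpow hsU, e3] at e2
  simp only at e2
  have e4 : ‖P.2 + s • P.2‖ = (1 + s) * ‖P.2‖ := by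
    have : P.2 + s • P.2 = (1 + s) • P.2 := by rw [add_smul, one_smul]
    rw [this, norm_smul, Real.norm_of_nonneg (by linarith)]
  rw [e4, Real.mul_rpow (by linarith) hP0.le] at e2
  have hne : ((1 + s) ^ lam - 1) * ‖P.2‖ ^ lam ≠ 0 := by
    refine mul_ne_zero (fun h0 => ?_) (Real.rpow_pos_of_pos hP0 _).ne'
    have h1 : (1 + s) ^ lam = 1 := by linarith
    have h2 := congrArg Real.log h1
    rw [Real.log_rpow (by linarith), Real.log_one, mul_eq_zero, or_iff_right hlam] at h2
    exact (Real.log_pos (by linarith)).ne' h2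
  have hnec : (((1 + s) ^ lam : ℝ) - 1 : ℂ) * ((‖P.2‖ ^ lam : ℝ) : ℂ) ≠ 0 := by exact_mod_cast hne
  refine mul_left_cancel₀ hnec ?_
  push_cast at e1 e2 ⊢
  field_simp at e1 e2
  linear_combination (e2 - e1) / 4

theorem HasVarForm.potential_eq (h : HasVarForm U φ T X S Z O) (hlam : lam ≠ 0)
    (hU : IsVarDomain U) (hR : ∀ P ∈ U, PotentialRelation lam φ T X S Z O θ θ' P)
    {P : Var n} (hP : P ∈ U) :
    θ'.V (φ P).1 = hat (deriv T P.1.1) (θ.V P.1) / ((|deriv T P.1.1| : ℝ) : ℂ)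
      + (potentialShift T (fun a s => X s a) S O P.1.1 P.1.2 : ℂ)
      + Complex.I * ((-(deriv Z P.1.1 / deriv T P.1.1)
        - n / 4 * (deriv (deriv T) P.1.1 / deriv T P.1.1 ^ 2) : ℝ) : ℂ) := by
  have hT := h.T_ne _ (mem_timesOf hP)
  have hTc : ((|deriv T P.1.1| : ℝ) : ℂ) ≠ 0 := by exact_mod_cast abs_ne_zero.2 hT
  have e1 := hR P hP
  have e2 := h.hat_coefficient hlam hU hR hP
  unfold PotentialRelation at e1
  rw [h.norm_fiber_rpow hP, ← e2] at e1
  rw [add_div, mul_div_assoc] at e1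
  have e3 : θ'.δ * ((Real.exp (Z P.1.1) ^ lam * |deriv T P.1.1| : ℝ) : ℂ)
      * (((‖P.2‖ ^ lam : ℝ) : ℂ) / ((|deriv T P.1.1| : ℝ) : ℂ))
      = θ'.δ * ((Real.exp (Z P.1.1) ^ lam * ‖P.2‖ ^ lam : ℝ) : ℂ) := by
    push_cast
    field_simp
  rw [e3] at e1
  linear_combination e1

/-- Here the constancy of both `δ` and its image enters: taking moduli in `hat_coefficient` shows
that `e^{λZ} |T_t|` is the constant `‖θ.δ‖ / ‖θ'.δ‖`, whose root of order `lam` is `μ`. -/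
theorem HasVarForm.exists_scale (h : HasVarForm U φ T X S Z O) (hlam : lam ≠ 0)
    (hU : IsVarDomain U) (hδ' : θ'.δ ≠ 0) (hδ : θ.δ ≠ 0)
    (hR : ∀ P ∈ U, PotentialRelation lam φ T X S Z O θ θ' P) :
    ∃ μ : ℝ, 0 < μ ∧ ∀ t ∈ timesOf U, Real.exp (Z t) = μ * |deriv T t| ^ (-1 / lam) := by
  have hd : 0 < ‖θ.δ‖ / ‖θ'.δ‖ := div_pos (norm_pos_iff.2 hδ) (norm_pos_iff.2 hδ')
  refine ⟨(‖θ.δ‖ / ‖θ'.δ‖) ^ (1 / lam), Real.rpow_pos_of_pos hd _, ?_⟩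
  rintro _ ⟨P, hP, rfl⟩
  have hT := abs_pos.2 (h.T_ne _ (mem_timesOf hP))
  have h1 := congrArg norm (h.hat_coefficient hlam hU hR hP)
  have h2 : 0 < Real.exp (Z P.1.1) ^ lam := Real.rpow_pos_of_pos (Real.exp_pos _) _
  rw [norm_mul, norm_hat, Complex.norm_real, Real.norm_of_nonneg (mul_pos h2 hT).le] at h1
  have h3 : ‖θ.δ‖ / ‖θ'.δ‖ = Real.exp (Z P.1.1) ^ lam * |deriv T P.1.1| := by
    rw [← h1, mul_div_cancel_left₀ _ (norm_ne_zero_iff.2 hδ')]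
  simp only
  rw [h3, Real.mul_rpow h2.le hT.le, ← Real.rpow_mul (Real.exp_nonneg _), mul_one_div_cancel hlam,
    Real.rpow_one, mul_assoc, ← Real.rpow_add hT]
  have : 1 / lam + -1 / lam = 0 := by ring
  rw [this, Real.rpow_zero, mul_one]

theorem rpow_scale {lam μ r z : ℝ} (hlam : lam ≠ 0) (hμ : 0 < μ) (hr : r ≠ 0)
    (h : Real.exp z = μ * |r| ^ (-1 / lam)) : Real.exp z ^ lam * |r| = μ ^ lam := by
  have hr' := abs_pos.2 hr
  rw [h, Real.mul_rpow hμ.le (Real.rpow_nonneg hr'.le _), ← Real.rpow_mul hr'.le,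
    div_mul_cancel₀ _ hlam, Real.rpow_neg_one, mul_assoc, inv_mul_cancel₀ hr'.ne', mul_one]

/-- Turns the term `-Z_t / T_t` of the potential relation into `(1/λ) T_tt / T_t²`, which combines
with the `n/4` term to the coefficient `λ'`. -/
theorem HasVarForm.deriv_log_scale (h : HasVarForm U φ T X S Z O) {μ : ℝ} (hμ : 0 < μ)
    (hU : IsVarDomain U)
    (hZ : ∀ t ∈ timesOf U, Real.exp (Z t) = μ * |deriv T t| ^ (-1 / lam)) {t : ℝ}
    (ht : t ∈ timesOf U) : deriv Z t = -1 / lam * (deriv (deriv T) t / deriv T t) := by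
  have hIo := isOpen_timesOf hU.isOpen
  have hT2 := hasDerivAt_of_contDiffOn hIo (contDiffOn_infty_deriv hIo h.T_smooth) ht
  have h1 := ((hT2.log (h.T_ne t ht)).const_mul (-1 / lam)).const_add (Real.log μ)
  refine (h1.congr_of_eventuallyEq ?_).deriv
  filter_upwards [hIo.mem_nhds ht] with s hs
  have h2 := abs_pos.2 (h.T_ne s hs)
  rw [← Real.log_exp (Z s), hZ s hs, Real.log_mul hμ.ne' (Real.rpow_pos_of_pos h2 _).ne',
    Real.log_rpow h2, Real.log_abs]

/-- The transformation law of the arbitrary elements. -/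
theorem HasVarForm.mapsEquation_iff_of_scale (h : HasVarForm U φ T X S Z O) (hlam : lam ≠ 0)
    (hU : IsVarDomain U) (hC : ContDiffOn ℝ ∞ φ U) {μ : ℝ} (hμ : 0 < μ)
    (hZ : ∀ t ∈ timesOf U, Real.exp (Z t) = μ * |deriv T t| ^ (-1 / lam)) :
    MapsEquation lam U φ θ θ' ↔ ∀ P ∈ U,
      θ'.δ = hat (deriv T P.1.1) θ.δ / ((μ ^ lam : ℝ) : ℂ) ∧
      θ'.V (φ P).1 = hat (deriv T P.1.1) (θ.V P.1) / ((|deriv T P.1.1| : ℝ) : ℂ)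
        + (potentialShift T (fun a s => X s a) S O P.1.1 P.1.2 : ℂ)
        + Complex.I * (((1 / lam - n / 4)
          * (deriv (deriv T) P.1.1 / deriv T P.1.1 ^ 2) : ℝ) : ℂ) := by
  have hμc : ((μ ^ lam : ℝ) : ℂ) ≠ 0 := by exact_mod_cast (Real.rpow_pos_of_pos hμ _).ne'
  have key : ∀ P ∈ U, (-(deriv Z P.1.1 / deriv T P.1.1)
        - n / 4 * (deriv (deriv T) P.1.1 / deriv T P.1.1 ^ 2) : ℝ)
      = (1 / lam - n / 4) * (deriv (deriv T) P.1.1 / deriv T P.1.1 ^ 2) := by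
    intro P hP
    rw [h.deriv_log_scale hμ hU hZ (mem_timesOf hP)]
    have hT := h.T_ne _ (mem_timesOf hP)
    field_simp
  rw [h.mapsEquation_iff hU hC]
  constructor
  · intro hR P hP
    have ht := mem_timesOf hP
    refine ⟨?_, ?_⟩
    · rw [← h.hat_coefficient hlam hU hR hP, rpow_scale hlam hμ (h.T_ne _ ht) (hZ _ ht),
        mul_div_cancel_right₀ _ hμc]
    · rw [h.potential_eq hlam hU hR hP, key P hP]
  · intro hR P hP
    have ht := mem_timesOf hP
    have hT := h.T_ne _ ht
    have hTc : ((|deriv T P.1.1| : ℝ) : ℂ) ≠ 0 := by exact_mod_cast abs_ne_zero.2 hT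
    obtain ⟨h1, h2⟩ := hR P hP
    unfold PotentialRelation
    rw [h2, key P hP, h1, h.norm_fiber_rpow hP, ← rpow_scale hlam hμ hT (hZ _ ht)]
    have h3 : ((Real.exp (Z P.1.1) ^ lam : ℝ) : ℂ) ≠ 0 := by
      exact_mod_cast (Real.rpow_pos_of_pos (Real.exp_pos _) _).ne'
    push_cast
    field_simp
    ring

end TransformationLaw

/-! ### Smoothness, invertibility and the transformed equation -/

section EquivalenceGroup

section Smoothness

variable {W : Type*} [NormedAddCommGroup W] [NormedSpace ℝ W] {D : Set W} {τ : W → ℝ}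
  {χ : W → Space n} {I : Set ℝ} {T : ℝ → ℝ} {X : Fin n → ℝ → ℝ} {S Z : ℝ → ℝ}
  {O : Matrix (Fin n) (Fin n) ℝ}

theorem contDiffOn_hat (hI : IsOpen I) (hI' : IsPreconnected I) (hT : ContDiffOn ℝ ∞ T I)
    (hT0 : ∀ t ∈ I, deriv T t ≠ 0) (hD : Set.MapsTo τ D I) {f : W → ℂ}
    (hf : ContDiffOn ℝ ∞ f D) : ContDiffOn ℝ ∞ (fun w => hat (deriv T (τ w)) (f w)) D := by
  rcases pos_or_neg_of_ne_zero hI' (contDiffOn_infty_deriv hI hT).continuousOn hT0 with h | h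
  · exact hf.congr fun w hw => by simp [hat, h _ (hD hw)]
  · exact (Complex.conjCLE.contDiff.comp_contDiffOn hf).congr fun w hw => by
      simp [hat, (h _ (hD hw)).not_gt]

theorem contDiffOn_psiExponent (hI : IsOpen I) (hI' : IsPreconnected I) (hT : ContDiffOn ℝ ∞ T I)
    (hX : ∀ a, ContDiffOn ℝ ∞ (X a) I) (hS : ContDiffOn ℝ ∞ S I) (hZ : ContDiffOn ℝ ∞ Z I)
    (hT0 : ∀ t ∈ I, deriv T t ≠ 0) (hD : Set.MapsTo τ D I) (hτ : ContDiffOn ℝ ∞ τ D)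
    (hχ : ContDiffOn ℝ ∞ χ D) :
    ContDiffOn ℝ ∞ (fun w => psiExponent T X S Z O (τ w) (χ w)) D := by
  have hT1 := contDiffOn_infty_deriv hI hT
  have hT2 := (contDiffOn_infty_deriv hI hT1).comp hτ hD
  have hX1 := fun a => (contDiffOn_infty_deriv hI (hX a)).comp hτ hD
  obtain ⟨σ, -, hσ⟩ := exists_sign hI' hT1.continuousOn hT0
  have hA := (hT1.abs hT0).comp hτ hD
  have hQ := ((hT1.abs hT0).sqrt fun t ht => abs_ne_zero.2 (hT0 t ht)).comp hτ hD
  have hχa := contDiffOn_euclidean.1 hχ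
  have hsign : ∀ w ∈ D, Real.sign (deriv T (τ w)) = σ := fun w hw => (hσ _ (hD hw)).2.1
  have hsum1 : ContDiffOn ℝ ∞ (fun w => ∑ a, χ w a * χ w a) D :=
    ContDiffOn.sum fun a _ => (hχa a).mul (hχa a)
  have hsum2 : ContDiffOn ℝ ∞ (fun w => ∑ b, ∑ a,
      σ * deriv (X b) (τ w) / √|deriv T (τ w)| * O b a * χ w a) D :=
    ContDiffOn.sum fun b _ => ContDiffOn.sum fun a _ =>
      ((((contDiffOn_const.mul (hX1 b)).div hQ fun w hw =>
        (Real.sqrt_pos.2 (abs_pos.2 (hT0 _ (hD hw)))).ne').mul contDiffOn_const).mul (hχa a))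
  have h1 := (((contDiffOn_const (c := (1 / 8 : ℝ))).mul
    (hT2.div hA fun w hw => abs_ne_zero.2 (hT0 _ (hD hw)))).mul hsum1).add
    ((contDiffOn_const (c := (1 / 2 : ℝ))).mul hsum2) |>.add (hS.comp hτ hD)
  have h2 := ((contDiffOn_const (c := Complex.I)).mul
    (Complex.ofRealCLM.contDiff.comp_contDiffOn h1)).add
    (Complex.ofRealCLM.contDiff.comp_contDiffOn (hZ.comp hτ hD))
  refine h2.congr fun w hw => ?_
  unfold psiExponent
  rw [hsign w hw]
  rfl

theorem contDiffOn_potentialShift (hI : IsOpen I) (hI' : IsPreconnected I)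
    (hT : ContDiffOn ℝ ∞ T I) (hX : ∀ a, ContDiffOn ℝ ∞ (X a) I) (hS : ContDiffOn ℝ ∞ S I)
    (hT0 : ∀ t ∈ I, deriv T t ≠ 0) (hD : Set.MapsTo τ D I) (hτ : ContDiffOn ℝ ∞ τ D)
    (hχ : ContDiffOn ℝ ∞ χ D) :
    ContDiffOn ℝ ∞ (fun w => potentialShift T X S O (τ w) (χ w)) D := by
  have hT1 := contDiffOn_infty_deriv hI hT
  have hT1' := hT1.comp hτ hD
  have hT2 := (contDiffOn_infty_deriv hI hT1).comp hτ hD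
  have hT3 := (contDiffOn_infty_deriv hI (contDiffOn_infty_deriv hI hT1)).comp hτ hD
  have hX1 := fun a => (contDiffOn_infty_deriv hI (hX a)).comp hτ hD
  have hX2 := fun a => (contDiffOn_infty_deriv hI
    ((contDiffOn_infty_deriv hI (hX a)).div hT1 hT0)).comp hτ hD
  obtain ⟨σ, hσ1, hσ⟩ := exists_sign hI' hT1.continuousOn hT0
  have hσ0 : σ ≠ 0 := fun h => by simp [h] at hσ1
  have hQ := ((hT1.abs hT0).sqrt fun t ht => abs_ne_zero.2 (hT0 t ht)).comp hτ hD
  have hχa := contDiffOn_euclidean.1 hχ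
  have hsign : ∀ w ∈ D, Real.sign (deriv T (τ w)) = σ := fun w hw => (hσ _ (hD hw)).2.1
  have hne : ∀ w ∈ D, deriv T (τ w) ≠ 0 := fun w hw => hT0 _ (hD hw)
  have hsum1 : ContDiffOn ℝ ∞ (fun w => ∑ a, χ w a * χ w a) D :=
    ContDiffOn.sum fun a _ => (hχa a).mul (hχa a)
  have hsum2 : ContDiffOn ℝ ∞ (fun w => ∑ b, ∑ a,
      deriv (fun s => deriv (X b) s / deriv T s) (τ w) * (O b a * χ w a) / √|deriv T (τ w)|) D :=
    ContDiffOn.sum fun b _ => ContDiffOn.sum fun a _ =>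
      ((hX2 b).mul (contDiffOn_const.mul (hχa a))).div hQ fun w hw =>
        (Real.sqrt_pos.2 (abs_pos.2 (hne w hw))).ne'
  have hsum3 : ContDiffOn ℝ ∞ (fun w => ∑ a, deriv (X a) (τ w) * deriv (X a) (τ w)) D :=
    ContDiffOn.sum fun a _ => (hX1 a).mul (hX1 a)
  have h1 := ((((contDiffOn_const (c := (2 : ℝ))).mul hT3).mul hT1').sub
    ((contDiffOn_const (c := (3 : ℝ))).mul (hT2.pow 2))).div
    ((contDiffOn_const (c := 16 * σ)).mul (hT1'.pow 3))
    (fun w hw => mul_ne_zero (mul_ne_zero (by norm_num) hσ0) (pow_ne_zero 3 (hne w hw)))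
  have h2 := (((h1.mul hsum1).add ((contDiffOn_const (c := σ / 2)).mul hsum2)).add
    (((contDiffOn_infty_deriv hI hS).comp hτ hD).div hT1' hne)).sub
    (hsum3.div ((contDiffOn_const (c := (4 : ℝ))).mul (hT1'.pow 2))
      (fun w hw => mul_ne_zero (by norm_num) (pow_ne_zero 2 (hne w hw))))
  refine h2.congr fun w hw => ?_
  unfold potentialShift
  rw [hsign w hw]
  rfl

/-- By injectivity the global inverse agrees near each image point with the smooth local inverse. -/
theorem contDiffOn_invFunOn [CompleteSpace W] {b : W → W} (hD : IsOpen D)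
    (hb : ContDiffOn ℝ ∞ b D) (hinj : Set.InjOn b D)
    (hb' : ∀ q ∈ D, ∃ e : W ≃L[ℝ] W, fderiv ℝ b q = e) :
    ContDiffOn ℝ ∞ (Function.invFunOn b D) (b '' D) := by
  rintro _ ⟨q, hq, rfl⟩
  obtain ⟨e, he⟩ := hb' q hq
  have h1 : ContDiffAt ℝ ∞ b q := (hb q hq).contDiffAt (hD.mem_nhds hq)
  have h2 : HasFDerivAt b (e : W →L[ℝ] W) q := by
    rw [← he]
    exact (h1.differentiableAt (by simp)).hasFDerivAt
  have h3 := h1.to_localInverse h2 (by simp)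
  refine (h3.congr_of_eventuallyEq ?_).contDiffWithinAt
  refine (h1.hasStrictFDerivAt' h2 (by simp)).localInverse_unique ?_
  filter_upwards [hD.mem_nhds hq] with x hx
  exact hinj.leftInvOn_invFunOn hx

end Smoothness

theorem bijective_of_injective {E : Type*} [NormedAddCommGroup E] [NormedSpace ℝ E]
    [FiniteDimensional ℝ E] (A : E →L[ℝ] E) (hA : ∀ v, A v = 0 → v = 0) :
    Function.Bijective A := by
  have hinj : Function.Injective A := (injective_iff_map_eq_zero _).2 hA
  exact ⟨hinj, (LinearMap.injective_iff_surjective (f := A.toLinearMap)).1 hinj⟩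

variable {U : Set (Var n)} {φ : Var n → Var n} {T : ℝ → ℝ} {X : ℝ → Space n} {S Z : ℝ → ℝ}
  {O : Matrix (Fin n) (Fin n) ℝ} {lam : ℝ}

/-- The transformation of the independent variables. -/
def baseTransform (T : ℝ → ℝ) (X : ℝ → Space n) (O : Matrix (Fin n) (Fin n) ℝ) (q : Base n) :
    Base n :=
  (T q.1, √|deriv T q.1| • matMap O q.2 + X q.1)

theorem HasVarForm.fst_eq (h : HasVarForm U φ T X S Z O) {P : Var n} (hP : P ∈ U) :
    (φ P).1 = baseTransform T X O P.1 :=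
  Prod.ext (h.time P hP) (h.space P hP)

theorem HasVarForm.contDiffOn_baseTransform (h : HasVarForm U φ T X S Z O) (hU : IsVarDomain U)
    {W : Type*} [NormedAddCommGroup W] [NormedSpace ℝ W] {D : Set W} {f : W → Base n}
    (hf : ContDiffOn ℝ ∞ f D) (hD : ∀ w ∈ D, (f w).1 ∈ timesOf U) :
    ContDiffOn ℝ ∞ (fun w => baseTransform T X O (f w)) D := by
  have hIo := isOpen_timesOf hU.isOpen
  have hT1 := contDiffOn_infty_deriv hIo h.T_smooth
  have hτ : ContDiffOn ℝ ∞ (fun w => (f w).1) D := contDiff_fst.comp_contDiffOn hf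
  have hχ : ContDiffOn ℝ ∞ (fun w => (f w).2) D := contDiff_snd.comp_contDiffOn hf
  have hQ := ((hT1.abs h.T_ne).sqrt fun t ht => abs_ne_zero.2 (h.T_ne t ht)).comp hτ hD
  exact (h.T_smooth.comp hτ hD).prodMk
    ((hQ.smul ((matMap O).contDiff.comp_contDiffOn hχ)).add (h.X_smooth.comp hτ hD))

theorem HasVarForm.contDiffOn (h : HasVarForm U φ T X S Z O) (hU : IsVarDomain U) :
    ContDiffOn ℝ ∞ φ U := by
  have hIo := isOpen_timesOf hU.isOpen
  have hD : Set.MapsTo (fun P : Var n => P.1.1) U (timesOf U) := fun P hP => mem_timesOf hP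
  have h1 := h.contDiffOn_baseTransform hU (D := U) contDiff_fst.contDiffOn
    fun P hP => mem_timesOf hP
  have h2 := (contDiffOn_psiExponent (O := O) (χ := fun P : Var n => P.1.2) hIo hU.times_connected
    h.T_smooth (contDiffOn_euclidean.1 h.X_smooth) h.S_smooth h.Z_smooth h.T_ne hD
    (contDiff_fst.comp contDiff_fst).contDiffOn (contDiff_snd.comp contDiff_fst).contDiffOn).cexp
  have h3 := contDiffOn_hat hIo hU.times_connected h.T_smooth h.T_ne hD
    (f := fun P : Var n => P.2) contDiff_snd.contDiffOn
  exact (h1.prodMk (h2.mul h3)).congr fun P hP => Prod.ext (h.fst_eq hP) (h.fiber P hP)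

theorem HasVarForm.eq_zero_of_fderiv_fst (h : HasVarForm U φ T X S Z O) (hU : IsVarDomain U)
    {P : Var n} (hP : P ∈ U) {v : Base n} {z : ℂ} (hv : (fderiv ℝ φ P (v, z)).1 = 0) : v = 0 := by
  have hC := h.contDiffOn hU
  have hT := h.T_ne _ (mem_timesOf hP)
  obtain ⟨s, ξ⟩ := v
  have e1 : (((s, ξ), z) : Var n) = s • (((1, 0), 0) : Var n) + ((0, ξ), z) := by
    refine Prod.ext (Prod.ext ?_ ?_) ?_ <;> simp
  rw [e1, map_add, map_smul, Prod.fst_add, Prod.smul_fst, (h.fderiv_time hU hC hP).1,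
    h.fderiv_slice_fst hU.isOpen hC hP] at hv
  have h2 := congrArg Prod.fst hv
  simp only [Prod.fst_add, Prod.smul_fst, add_zero, Prod.fst_zero, smul_eq_mul, mul_eq_zero, hT,
    or_false] at h2
  subst h2
  have h3 := congrArg Prod.snd hv
  simp only [zero_smul, zero_add, Prod.snd_zero] at h3
  have h4 := h.conf (t := P.1.1) ξ ξ
  rw [h3, inner_zero_left, eq_comm, mul_eq_zero, or_iff_right (abs_ne_zero.2 hT),
    inner_self_eq_zero] at h4
  rw [h4]; rfl

theorem HasVarForm.eq_zero_of_fderiv (h : HasVarForm U φ T X S Z O) (hU : IsVarDomain U)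
    {P : Var n} (hP : P ∈ U) {w : Var n} (hw : fderiv ℝ φ P w = 0) : w = 0 := by
  obtain ⟨v, z⟩ := w
  obtain rfl : v = 0 := h.eq_zero_of_fderiv_fst hU hP (z := z) (by rw [hw]; rfl)
  have h1 := h.fderiv_slice_snd hU (h.contDiffOn hU) hP 0 z
  have h2 : fderiv ℝ φ P ((0, 0), z) = 0 := hw
  rw [h2] at h1
  have hne : hat (deriv T P.1.1) P.2 ≠ 0 := by
    rw [Ne, hat_eq_zero]; exact hU.ne_zero P hP
  have h3 : phaseForm T X O P.1.1 P.1.2 0 = 0 := by simp [phaseForm]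
  rw [h3, Complex.ofReal_zero, mul_zero, zero_add, eq_comm, Prod.snd_zero, mul_eq_zero,
    or_iff_left (h.fiber_ne_zero hU hP), div_eq_zero_iff, or_iff_left hne, hat_eq_zero] at h1
  rw [h1]; rfl

theorem HasVarForm.isPointTransformation (h : HasVarForm U φ T X S Z O) (hU : IsVarDomain U) :
    IsPointTransformation U φ :=
  ⟨h.contDiffOn hU, fun _ hP => bijective_of_injective _ fun _ => h.eq_zero_of_fderiv hU hP,
    fun _ => h.fiber_ne_zero hU⟩

theorem isOpen_baseOf (hU : IsOpen U) : IsOpen (baseOf U) := isOpenMap_fst U hU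

theorem mem_timesOf_of_mem_baseOf {q : Base n} (hq : q ∈ baseOf U) : q.1 ∈ timesOf U := by
  obtain ⟨P, hP, rfl⟩ := hq
  exact mem_timesOf hP

/-- The values of `t` form an interval, so `T` is strictly monotone. The resulting injectivity on
the base makes the transformed potential single-valued over the whole image. -/
theorem HasVarForm.injOn_time (h : HasVarForm U φ T X S Z O) (hU : IsVarDomain U) :
    Set.InjOn T (timesOf U) := by
  have hIo := isOpen_timesOf hU.isOpen
  have hcv : Convex ℝ (timesOf U) := hU.times_connected.ordConnected.convex
  rcases pos_or_neg_of_ne_zero hU.times_connected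
    (contDiffOn_infty_deriv hIo h.T_smooth).continuousOn h.T_ne with h1 | h1
  · refine (strictMonoOn_of_deriv_pos hcv h.T_smooth.continuousOn fun t ht => ?_).injOn
    exact h1 t (interior_subset ht)
  · refine (strictAntiOn_of_deriv_neg hcv h.T_smooth.continuousOn fun t ht => ?_).injOn
    exact h1 t (interior_subset ht)

theorem HasVarForm.injOn_baseTransform (h : HasVarForm U φ T X S Z O) (hU : IsVarDomain U) :
    Set.InjOn (baseTransform T X O) (baseOf U) := by
  rintro ⟨t, x⟩ hq ⟨t', x'⟩ hq' heq
  have ht := mem_timesOf_of_mem_baseOf hq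
  obtain rfl : t = t' := h.injOn_time hU ht (mem_timesOf_of_mem_baseOf hq')
    (congrArg Prod.fst heq)
  have h1 := congrArg Prod.snd heq
  simp only [baseTransform, add_left_inj] at h1
  have h2 := h.conf (t := t) (x - x') (x - x')
  rw [map_sub, smul_sub, h1, sub_self, inner_zero_left, eq_comm, mul_eq_zero,
    or_iff_right (abs_ne_zero.2 (h.T_ne t ht)), inner_self_eq_zero, sub_eq_zero] at h2
  rw [h2]

theorem HasVarForm.exists_fderiv_baseTransform (h : HasVarForm U φ T X S Z O)
    (hU : IsVarDomain U) {q : Base n} (hq : q ∈ baseOf U) :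
    ∃ e : Base n ≃L[ℝ] Base n, fderiv ℝ (baseTransform T X O) q = e := by
  obtain ⟨P, hP, rfl⟩ := hq
  have h1 : DifferentiableAt ℝ (baseTransform T X O) P.1 :=
    (((h.contDiffOn_baseTransform hU contDiffOn_id fun q hq => mem_timesOf_of_mem_baseOf hq) P.1
      ⟨P, hP, rfl⟩).contDiffAt ((isOpen_baseOf hU.isOpen).mem_nhds ⟨P, hP, rfl⟩)).differentiableAt
      (by simp)
  have h2 : HasFDerivAt (fun R : Var n => baseTransform T X O R.1)
      ((fderiv ℝ (baseTransform T X O) P.1).comp (ContinuousLinearMap.fst ℝ (Base n) ℂ)) P :=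
    h1.hasFDerivAt.comp P hasFDerivAt_fst
  have hd := ((contDiffAt_two hU.isOpen (h.contDiffOn hU) hP).differentiableAt
    (by norm_num)).hasFDerivAt
  have h3 := hd.fst.unique (h2.congr_of_eventuallyEq (by
    filter_upwards [hU.isOpen.mem_nhds hP] with R hR
    exact h.fst_eq hR))
  have h4 : Function.Injective (fderiv ℝ (baseTransform T X O) P.1) := by
    refine (injective_iff_map_eq_zero _).2 fun v hv => ?_
    refine h.eq_zero_of_fderiv_fst hU hP (z := 0) ?_
    have h5 := congrArg (fun A : Var n →L[ℝ] Base n => A (v, 0)) h3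
    exact h5.trans hv
  obtain ⟨e, he⟩ := exists_equiv_of_injective _ h4
  exact ⟨e, ContinuousLinearMap.ext he⟩

/-- The value of the transformed potential over the point `(t, x)`, where the original potential
has the value `v`. -/
def potentialValue (lam : ℝ) (T : ℝ → ℝ) (X : ℝ → Space n) (S : ℝ → ℝ)
    (O : Matrix (Fin n) (Fin n) ℝ) (q : Base n) (v : ℂ) : ℂ :=
  hat (deriv T q.1) v / ((|deriv T q.1| : ℝ) : ℂ)
    + (potentialShift T (fun a s => X s a) S O q.1 q.2 : ℂ)
    + Complex.I * (((1 / lam - n / 4) * (deriv (deriv T) q.1 / deriv T q.1 ^ 2) : ℝ) : ℂ)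

theorem HasVarForm.contDiffOn_potentialValue (h : HasVarForm U φ T X S Z O) (hU : IsVarDomain U)
    {W : Type*} [NormedAddCommGroup W] [NormedSpace ℝ W] {D : Set W} {f : W → Base n}
    (hf : ContDiffOn ℝ ∞ f D) (hD : Set.MapsTo (fun w => (f w).1) D (timesOf U)) {v : W → ℂ}
    (hv : ContDiffOn ℝ ∞ v D) :
    ContDiffOn ℝ ∞ (fun w => potentialValue lam T X S O (f w) (v w)) D := by
  have hIo := isOpen_timesOf hU.isOpen
  have hT1 := contDiffOn_infty_deriv hIo h.T_smooth
  have hτ : ContDiffOn ℝ ∞ (fun w => (f w).1) D := contDiff_fst.comp_contDiffOn hf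
  have hχ : ContDiffOn ℝ ∞ (fun w => (f w).2) D := contDiff_snd.comp_contDiffOn hf
  have h1 := (contDiffOn_hat hIo hU.times_connected h.T_smooth h.T_ne hD hv).mul
    ((Complex.ofRealCLM.contDiff.comp_contDiffOn ((hT1.abs h.T_ne).comp hτ hD)).inv fun w hw => by
      have := abs_ne_zero.2 (h.T_ne _ (hD hw))
      simpa using this)
  have h2 := Complex.ofRealCLM.contDiff.comp_contDiffOn (contDiffOn_potentialShift (O := O)
    hIo hU.times_connected h.T_smooth (contDiffOn_euclidean.1 h.X_smooth) h.S_smooth h.T_ne hD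
    hτ hχ)
  have h3 := (contDiffOn_const (c := Complex.I)).mul
    (Complex.ofRealCLM.contDiff.comp_contDiffOn ((contDiffOn_const (c := 1 / lam - n / 4)).mul
      (((contDiffOn_infty_deriv hIo hT1).comp hτ hD).div ((hT1.comp hτ hD).pow 2)
        fun w hw => pow_ne_zero 2 (h.T_ne _ (hD hw)))))
  refine ((h1.add h2).add h3).congr fun w _ => ?_
  unfold potentialValue
  rw [div_eq_mul_inv]
  rfl

/-- The equation of the class to which a transformation of the explicit form maps a given
equation. -/
theorem HasVarForm.exists_admissible (h : HasVarForm U φ T X S Z O) (hlam : lam ≠ 0)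
    (hU : IsVarDomain U) {μ : ℝ} (hμ : 0 < μ)
    (hZ : ∀ t ∈ timesOf U, Real.exp (Z t) = μ * |deriv T t| ^ (-1 / lam)) {θ : ArbElem n}
    (hθ : InClass (baseOf U) θ) :
    ∃ θ' : ArbElem n, IsAdmissible lam U θ φ θ' ∧ ∀ P ∈ U,
      θ'.δ = hat (deriv T P.1.1) θ.δ / ((μ ^ lam : ℝ) : ℂ) ∧
      θ'.V (φ P).1 = potentialValue lam T X S O P.1 (θ.V P.1) := by
  obtain ⟨σ, -, hσ⟩ := exists_sign hU.times_connected
    (contDiffOn_infty_deriv (isOpen_timesOf hU.isOpen) h.T_smooth).continuousOn h.T_ne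
  have hμc : ((μ ^ lam : ℝ) : ℂ) ≠ 0 := by exact_mod_cast (Real.rpow_pos_of_pos hμ _).ne'
  have hinj := h.injOn_baseTransform hU
  have hΩ := isOpen_baseOf hU.isOpen
  let g := Function.invFunOn (baseTransform T X O) (baseOf U)
  -- Using the constant sign `σ` makes the new coefficient a constant; the new potential is
  -- transported by the inverse `g` of the base transformation, its values off the image being
  -- immaterial.
  let θ' : ArbElem n :=
    ⟨hat σ θ.δ / ((μ ^ lam : ℝ) : ℂ), fun y => potentialValue lam T X S O (g y) (θ.V (g y))⟩
  have hrel : ∀ P ∈ U, θ'.δ = hat (deriv T P.1.1) θ.δ / ((μ ^ lam : ℝ) : ℂ) ∧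
      θ'.V (φ P).1 = potentialValue lam T X S O P.1 (θ.V P.1) := by
    intro P hP
    refine ⟨?_, ?_⟩
    · rw [hat_congr (hσ _ (mem_timesOf hP)).2.2]
    · have hg : g (φ P).1 = P.1 := by
        rw [h.fst_eq hP]
        exact hinj.leftInvOn_invFunOn ⟨P, hP, rfl⟩
      simp only [θ', hg]
  refine ⟨θ', ⟨hθ, ⟨?_, ?_⟩, h.isPointTransformation hU, ?_⟩, hrel⟩
  · refine div_ne_zero ?_ hμc
    rw [Ne, hat_eq_zero]
    exact hθ.1
  · have h1 : ContDiffOn ℝ ∞ g (baseTransform T X O '' baseOf U) :=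
      contDiffOn_invFunOn hΩ
        (h.contDiffOn_baseTransform hU contDiffOn_id fun q hq => mem_timesOf_of_mem_baseOf hq)
        hinj fun q hq => h.exists_fderiv_baseTransform hU hq
    have hmaps : Set.MapsTo g (baseTransform T X O '' baseOf U) (baseOf U) := by
      rintro _ ⟨q, hq, rfl⟩
      rw [show g (baseTransform T X O q) = q from hinj.leftInvOn_invFunOn hq]
      exact hq
    have h2 := h.contDiffOn_potentialValue (lam := lam) hU h1
      (fun y hy => mem_timesOf_of_mem_baseOf (hmaps hy)) (hθ.2.comp h1 hmaps)
    refine h2.mono ?_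
    rintro _ ⟨_, ⟨P, hP, rfl⟩, rfl⟩
    exact ⟨P.1, ⟨P, hP, rfl⟩, (h.fst_eq hP).symm⟩
  · exact (h.mapsEquation_iff_of_scale hlam hU (h.contDiffOn hU) hμ hZ).2 hrel

/-! ### Equivalence transformations and normalization -/

/-- A transformation of the extended space that has the explicit form. -/
structure HasExtForm (lam : ℝ) (U : Set (Var n)) (Φ : ExtVar n → ExtVar n) (φ : Var n → Var n)
    (T : ℝ → ℝ) (X : ℝ → Space n) (S Z : ℝ → ℝ) (O : Matrix (Fin n) (Fin n) ℝ) (μ : ℝ) :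
    Prop where
  varForm : HasVarForm U φ T X S Z O
  projects : ProjectsTo U Φ φ
  scale_pos : 0 < μ
  scale : ∀ t ∈ timesOf U, Real.exp (Z t) = μ * |deriv T t| ^ (-1 / lam)
  coefficient : ∀ P ∈ extDomain U,
    (Φ P).2.1 = hat (deriv T P.1.1.1) P.2.1 / ((μ ^ lam : ℝ) : ℂ)
  potential : ∀ P ∈ extDomain U, (Φ P).2.2 = potentialValue lam T X S O P.1.1 P.2.2

theorem hasEquivForm_iff {Φ : ExtVar n → ExtVar n} :
    HasEquivForm lam U Φ ↔ ∃ φ T X S Z O μ, HasExtForm lam U Φ φ T X S Z O μ := by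
  constructor
  · rintro ⟨T, X, S, Z, O, μ, hT, hX, hS, hZ, hT0, hO, hμ, hZμ, hΦ⟩
    -- The projection is read off at the sample values `δ = 1`, `V = 0`; the explicit form shows
    -- that it does not depend on them.
    have hmem : ∀ P ∈ U, ((P, 1, 0) : ExtVar n) ∈ extDomain U := fun P hP => ⟨hP, one_ne_zero⟩
    refine ⟨fun P => (Φ (P, 1, 0)).1, T, fun s => WithLp.toLp 2 fun a => X a s, S, Z, O, μ,
      ⟨hT, contDiffOn_euclidean.2 hX, hS, hZ, hT0, hO, ?_, ?_, ?_⟩, ?_, hμ, hZμ, ?_, ?_⟩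
    · exact fun P hP => (hΦ _ _ _ _ _ (hmem P hP)).1
    · intro P hP
      ext a
      exact (hΦ _ _ _ _ _ (hmem P hP)).2.1 a
    · exact fun P hP => (hΦ _ _ _ _ _ (hmem P hP)).2.2.1
    · intro P hP
      obtain ⟨h1, h2, h3, -⟩ := hΦ _ _ _ _ _ hP
      obtain ⟨k1, k2, k3, -⟩ := hΦ _ _ _ _ _ (hmem P.1 hP.1)
      refine Prod.ext (Prod.ext (h1.trans k1.symm) ?_) (h3.trans k3.symm)
      ext a
      exact (h2 a).trans (k2 a).symm
    · exact fun P hP => (hΦ _ _ _ _ _ hP).2.2.2.1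
    · exact fun P hP => (hΦ _ _ _ _ _ hP).2.2.2.2
  · rintro ⟨φ, T, X, S, Z, O, μ, h⟩
    refine ⟨T, fun a s => X s a, S, Z, O, μ, h.varForm.T_smooth,
      contDiffOn_euclidean.1 h.varForm.X_smooth, h.varForm.S_smooth, h.varForm.Z_smooth,
      h.varForm.T_ne, h.varForm.orth, h.scale_pos, h.scale, ?_⟩
    intro t x ψ δ V hP
    have hP1 := hP.1
    rw [h.projects _ hP]
    refine ⟨h.varForm.time _ hP1, fun a => ?_, h.varForm.fiber _ hP1, h.coefficient _ hP,
      h.potential _ hP⟩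
    rw [h.varForm.space _ hP1]
    rfl

theorem isOpen_extDomain (hU : IsOpen U) : IsOpen (extDomain U) :=
  (hU.preimage continuous_fst).inter
    (isOpen_ne.preimage (continuous_fst.comp continuous_snd))

variable {Φ : ExtVar n → ExtVar n} {μ : ℝ}

theorem HasExtForm.contDiffOn (h : HasExtForm lam U Φ φ T X S Z O μ) (hU : IsVarDomain U) :
    ContDiffOn ℝ ∞ Φ (extDomain U) := by
  have hIo := isOpen_timesOf hU.isOpen
  have hv := h.varForm
  have hD : Set.MapsTo (fun P : ExtVar n => P.1.1.1) (extDomain U) (timesOf U) :=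
    fun P hP => mem_timesOf hP.1
  have h1 : ContDiffOn ℝ ∞ (fun P : ExtVar n => φ P.1) (extDomain U) :=
    (hv.contDiffOn hU).comp contDiff_fst.contDiffOn fun P hP => hP.1
  have h2 := (contDiffOn_hat hIo hU.times_connected hv.T_smooth hv.T_ne hD
    (f := fun P : ExtVar n => P.2.1) (contDiff_fst.comp contDiff_snd).contDiffOn).div_const
    ((μ ^ lam : ℝ) : ℂ)
  have h3 := hv.contDiffOn_potentialValue (lam := lam) hU (f := fun P : ExtVar n => P.1.1)
    (v := fun P : ExtVar n => P.2.2) (contDiff_fst.comp contDiff_fst).contDiffOn hD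
    (contDiff_snd.comp contDiff_snd).contDiffOn
  exact (h1.prodMk (h2.prodMk h3)).congr fun P hP => Prod.ext (h.projects P hP)
    (Prod.ext (h.coefficient P hP) (h.potential P hP))

/-- The derivative is block triangular. The `(t, x, ψ)`-part of a kernel vector is killed by the
derivative of `φ`, hence zero, and along `δ` and `V` the map is `hat` up to a nonzero factor and a
translation. -/
theorem HasExtForm.eq_zero_of_fderiv (h : HasExtForm lam U Φ φ T X S Z O μ)
    (hU : IsVarDomain U) {P : ExtVar n} (hP : P ∈ extDomain U) {w : ExtVar n}
    (hw : fderiv ℝ Φ P w = 0) : w = 0 := by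
  have hv := h.varForm
  have hO := isOpen_extDomain hU.isOpen
  have hd : HasFDerivAt Φ (fderiv ℝ Φ P) P :=
    ((((h.contDiffOn hU) P hP).contDiffAt (hO.mem_nhds hP)).differentiableAt
      (by simp)).hasFDerivAt
  have hdφ : HasFDerivAt φ (fderiv ℝ φ P.1) P.1 :=
    ((contDiffAt_two hU.isOpen (hv.contDiffOn hU) hP.1).differentiableAt (by norm_num)).hasFDerivAt
  have h1 : HasFDerivAt (fun R : ExtVar n => φ R.1)
      ((fderiv ℝ φ P.1).comp (ContinuousLinearMap.fst ℝ (Var n) (ℂ × ℂ))) P :=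
    hdφ.comp P hasFDerivAt_fst
  have h2 := hd.fst.unique (h1.congr_of_eventuallyEq (by
    filter_upwards [hO.mem_nhds hP] with R hR
    exact h.projects R hR))
  obtain ⟨v, d, e⟩ := w
  have h3 : fderiv ℝ φ P.1 v = 0 := by
    have h4 := congrArg (fun A : ExtVar n →L[ℝ] Var n => A (v, d, e)) h2
    refine (h4.symm.trans ?_)
    simp [hw]
  obtain rfl := hv.eq_zero_of_fderiv hU hP.1 h3
  have hline : HasDerivAt (fun s : ℝ => P + s • ((0, d, e) : ExtVar n)) (0, d, e) 0 :=
    hasDerivAt_line _ _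
  have hev : ∀ᶠ s : ℝ in 𝓝 0, P + s • ((0, d, e) : ExtVar n) ∈ extDomain U := by
    have h5 := hline.continuousAt.tendsto
    simp only [zero_smul, add_zero] at h5
    exact h5.eventually (hO.mem_nhds hP)
  have h6 : HasDerivAt (fun s : ℝ => Φ (P + s • ((0, d, e) : ExtVar n))) 0 0 := by
    have h7 : HasFDerivAt Φ (fderiv ℝ Φ P) (P + (0 : ℝ) • ((0, d, e) : ExtVar n)) := by
      simpa using hd
    have h8 := h7.comp_hasDerivAt 0 hline
    rwa [hw] at h8
  have hT := hv.T_ne _ (mem_timesOf hP.1)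
  have hd0 : d = 0 := by
    have h9 : HasDerivAt (fun s : ℝ => (Φ (P + s • ((0, d, e) : ExtVar n))).2.1) 0 0 :=
      h6.snd.fst
    have h10 := (hasDerivAt_hat (deriv T P.1.1.1) P.2.1 d).div_const ((μ ^ lam : ℝ) : ℂ)
    have h11 := h9.unique (h10.congr_of_eventuallyEq (by
      filter_upwards [hev] with s hs
      rw [h.coefficient _ hs]
      simp))
    rw [eq_comm, div_eq_zero_iff, hat_eq_zero, or_iff_left] at h11
    · exact h11
    · exact_mod_cast (Real.rpow_pos_of_pos h.scale_pos _).ne'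
  have he0 : e = 0 := by
    have h9 : HasDerivAt (fun s : ℝ => (Φ (P + s • ((0, d, e) : ExtVar n))).2.2) 0 0 :=
      h6.snd.snd
    have h10 := (((hasDerivAt_hat (deriv T P.1.1.1) P.2.2 e).div_const
      ((|deriv T P.1.1.1| : ℝ) : ℂ)).add_const
      (potentialShift T (fun a s => X s a) S O P.1.1.1 P.1.1.2 : ℂ)).add_const
      (Complex.I * (((1 / lam - n / 4)
        * (deriv (deriv T) P.1.1.1 / deriv T P.1.1.1 ^ 2) : ℝ) : ℂ))
    have h11 := h9.unique (h10.congr_of_eventuallyEq (by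
      filter_upwards [hev] with s hs
      rw [h.potential _ hs]
      simp [potentialValue]))
    rw [eq_comm, div_eq_zero_iff, hat_eq_zero, or_iff_left] at h11
    · exact h11
    · exact_mod_cast abs_ne_zero.2 hT
  rw [hd0, he0]; rfl

theorem HasExtForm.isEquivTransformation (h : HasExtForm lam U Φ φ T X S Z O μ)
    (hlam : lam ≠ 0) (hU : IsVarDomain U) : IsEquivTransformation lam U Φ := by
  refine ⟨h.contDiffOn hU, fun P hP => bijective_of_injective _ fun w => h.eq_zero_of_fderiv hU hP,
    φ, h.projects, fun θ hθ => ?_⟩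
  obtain ⟨θ', hadm, hrel⟩ := h.varForm.exists_admissible hlam hU h.scale_pos h.scale hθ
  refine ⟨θ', fun p hp => ?_, hadm⟩
  have hP : ((p, θ.δ, θ.V p.1) : ExtVar n) ∈ extDomain U := ⟨hp, hθ.1⟩
  refine Prod.ext ?_ ?_
  · rw [h.coefficient _ hP]
    exact (hrel p hp).1.symm
  · rw [h.potential _ hP, h.projects _ hP]
    exact (hrel p hp).2.symm

theorem exists_varForm_of_isAdmissible {θ θ' : ArbElem n} (hlam : lam ≠ 0) (a₀ : Fin n)
    (hU : IsVarDomain U) (h : IsAdmissible lam U θ φ θ') :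
    ∃ T X S Z O μ, HasVarForm U φ T X S Z O ∧ 0 < μ ∧
      ∀ t ∈ timesOf U, Real.exp (Z t) = μ * |deriv T t| ^ (-1 / lam) := by
  obtain ⟨hθ, hθ', hφ, hM⟩ := h
  obtain ⟨T, X, S, Z, O, hv⟩ := exists_varForm hlam a₀ hU hφ hM hθ'.1
  obtain ⟨μ, hμ, hZ⟩ := hv.exists_scale hlam hU hθ'.1 hθ.1 ((hv.mapsEquation_iff hU hφ.1).1 hM)
  exact ⟨T, X, S, Z, O, μ, hv, hμ, hZ⟩

/-- The parameters read off from `φ` define a map of the extended space for all `δ` and `V`. The law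
for which `φ` maps equations to equations involves only these parameters, so the map serves every
equation and carries `θ` to `θ'`. -/
theorem isNormalized (hlam : lam ≠ 0) (a₀ : Fin n) : IsNormalized n lam := by
  intro U hU θ θ' φ hadm
  obtain ⟨T, X, S, Z, O, μ, hv, hμ, hZ⟩ := exists_varForm_of_isAdmissible hlam a₀ hU hadm
  let Φ : ExtVar n → ExtVar n := fun P =>
    (φ P.1, hat (deriv T P.1.1.1) P.2.1 / ((μ ^ lam : ℝ) : ℂ),
      potentialValue lam T X S O P.1.1 P.2.2)
  have hΦ : HasExtForm lam U Φ φ T X S Z O μ :=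
    ⟨hv, fun _ _ => rfl, hμ, hZ, fun _ _ => rfl, fun _ _ => rfl⟩
  refine ⟨Φ, hΦ.isEquivTransformation hlam hU, hΦ.projects, fun p hp => ?_⟩
  obtain ⟨h1, h2⟩ := (hv.mapsEquation_iff_of_scale hlam hU hadm.2.2.1.1 hμ hZ).1 hadm.2.2.2 p hp
  exact Prod.ext h1.symm h2.symm

/-- The single equation with `δ = 1`, `V = 0` fixes the projection and its parameters. Every point
of the extended domain lies on the graph of some constant pair `(δ, V)`, where the law then gives
the remaining components. -/
theorem IsEquivTransformation.hasEquivForm (hlam : lam ≠ 0) (a₀ : Fin n) (hU : IsVarDomain U)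
    (h : IsEquivTransformation lam U Φ) : HasEquivForm lam U Φ := by
  obtain ⟨-, -, φ, hproj, hθ⟩ := h
  obtain ⟨_, -, hadm⟩ := hθ ⟨1, fun _ => 0⟩ ⟨one_ne_zero, contDiffOn_const⟩
  obtain ⟨T, X, S, Z, O, μ, hv, hμ, hZ⟩ := exists_varForm_of_isAdmissible hlam a₀ hU hadm
  have key : ∀ P ∈ extDomain U,
      (Φ P).2.1 = hat (deriv T P.1.1.1) P.2.1 / ((μ ^ lam : ℝ) : ℂ) ∧
      (Φ P).2.2 = potentialValue lam T X S O P.1.1 P.2.2 := by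
    rintro ⟨p, δ, V⟩ hP
    obtain ⟨θ', hmap, hadm'⟩ := hθ ⟨δ, fun _ => V⟩ ⟨hP.2, contDiffOn_const⟩
    obtain ⟨h1, h2⟩ := (hv.mapsEquation_iff_of_scale hlam hU hadm'.2.2.1.1 hμ hZ).1 hadm'.2.2.2
      p hP.1
    have h3 := hmap p hP.1
    simp only at h3
    rw [hproj _ hP] at h3
    rw [h3]
    exact ⟨h1, h2⟩
  exact hasEquivForm_iff.2 ⟨φ, T, X, S, Z, O, μ, hv, hproj, hμ, hZ, fun P hP => (key P hP).1,
    fun P hP => (key P hP).2⟩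

end EquivalenceGroup

end PowerNLS

theorem mainTheorem9 (n : ℕ) (hn : 1 ≤ n) (lam : ℝ) (hlam : lam ≠ 0) :
    PowerNLS.IsNormalized n lam ∧
      ∀ U : Set (PowerNLS.Var n), PowerNLS.IsVarDomain U →
        ∀ Φ : PowerNLS.ExtVar n → PowerNLS.ExtVar n,
          PowerNLS.IsEquivTransformation lam U Φ ↔ PowerNLS.HasEquivForm lam U Φ := by
  refine ⟨PowerNLS.isNormalized hlam ⟨0, hn⟩, fun U hU Φ => ⟨fun h => ?_, fun h => ?_⟩⟩
  · exact h.hasEquivForm hlam ⟨0, hn⟩ hU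
  · obtain ⟨φ, T, X, S, Z, O, μ, hΦ⟩ := PowerNLS.hasEquivForm_iff.1 h
    exact hΦ.isEquivTransformation hlam hU

end
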